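/- Let $K$ be a global function field with exact field of constants $\mathbb F=\mathbb F_q$, $\infty$ a place of $K$ with residue field of order $q_\infty=q^{d_\infty}$, $A\subset K$ the ring of elements regular away from $\infty$, $K_\infty$ the completion of $K$ at $\infty$ with $|\pi|=q_\infty^{-1}$ for a fixed uniformizer $\pi\in K$ at $\infty$, and $C_\infty$ the completed algebraic closure of $K_\infty$. Put $\log x=\log_q|x|$ for $0\ne x\in C_\infty$. An $A$-lattice of rank $r\ge 1$ in $C_\infty$ is a finitely generated $A$-submodule $\Lambda$ of rank $r$ having finite intersection with every ball of finite radius. Let $\sum'$, $\prod'$ denote sums and products over non-zero elements. For such $\Lambda$ let $e^\Lambda(z)=z\prod'_{\lambda\in\Lambda}(1-z/\lambda)$ and $\Lambda_N=\{\lambda\in\Lambda : \log\lambda\le N\}$ (with $0 \in \Lambda_N$). For $0\ne a\in A$ of degree $d=\deg a=\dim_{\mathbb F}A/(a)$ let $\phi_a^\Lambda(X)=aX+\sum_{1\le i\le rd}\ell_iX^{q^i}$ be the polynomial with $e^\Lambda(az)=\phi_a^\Lambda(e^\Lambda(z))$, and let $\Delta_a(\Lambda)$ be its coefficient of $X^{q^{rd}}$.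 For lattices $\Lambda\subset\Lambda'$ of rank $r$ let $\Delta(\Lambda'|\Lambda)$ be the leading coefficient of the unique $\mathbb F$-linear polynomial $\varphi$ of degree $[\Lambda':\Lambda]$ with linear coefficient $1$ and $e^{\Lambda'}=\varphi\circ e^\Lambda$. For $0\ne a\in A$ let $\operatorname{sgn}(a)$ be the $(q_\infty-1)$-th root of unity in $C_\infty$ such that $|a\pi^m-\operatorname{sgn}(a)|<1$ for some $m\in\mathbb Z$. Put $w_r=q_\infty^r-1$. The canonical discriminant $\Delta(\Lambda)$ is the element of $C_\infty$ such that, for all $0\ne a\in A$ of degree $d$, $$\Delta_a(\Lambda)=\operatorname{sgn}(a)^{\#\Lambda_N}\,\Delta(\Lambda)^{(q^{rd}-1)/w_r}\qquad (N\gg0).$$ (It exists and is unique; the factor $\operatorname{sgn}(a)^{\#\Lambda_N}$ is stationary for $N\gg 0$, and equals $\operatorname{sgn}(a)$ if $d_\infty=1$.) Finally let $Z_\Lambda(S)=\sum'_{\lambda\in\Lambda}S^{\log\lambda}$; for a common denominator $n$ of the exponents it is the Laurent expansion in $S^{1/n}$ of a rational function of $S^{1/n}$ that is regular at $S^{1/n}=1$.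 Let $Z_\Lambda'(1)\in\mathbb Q$ be the value at $S=1$ (i.e. $S^{1/n}=1$) of $\frac{d}{dS}Z_\Lambda$. Then, for all $A$-lattices $\Lambda\subset\Lambda'$ of rank $r\geq 1$ in $C_\infty$: (i) $|\Delta(\Lambda'|\Lambda)|=q^{k}$ with $k=[\Lambda':\Lambda]\,Z_\Lambda'(1)-Z_{\Lambda'}'(1)$; (ii) $|\Delta_a(\Lambda)|=q^{k}$ with $k=(q^{rd}-1)Z_\Lambda'(1)$, for all $0\ne a\in A$ of degree $d$; (iii) $|\Delta(\Lambda)|=q^{k}$ with $k=w_rZ_\Lambda'(1)$; and the same holds with $\Delta(\Lambda)$ replaced by any $D\in C_\infty$ such that for every $0\ne a\in A$ one has $\Delta_a(\Lambda)=\zeta_a D^{(q^{r\deg a}-1)/w_r}$ with some root of unity $\zeta_a$. -/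

import Mathlib

open Polynomial IsLocalRing
open scoped RatFunc IntermediateField LaurentSeries

/-- `K` is a global function field with (exact) field of constants `F`. -/
class IsGlobalFunctionField (F K : Type*) [Field F] [Field K] [Algebra F K] : Prop where
  finite_constants : Finite F
  functionField : ∃ _ : Algebra (RatFunc F) K, IsScalarTower F (RatFunc F) K ∧ FunctionField F K
  constants_closed : ∀ x : K, IsAlgebraic F x → x ∈ Set.range (algebraMap F K)

namespace DrinfeldLattice

section Residue

variable (F : Type*) {K : Type*} [Field F] [Field K] [Algebra F K] [IsGlobalFunctionField F K]

theorem constants_mem (W : ValuationSubring K) (c : F) : algebraMap F K c ∈ W := by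
  have := IsGlobalFunctionField.finite_constants (F := F) (K := K)
  have : Fintype F := Fintype.ofFinite F
  rcases eq_or_ne c 0 with rfl | hc
  · simp
  · have h : (algebraMap F K c) ^ (Fintype.card F - 1) = 1 := by
      rw [← map_pow, FiniteField.pow_card_sub_one_eq_one c hc, map_one]
    have hpos : 0 < Fintype.card F - 1 := by
      have := Fintype.one_lt_card (α := F); omega
    rw [← W.valuation_le_one_iff]
    have h2 := congrArg W.valuation h
    rw [map_pow, map_one] at h2
    exact ((pow_eq_one_iff_of_nonneg zero_le hpos.ne').1 h2).le

theorem exists_dependence (s : K) (hs : Transcendental F s) :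
    ∃ n : ℕ, ∀ x : Fin n → K, ∃ p : Fin n → F[X], (∃ i, ¬ X ∣ p i) ∧
      ∑ i, aeval s (p i) * x i = 0 := by
  obtain ⟨_, _, _⟩ := IsGlobalFunctionField.functionField (F := F) (K := K)
  have hfin : FiniteDimensional F⟮s⟯ K := FunctionField.finiteDimensional_of_adjoin_transcendental hs
  refine ⟨Module.finrank F⟮s⟯ K + 1, fun x ↦ ?_⟩
  have hs0 : s ≠ 0 := by rintro rfl; exact hs isAlgebraic_zero
  have key : ∃ d : ℕ, ∃ p : Fin (Module.finrank F⟮s⟯ K + 1) → F[X], p ≠ 0 ∧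
      (∑ i, aeval s (p i) * x i = 0) ∧ ∑ i, (p i).natDegree = d := by
    have hx : ¬ LinearIndependent F⟮s⟯ x := fun h ↦ by
      have := h.fintype_card_le_finrank; simp at this
    open scoped RatFunc IntermediateField.algebraAdjoinAdjoin in
    rw [← LinearIndependent.iff_fractionRing (Algebra.adjoin F {s}) F⟮s⟯,
      Fintype.linearIndependent_iff] at hx
    push Not at hx
    obtain ⟨g, hg, i, hi⟩ := hx
    have hp : ∀ i, ∃ p : F[X], aeval s p = (g i : K) := fun i ↦ by
      have h := (Algebra.adjoin_singleton_eq_range_aeval F s).le (g i).2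
      exact h
    choose p hp using hp
    refine ⟨_, p, ?_, ?_, rfl⟩
    · rintro rfl
      apply hi
      have := hp i
      simp at this
      exact Subtype.ext this.symm
    · rw [← hg]
      exact Finset.sum_congr rfl fun i _ ↦ by rw [hp i]; rfl
  classical
  obtain ⟨p, hp0, hp, hd⟩ := Nat.find_spec key
  refine ⟨p, ?_, hp⟩
  by_contra hcon
  push Not at hcon
  choose r hr using hcon
  refine Nat.find_min key (m := ∑ i, (r i).natDegree) ?_ ⟨r, ?_, ?_, rfl⟩
  · rw [← hd]
    obtain ⟨i, hi⟩ : ∃ i, p i ≠ 0 := by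
      by_contra! h; exact hp0 (funext h)
    refine Finset.sum_lt_sum (fun j _ ↦ ?_) ⟨i, Finset.mem_univ _, ?_⟩
    · rw [hr j]
      rcases eq_or_ne (r j) 0 with h | h
      · simp [h]
      · rw [natDegree_X_mul h]; omega
    · have : r i ≠ 0 := by rintro h; apply hi; rw [hr i, h, mul_zero]
      conv_rhs => rw [hr i]
      rw [natDegree_X_mul this]; omega
  · rintro rfl; apply hp0; funext i; rw [hr i]; simp
  · have : s * ∑ i, aeval s (r i) * x i = 0 := by
      rw [← hp, Finset.mul_sum]
      refine Finset.sum_congr rfl fun i _ ↦ ?_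
      conv_rhs => rw [hr i]
      simp [mul_assoc]
    exact (mul_eq_zero.1 this).resolve_left hs0

theorem finite_residueField (F : Type*) {K : Type*} [Field F] [Field K] [Algebra F K]
    [IsGlobalFunctionField F K] (O : ValuationSubring K) [IsDiscreteValuationRing O] :
    Finite (ResidueField O) := by
  have := IsGlobalFunctionField.finite_constants (F := F) (K := K)
  let _ : Algebra F O := ((algebraMap F K).codRestrict O.toSubring (constants_mem F O)).toAlgebra
  have _ : IsScalarTower F O K := IsScalarTower.of_algebraMap_eq fun _ ↦ rfl
  obtain ⟨s, hs⟩ := IsDiscreteValuationRing.exists_irreducible O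
  have hsm : residue O s = 0 := (residue_eq_zero_iff s).2 ((mem_maximalIdeal s).2 hs.not_isUnit)
  have htr : Transcendental F (s : K) := by
    intro h
    obtain ⟨c, hc⟩ := IsGlobalFunctionField.constants_closed (F := F) (s : K) h
    have hcs : algebraMap F O c = s := Subtype.ext hc
    apply hs.not_isUnit
    rw [← hcs]
    refine (IsUnit.mk0 c ?_).map _
    rintro rfl
    apply hs.ne_zero
    rw [← hcs, map_zero]
  obtain ⟨n, hn⟩ := exists_dependence F (s : K) htr
  have : Module.Finite F (ResidueField O) := by
    rw [← Module.rank_lt_aleph0_iff]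
    by_contra! hlt
    obtain ⟨v, hv⟩ := exists_linearIndependent_of_le_rank
      ((Cardinal.natCast_le_aleph0 (n := n)).trans hlt)
    choose x hx using fun i ↦ residue_surjective (R := O) (v i)
    obtain ⟨p, ⟨i, hi⟩, hp⟩ := hn fun i ↦ (x i : K)
    have hp' : ∑ i, aeval s (p i) * x i = 0 := by
      apply IsFractionRing.injective O K
      have h : ∀ i, ((aeval s (p i) : O) : K) = aeval (s : K) (p i) := fun i ↦
        (aeval_algebraMap_apply K s (p i)).symm
      rw [map_sum, map_zero, ← hp]
      refine Finset.sum_congr rfl fun i _ ↦ ?_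
      rw [map_mul, ← h]
      rfl
    have h2 := congrArg (residue O) hp'
    rw [map_sum, map_zero] at h2
    have h3 : ∀ i, residue O (aeval s (p i)) = algebraMap F _ ((p i).coeff 0) := fun i ↦ by
      have := aeval_algebraMap_apply (ResidueField O) s (p i)
      rw [IsLocalRing.ResidueField.algebraMap_eq, hsm] at this
      rw [← this, coeff_zero_eq_aeval_zero']
    have h4 : ∑ i, (p i).coeff 0 • v i = 0 := by
      rw [← h2]
      refine Finset.sum_congr rfl fun i _ ↦ ?_
      rw [map_mul, h3, hx, Algebra.smul_def]
    exact hi (X_dvd_iff.2 (Fintype.linearIndependent_iff.1 hv _ h4 i))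
  exact Module.finite_of_finite F
end Residue

noncomputable section

section Field

variable (F : Type*) {K : Type*} [Field F] [Field K] [Algebra F K] [IsGlobalFunctionField F K]
  (O : ValuationSubring K) [IsDiscreteValuationRing O]

/-- `q_∞ = q ^ d_∞`, the order of the residue field at the place `∞` with valuation ring `O`. -/
def qInf {K : Type*} [Field K] (O : ValuationSubring K) : ℕ := Nat.card (ResidueField O)

theorem one_lt_qInf (F : Type*) {K : Type*} [Field F] [Field K] [Algebra F K]
    [IsGlobalFunctionField F K] (O : ValuationSubring K) [IsDiscreteValuationRing O] :
    (1 : NNReal) < (qInf O : NNReal) := by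
  have := finite_residueField F O
  exact_mod_cast Finite.one_lt_card (α := ResidueField O)

/-- The absolute value of `K` at `∞`, normalized by `|π| = q_∞⁻¹` for a uniformizer `π`. -/
def absInf : AbsoluteValue K ℝ :=
  (IsDiscreteValuationRing.maximalIdeal O).adicAbv (K := K) (one_lt_qInf F O)

theorem absInf_uniformizer {π : O} (hπ : Irreducible π) :
    absInf F O (π : K) = (qInf O : ℝ)⁻¹ := by
  have h : (IsDiscreteValuationRing.maximalIdeal O).valuation K (algebraMap O K π) =
      WithZero.exp (-1 : ℤ) := by
    rw [IsDedekindDomain.HeightOneSpectrum.valuation_of_algebraMap]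
    exact IsDedekindDomain.HeightOneSpectrum.intValuation_singleton _ hπ.ne_zero
      hπ.maximalIdeal_eq
  have h2 : absInf F O (π : K) = (WithZeroMulInt.toNNReal (ne_zero_of_lt (one_lt_qInf F O))
      ((IsDiscreteValuationRing.maximalIdeal O).valuation K (algebraMap O K π)) : NNReal) := rfl
  rw [h2, h, WithZeroMulInt.toNNReal_neg_apply _ WithZero.exp_ne_zero]
  rw [NNReal.coe_zpow]
  exact zpow_neg_one (qInf O : ℝ)

/-- The completion `K_∞` of `K` at `∞`. -/
abbrev KInf : Type _ := (absInf F O).Completion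

instance : IsUltrametricDist (KInf F O) := by
  refine IsUltrametricDist.isUltrametricDist_of_forall_norm_add_le_max_norm fun x y ↦ ?_
  refine UniformSpace.Completion.induction_on₂ x y
    (isClosed_le (by fun_prop) (by fun_prop)) fun a b ↦ ?_
  rw [← UniformSpace.Completion.coe_add]
  simp only [UniformSpace.Completion.norm_coe]
  exact (IsDiscreteValuationRing.maximalIdeal O).isNonarchimedean_adicAbv
    (one_lt_qInf F O) a.ofAbs b.ofAbs

instance : NontriviallyNormedField (KInf F O) where
  non_trivial := by
    obtain ⟨π, hπ⟩ := IsDiscreteValuationRing.exists_irreducible O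
    refine ⟨((WithAbs.equiv (absInf F O)).symm ((π : K)⁻¹) : (absInf F O).Completion), ?_⟩
    rw [UniformSpace.Completion.norm_coe]
    change 1 < absInf F O ((π : K)⁻¹)
    rw [map_inv₀, absInf_uniformizer F O hπ, inv_inv]
    exact_mod_cast one_lt_qInf F O

/-- The algebraic closure of `K_∞`, with the unique extension of the absolute value. -/
def KInfAlg : Type _ := AlgebraicClosure (KInf F O)

instance : Field (KInfAlg F O) := inferInstanceAs (Field (AlgebraicClosure (KInf F O)))
instance : Algebra (KInf F O) (KInfAlg F O) :=
  inferInstanceAs (Algebra (KInf F O) (AlgebraicClosure (KInf F O)))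
instance : IsAlgClosure (KInf F O) (KInfAlg F O) :=
  inferInstanceAs (IsAlgClosure (KInf F O) (AlgebraicClosure (KInf F O)))
instance : Algebra.IsAlgebraic (KInf F O) (KInfAlg F O) := IsAlgClosure.isAlgebraic
instance : NormedField (KInfAlg F O) := spectralNorm.normedField (KInf F O) (KInfAlg F O)

/-- `C_∞`, the completed algebraic closure of `K_∞`. -/
def CInf : Type _ := UniformSpace.Completion (KInfAlg F O)

instance : NormedField (CInf F O) :=
  inferInstanceAs (NormedField (UniformSpace.Completion (KInfAlg F O)))
instance : CompleteSpace (CInf F O) :=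
  inferInstanceAs (CompleteSpace (UniformSpace.Completion (KInfAlg F O)))

/-- The embedding of `K` into `C_∞`. -/
def embC : K →+* CInf F O :=
  (UniformSpace.Completion.coeRingHom (α := KInfAlg F O)).comp
    ((algebraMap (KInf F O) (KInfAlg F O)).comp
      ((UniformSpace.Completion.coeRingHom (α := WithAbs (absInf F O))).comp
        (WithAbs.equiv (absInf F O)).symm.toRingHom))

instance : Algebra K (CInf F O) := (embC F O).toAlgebra

theorem norm_algebraMap_CInf (x : K) : ‖algebraMap K (CInf F O) x‖ = absInf F O x := by
  change ‖((algebraMap (KInf F O) (KInfAlg F O)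
    (((WithAbs.equiv (absInf F O)).symm x : WithAbs (absInf F O)) : KInf F O) : KInfAlg F O) :
      UniformSpace.Completion (KInfAlg F O))‖ = _
  rw [UniformSpace.Completion.norm_coe]
  refine (spectralNorm_extends _).trans ?_
  rw [UniformSpace.Completion.norm_coe]
  rfl

/-- The Drinfeld coefficient ring `A`: the elements of `K` regular at all places other than `∞`. -/
def coeffRing : Subalgebra F K where
  carrier := {x | ∀ W : ValuationSubring K, IsDiscreteValuationRing W → W ≠ O → x ∈ W}
  mul_mem' hx hy W h h' := W.mul_mem _ _ (hx W h h') (hy W h h')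
  add_mem' hx hy W h h' := W.add_mem _ _ (hx W h h') (hy W h h')
  algebraMap_mem' c W _ _ := constants_mem F W c

/-- The degree of `a ∈ A`, that is `dim_F A / (a)` (for `a ≠ 0`). -/
def degA (a : coeffRing F O) : ℕ := Module.finrank F (coeffRing F O ⧸ Ideal.span {a})

end Field

section Lattice

variable {F K : Type*} [Field F] [Field K] [Algebra F K] [IsGlobalFunctionField F K]
  {O : ValuationSubring K} [IsDiscreteValuationRing O]

/-- `Λ` is an `A`-lattice of rank `r` in `C_∞`: finitely generated, of rank `r`, and with finite
intersection with each ball of finite radius. -/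
structure IsLattice (Λ : Submodule (coeffRing F O) (CInf F O)) (r : ℕ) : Prop where
  fg : Λ.FG
  finrank_eq : Module.finrank (coeffRing F O) Λ = r
  discrete : ∀ R : ℝ, {x : CInf F O | x ∈ Λ ∧ ‖x‖ ≤ R}.Finite

/-- The index `[Λ' : Λ]` of a lattice pair `Λ ⊆ Λ'`. -/
def latticeIndex (Λ Λ' : Submodule (coeffRing F O) (CInf F O)) : ℕ :=
  Λ.toAddSubgroup.relIndex Λ'.toAddSubgroup

/-- The exponential function `e^Λ(z) = z ∏' (1 - z / λ)`, the product being over `0 ≠ λ ∈ Λ`. -/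
def expFn (Λ : Submodule (coeffRing F O) (CInf F O)) (z : CInf F O) : CInf F O :=
  z * ∏' x : {x : CInf F O // x ∈ Λ ∧ x ≠ 0}, (1 - z / x)

/-- `φ` is the normalized isogeny of the lattice pair `Λ ⊆ Λ'`: the `F`-linear polynomial of degree
`[Λ' : Λ]` with linear coefficient `1` such that `e^Λ' = φ ∘ e^Λ`. -/
structure IsNormalizedIsogeny (Λ Λ' : Submodule (coeffRing F O) (CInf F O))
    (φ : (CInf F O)[X]) : Prop where
  linear : ∀ i ∈ φ.support, ∃ j : ℕ, i = Nat.card F ^ j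
  coeff_one : φ.coeff 1 = 1
  natDegree_eq : φ.natDegree = latticeIndex Λ Λ'
  comp : ∀ z, expFn Λ' z = φ.eval (expFn Λ z)

open Classical in
/-- `Δ(Λ' | Λ)`, the leading coefficient of the normalized isogeny `φ` of `Λ ⊆ Λ'`
(with value `0` if there were not exactly one such `φ`). -/
def pairDiscr (Λ Λ' : Submodule (coeffRing F O) (CInf F O)) : CInf F O :=
  if h : ∃! φ, IsNormalizedIsogeny Λ Λ' φ then h.exists.choose.leadingCoeff else 0

/-- `φ` is the polynomial `φ_a^Λ = a X + ∑_{1 ≤ i ≤ r deg a} ℓ_i X ^ (q ^ i)` with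
`e^Λ (a z) = φ_a^Λ (e^Λ z)`. -/
structure IsDrinfeldPoly (Λ : Submodule (coeffRing F O) (CInf F O)) (r : ℕ)
    (a : coeffRing F O) (φ : (CInf F O)[X]) : Prop where
  shape : ∀ i ∈ φ.support, ∃ j ≤ r * degA F O a, i = Nat.card F ^ j
  coeff_one : φ.coeff 1 = algebraMap K (CInf F O) a
  comp : ∀ z, expFn Λ (algebraMap K (CInf F O) a * z) = φ.eval (expFn Λ z)

open Classical in
/-- `Δ_a(Λ)`, the coefficient of `X ^ (q ^ (r deg a))` in `φ_a^Λ`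
(with value `0` if there were not exactly one such polynomial). -/
def drinfeldDiscr (Λ : Submodule (coeffRing F O) (CInf F O)) (r : ℕ) (a : coeffRing F O) : CInf F O :=
  if h : ∃! φ, IsDrinfeldPoly Λ r a φ then
    h.exists.choose.coeff (Nat.card F ^ (r * degA F O a)) else 0

/-- `ζ = sgn(a)` with respect to the uniformizer `π`: the `(q_∞ - 1)`-th root of unity `ζ` with
`a = ζ π ^ (-m) u` for an integer `m` and a `1`-unit `u`. -/
def IsSgn (π : O) (a : coeffRing F O) (ζ : CInf F O) : Prop :=
  ζ ^ (qInf O - 1) = 1 ∧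
    ∃ m : ℤ, ‖algebraMap K (CInf F O) ((a : K) * (π : K) ^ m) - ζ‖ < 1

/-- The exponent `(q ^ (r deg a) - 1) / (q_∞ ^ r - 1)`. -/
def discrExponent (r : ℕ) (a : coeffRing F O) : ℕ :=
  (Nat.card F ^ (r * degA F O a) - 1) / (qInf O ^ r - 1)

/-- `D` is a canonical discriminant of `Λ`: for all `0 ≠ a ∈ A` and all large `N`,
`Δ_a(Λ) = sgn(a) ^ #Λ_N · D ^ ((q ^ (r deg a) - 1) / w_r)`. -/
def IsCanonicalDiscr (π : O) (Λ : Submodule (coeffRing F O) (CInf F O)) (r : ℕ)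
    (D : CInf F O) : Prop :=
  ∀ a : coeffRing F O, a ≠ 0 → ∃ ζ, IsSgn π a ζ ∧ ∀ᶠ R : ℝ in Filter.atTop,
    drinfeldDiscr Λ r a =
      ζ ^ Nat.card {x : CInf F O // x ∈ Λ ∧ ‖x‖ ≤ R} * D ^ discrExponent r a

open Classical in
/-- The canonical discriminant `Δ(Λ)`
(with value `0` if there were not exactly one element as required). -/
def canonicalDiscr (π : O) (Λ : Submodule (coeffRing F O) (CInf F O)) (r : ℕ) : CInf F O :=
  if h : ∃! D, IsCanonicalDiscr π Λ r D then h.exists.choose else 0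

/-- `log x = log_q |x|`. -/
def logq (x : CInf F O) : ℝ := Real.logb (Nat.card F) ‖x‖

/-- `n ≥ 1` is a common denominator of all `log x`, `0 ≠ x ∈ Λ`, and the Laurent series in
`T = S ^ (1 / n)` given by `Z_Λ(S) = ∑_{0 ≠ x ∈ Λ} S ^ (log x)` is the Laurent expansion of the
rational function `f`. -/
structure IsZFunction (Λ : Submodule (coeffRing F O) (CInf F O)) (n : ℕ) (f : RatFunc ℚ) :
    Prop where
  pos : 0 < n
  denominator : ∀ x ∈ Λ, x ≠ 0 → ∃ m : ℤ, logq x = m / n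
  coeff_eq : ∀ m : ℤ, (algebraMap (RatFunc ℚ) ℚ⸨X⸩ f).coeff m =
    Nat.card {x : CInf F O // x ∈ Λ ∧ x ≠ 0 ∧ logq x = m / n}

/-- `z` is the derivative `Z_Λ'(1) = dZ_Λ/dS (1)`. If `Z_Λ = f(S ^ (1 / n))`, this is `f'(1) / n`,
where `f` has no pole at `1`. -/
def IsZDerivAtOne (Λ : Submodule (coeffRing F O) (CInf F O)) (z : ℚ) : Prop :=
  ∃ (n : ℕ) (f : RatFunc ℚ), IsZFunction Λ n f ∧ f.denom.eval 1 ≠ 0 ∧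
    z = ((derivative f.num).eval 1 * f.denom.eval 1 - f.num.eval 1 * (derivative f.denom).eval 1) /
      f.denom.eval 1 ^ 2 / n

open Classical in
/-- `Z_Λ'(1)` (with value `0` if it did not exist). -/
def zDeriv (Λ : Submodule (coeffRing F O) (CInf F O)) : ℚ :=
  if h : ∃! z, IsZDerivAtOne Λ z then h.exists.choose else 0

end Lattice

end

end DrinfeldLattice

open DrinfeldLattice

set_option linter.unusedSectionVars false

/-! ### Polynomial relations and valuation rings in a global function field -/

namespace DrinfeldLattice

section FunctionField

variable {F K : Type*} [Field F] [Field K] [Algebra F K] [IsGlobalFunctionField F K]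

/-! The discriminants are limits of quotients of finite products. Let c_R(Λ) be the product of -λ
over the nonzero λ in Λ with |λ| ≤ R, and Λ_R the set of all λ in Λ with |λ| ≤ R. By the ultrametric
inequality Λ_R is a finite F-space, so the monic polynomial with zero set Λ_R is F-linear; its
linear coefficient is c_R(Λ). Divided by c_R(Λ), it converges to e^Λ as R grows. If Λ' = Λ ⊕ T with
T finite, then Λ'_R = Λ_R ⊕ T for large R. Comparing linear coefficients gives Δ(Λ'|Λ) = lim
c_R(Λ)^[Λ':Λ] / c_R(Λ') (`tendsto_nzProd_div`). Applied to aΛ ⊆ Λ, this yields, with d = deg a,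
Δ_a(Λ) = lim (a^(#Λ_R) c_R(Λ))^(q^(rd)) / c_(|a|R)(Λ) (`IsLattice.tendsto_drinfeldDiscr`).

The same splitting Λ = aΛ ⊕ T shows that large spheres of Λ are q^(rd) times as numerous as those
with logarithm smaller by d. Hence (1 - q^(rd) S^d) Z_Λ has finitely many terms. Let L(N) = log c_R
and B(N) = #Λ_R for R = q^N. Evaluating this finite sum and its derivative at 1 gives Z_Λ(1) = -1
and, for large N, (q^(rd) - 1) Z_Λ'(1) = q^(rd) L(N) - L(N+d) + d q^(rd) B(N)
(`IsLattice.zDeriv_formula`). The right side is the logarithm of the expression converging to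
Δ_a(Λ), which is (ii). For (i), the formulas for Λ and Λ' are combined; the ball terms cancel
because #Λ'_R = [Λ':Λ] #Λ_R. For (iii), logarithms are divided by the exponent (q^(rd) - 1)/w_r.

The canonical discriminant is obtained by writing a = u π^(-m) with |u| = 1. The limit formula for
Δ_a splits into u^(#Λ_R) and a factor depending only on m, which tends to a power of one limit D
(`IsLattice.tendsto_discrSeq`). As #Λ_R is a power of q tending to infinity, the 1-unit part of u
disappears and sgn(a)^(#Λ_R) remains.

All this rests on |a| = q^(deg a) (`absInf_eq_pow_degA`) and on nonconstant elements of A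
(`exists_nonconstant`). Both come from dimension counts: dim B/(t) ≤ [K : F(t)] for F-subalgebras B
and transcendental t, played against the number of polynomial combinations of bounded degree. -/

theorem finiteDimensional_adjoin (s : K) (hs : Transcendental F s) :
    FiniteDimensional F⟮s⟯ K := by
  obtain ⟨_, _, _⟩ := IsGlobalFunctionField.functionField (F := F) (K := K)
  exact FunctionField.finiteDimensional_of_adjoin_transcendental hs

/-- `F⟮s⟯` is the fraction field of F[s], so the denominators of a relation can be cleared. -/
theorem exists_aeval_of_not_linearIndependent {s : K} {ι : Type*} [Fintype ι] {x : ι → K}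
    (hx : ¬ LinearIndependent F⟮s⟯ x) :
    ∃ p : ι → F[X], (∃ i, aeval s (p i) ≠ 0) ∧ ∑ i, aeval s (p i) * x i = 0 := by
  open scoped RatFunc IntermediateField.algebraAdjoinAdjoin in
  rw [← LinearIndependent.iff_fractionRing (Algebra.adjoin F {s}) F⟮s⟯,
    Fintype.linearIndependent_iff] at hx
  push Not at hx
  obtain ⟨g, hg, i, hi⟩ := hx
  have hp : ∀ i, ∃ p : F[X], aeval s p = (g i : K) := fun i ↦
    (Algebra.adjoin_singleton_eq_range_aeval F s).le (g i).2
  choose p hp using hp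
  refine ⟨p, ⟨i, ?_⟩, ?_⟩
  · rw [hp]
    exact fun h ↦ hi (Subtype.ext h)
  · rw [← hg]
    exact Finset.sum_congr rfl fun i _ ↦ by rw [hp i]; rfl

/-- A linear dependence over `F(s)` can be written with polynomials not all divisible by `s`. -/
theorem exists_dependence_of_not_linearIndependent {s : K} (hs : s ≠ 0)
    {ι : Type*} [Fintype ι] {x : ι → K} (hx : ¬ LinearIndependent F⟮s⟯ x) :
    ∃ p : ι → F[X], (∃ i, ¬ X ∣ p i) ∧ ∑ i, aeval s (p i) * x i = 0 := by
  have key : ∃ d : ℕ, ∃ p : ι → F[X], p ≠ 0 ∧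
      (∑ i, aeval s (p i) * x i = 0) ∧ ∑ i, (p i).natDegree = d := by
    obtain ⟨p, ⟨i, hi⟩, hp⟩ := exists_aeval_of_not_linearIndependent hx
    exact ⟨_, p, by rintro rfl; simp at hi, hp, rfl⟩
  classical
  obtain ⟨p, hp0, hp, hd⟩ := Nat.find_spec key
  refine ⟨p, ?_, hp⟩
  by_contra hcon
  push Not at hcon
  choose r hr using hcon
  -- In a relation of minimal total degree the coefficients cannot all be divisible by `X`:
  -- cancelling `s` would lower the degree.
  refine Nat.find_min key (m := ∑ i, (r i).natDegree) ?_ ⟨r, ?_, ?_, rfl⟩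
  · rw [← hd]
    obtain ⟨i, hi⟩ : ∃ i, p i ≠ 0 := by
      by_contra! h; exact hp0 (funext h)
    refine Finset.sum_lt_sum (fun j _ ↦ ?_) ⟨i, Finset.mem_univ _, ?_⟩
    · rw [hr j]
      rcases eq_or_ne (r j) 0 with h | h
      · simp [h]
      · rw [natDegree_X_mul h]; omega
    · have : r i ≠ 0 := by rintro h; apply hi; rw [hr i, h, mul_zero]
      conv_rhs => rw [hr i]
      rw [natDegree_X_mul this]; omega
  · rintro rfl; apply hp0; funext i; rw [hr i]; simp
  · have : s * ∑ i, aeval s (r i) * x i = 0 := by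
      rw [← hp, Finset.mul_sum]
      refine Finset.sum_congr rfl fun i _ ↦ ?_
      conv_rhs => rw [hr i]
      simp [mul_assoc]
    exact (mul_eq_zero.1 this).resolve_left hs

theorem aeval_sub_coeff_zero_mem_span {B : Subalgebra F K} (t : B) (p : F[X]) :
    aeval t p - algebraMap F B (p.coeff 0) ∈ Ideal.span {t} := by
  rw [Ideal.mem_span_singleton]
  have h : X ∣ p - C (p.coeff 0) := X_dvd_iff.2 (by simp)
  obtain ⟨r, hr⟩ := h
  refine ⟨aeval t r, ?_⟩
  have := congrArg (aeval t) hr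
  simpa using this

/-- A relation over F(t) can be written with polynomials whose constant terms are not all zero.
Modulo `t` only these constant terms survive and give a nontrivial relation over `F`. -/
theorem linearIndependent_of_mk {B : Subalgebra F K} (t : B) (ht : (t : K) ≠ 0)
    {ι : Type*} [Fintype ι] (x : ι → B)
    (hx : LinearIndependent F fun i ↦ Ideal.Quotient.mk (Ideal.span {t}) (x i)) :
    LinearIndependent F⟮(t : K)⟯ fun i ↦ (x i : K) := by
  by_contra hcon
  obtain ⟨p, ⟨i, hi⟩, hp⟩ := exists_dependence_of_not_linearIndependent ht hcon
  apply hi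
  rw [X_dvd_iff]
  refine Fintype.linearIndependent_iff.1 hx (fun i ↦ (p i).coeff 0) ?_ i
  have h0 : ∑ i, aeval t (p i) * x i = 0 := by
    apply Subtype.ext
    simpa using hp
  rw [← map_zero (Ideal.Quotient.mk (Ideal.span {t})), ← h0, map_sum]
  refine Finset.sum_congr rfl fun i _ ↦ ?_
  refine (map_smul (Ideal.Quotient.mkₐ F (Ideal.span {t})) ((p i).coeff 0) (x i)).symm.trans ?_
  rw [Algebra.smul_def]
  refine ((Ideal.Quotient.mk_eq_mk_iff_sub_mem _ _).2 ?_).symm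
  rw [← sub_mul]
  exact Ideal.mul_mem_right _ _ (aeval_sub_coeff_zero_mem_span t (p i))

theorem exists_linearIndependent_fin_of_not_finite_or_lt {V : Type*} [AddCommGroup V] [Module F V]
    {n : ℕ} (h : ¬ (Module.Finite F V ∧ Module.finrank F V ≤ n)) :
    ∃ v : Fin (n + 1) → V, LinearIndependent F v := by
  apply exists_linearIndependent_of_le_rank
  by_contra! hlt
  apply h
  have : Module.Finite F V := Module.rank_lt_aleph0_iff.1 (hlt.trans (Cardinal.natCast_lt_aleph0))
  refine ⟨this, ?_⟩
  rw [← Module.finrank_eq_rank] at hlt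
  have : Module.finrank F V < n + 1 := by exact_mod_cast hlt
  omega

/-- The upper bound behind all later counts. It holds for every subalgebra `B`, so it applies to
`A`, to valuation rings and to their intersections alike. -/
theorem finite_quotient_and_finrank_le {B : Subalgebra F K} (t : B)
    (ht : Transcendental F (t : K)) :
    Module.Finite F (B ⧸ Ideal.span {t}) ∧
      Module.finrank F (B ⧸ Ideal.span {t}) ≤ Module.finrank F⟮(t : K)⟯ K := by
  have := finiteDimensional_adjoin (t : K) ht
  have ht0 : (t : K) ≠ 0 := by intro h; rw [h] at ht; exact ht isAlgebraic_zero
  by_contra hcon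
  obtain ⟨v, hv⟩ := exists_linearIndependent_fin_of_not_finite_or_lt hcon
  choose x hx using fun i ↦ Ideal.Quotient.mk_surjective (v i)
  have := (linearIndependent_of_mk t ht0 x (by simpa only [hx] using hv)).fintype_card_le_finrank
  simp at this

/-- A valuation subring of a global function field, as a subalgebra over the constants. -/
def valSubalgebra (F : Type*) {K : Type*} [Field F] [Field K] [Algebra F K]
    [IsGlobalFunctionField F K] (W : ValuationSubring K) : Subalgebra F K :=
  { W.toSubring with algebraMap_mem' := constants_mem F W }

theorem mem_valSubalgebra {W : ValuationSubring K} {x : K} : x ∈ valSubalgebra F W ↔ x ∈ W :=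
  Iff.rfl

theorem algebraMap_notMem_nonunits {W : ValuationSubring K} {c : F}
    (h : algebraMap F K c ∈ W.nonunits) : c = 0 := by
  by_contra hc
  have h2 : (algebraMap F K c⁻¹)⁻¹ ∈ W.nonunits := by simpa using h
  rw [W.inv_mem_nonunits_iff] at h2
  rcases h2 with h2 | h2
  · simp at h2; exact hc h2
  · exact h2 (constants_mem F W _)

theorem transcendental_of_mem_nonunits {W : ValuationSubring K} {x : K} (hx : x ≠ 0)
    (hxW : x ∈ W.nonunits) : Transcendental F x := by
  intro h
  obtain ⟨c, rfl⟩ := IsGlobalFunctionField.constants_closed (F := F) x h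
  rw [algebraMap_notMem_nonunits hxW] at hx
  simp at hx

/-- Non-trivial valuation rings of a global function field are discrete. -/
theorem isDiscreteValuationRing_of_ne_top (F : Type*) {K : Type*} [Field F] [Field K] [Algebra F K]
    [IsGlobalFunctionField F K] (W : ValuationSubring K) {y : K} (hy : y ∉ W) :
    IsDiscreteValuationRing W := by
  have hy0 : y ≠ 0 := by rintro rfl; exact hy W.zero_mem
  have hyi : y⁻¹ ∈ W.nonunits := (W.inv_mem_nonunits_iff).2 (Or.inr hy)
  have hfield : ¬ IsField W := by
    intro h
    obtain ⟨hm, hmem⟩ := ValuationSubring.mem_nonunits_iff_exists_mem_maximalIdeal.1 hyi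
    have := (IsLocalRing.isField_iff_maximalIdeal_eq.1 h)
    rw [this] at hmem
    have := congrArg (Subtype.val) ((Submodule.mem_bot _).1 hmem)
    exact hy0 (inv_eq_zero.1 this)
  have hN : IsNoetherianRing W := by
    refine ⟨fun (I : Ideal W) ↦ ?_⟩
    rcases eq_or_ne I ⊥ with rfl | hI
    · exact Submodule.fg_bot
    rcases eq_or_ne I ⊤ with rfl | hI'
    · exact ⟨{1}, by simp⟩
    -- Modulo a nonzero `t` in `I` the ring is finite-dimensional over `F`, so the image of `I` is
    -- finitely generated, and the kernel is principal.
    obtain ⟨t, htI, ht0⟩ := Submodule.exists_mem_ne_zero_of_ne_bot hI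
    have htn : (t : K) ∈ W.nonunits := ValuationSubring.mem_nonunits_iff_exists_mem_maximalIdeal.2
      ⟨t.2, IsLocalRing.le_maximalIdeal hI' htI⟩
    have htr : Transcendental F (t : K) := transcendental_of_mem_nonunits
      (fun h ↦ ht0 (Subtype.ext h)) htn
    let _ : Algebra F W := inferInstanceAs (Algebra F (valSubalgebra F W))
    have hfin : Module.Finite F (W ⧸ Ideal.span {t}) :=
      (finite_quotient_and_finrank_le (B := valSubalgebra F W) t htr).1
    have : IsNoetherian F (W ⧸ Ideal.span {t}) := inferInstance
    have hN : IsNoetherian W (W ⧸ Ideal.span {t}) := isNoetherian_of_tower F this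
    refine Submodule.fg_of_fg_map_of_fg_inf_ker (Submodule.mkQ (Ideal.span {t})) (s := I)
      (hN.noetherian _) ?_
    rw [Submodule.ker_mkQ, inf_eq_right.2 ((Ideal.span_singleton_le_iff_mem _).2 htI)]
    exact ⟨{t}, by simp⟩
  have h : IsDiscreteValuationRing W ↔ ValuationRing W :=
    (IsDiscreteValuationRing.TFAE W hfield).out 0 1
  exact h.2 inferInstance

theorem mem_of_isIntegral {B : Type*} [CommRing B] [Algebra B K] {W : ValuationSubring K}
    (hB : ∀ b : B, algebraMap B K b ∈ W) {x : K} (hx : IsIntegral B x) : x ∈ W := by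
  let f : B →+* W := (algebraMap B K).codRestrict W.toSubring hB
  let _ : Algebra B W := f.toAlgebra
  have _ : IsScalarTower B W K := IsScalarTower.of_algebraMap_eq fun _ ↦ rfl
  obtain ⟨y, hy⟩ := IsIntegrallyClosed.isIntegral_iff.1 (hx.tower_top (A := W))
  rw [← hy]
  exact y.2

end FunctionField

section AbsInf

variable {F K : Type*} [Field F] [Field K] [Algebra F K] [IsGlobalFunctionField F K]
  (O : ValuationSubring K) [IsDiscreteValuationRing O]

theorem absInf_add_le_max (x y : K) : absInf F O (x + y) ≤ max (absInf F O x) (absInf F O y) :=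
  (IsDiscreteValuationRing.maximalIdeal O).isNonarchimedean_adicAbv (one_lt_qInf F O) x y

theorem absInf_coe_le_one (x : O) : absInf F O (x : K) ≤ 1 :=
  (IsDiscreteValuationRing.maximalIdeal O).adicAbv_coe_le_one (one_lt_qInf F O) x

theorem absInf_coe_lt_one_iff (x : O) : absInf F O (x : K) < 1 ↔ x ∈ maximalIdeal O :=
  (IsDiscreteValuationRing.maximalIdeal O).adicAbv_coe_lt_one_iff (one_lt_qInf F O) x

theorem absInf_coe_unit (x : Oˣ) : absInf F O ((x : O) : K) = 1 :=
  ((IsDiscreteValuationRing.maximalIdeal O).adicAbv_coe_eq_one_iff (one_lt_qInf F O) (x : O)).2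
    fun h ↦ (mem_maximalIdeal _).1 h x.isUnit

variable {O}

theorem absInf_le_one_iff {x : K} : absInf F O x ≤ 1 ↔ x ∈ O := by
  refine ⟨fun h ↦ ?_, fun h ↦ absInf_coe_le_one O ⟨x, h⟩⟩
  by_contra hx
  have hx0 : x ≠ 0 := by rintro rfl; exact hx O.zero_mem
  have hxi : x⁻¹ ∈ O.nonunits := (O.inv_mem_nonunits_iff).2 (Or.inr hx)
  obtain ⟨hm, hmem⟩ := ValuationSubring.mem_nonunits_iff_exists_mem_maximalIdeal.1 hxi
  have h2 := (absInf_coe_lt_one_iff (F := F) O ⟨_, hm⟩).2 hmem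
  simp only [map_inv₀] at h2
  rw [inv_lt_one₀ ((absInf F O).pos hx0)] at h2
  linarith

theorem absInf_lt_one_iff {x : K} : absInf F O x < 1 ↔ x ∈ O.nonunits := by
  rw [ValuationSubring.mem_nonunits_iff_exists_mem_maximalIdeal]
  constructor
  · intro h
    exact ⟨absInf_le_one_iff.1 h.le, (absInf_coe_lt_one_iff (F := F) O ⟨x, _⟩).1 h⟩
  · rintro ⟨h, h2⟩
    exact (absInf_coe_lt_one_iff O ⟨x, h⟩).2 h2

theorem exists_eq_mul_zpow {π : O} (hπ : Irreducible π) {x : K} (hx : x ≠ 0) :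
    ∃ (u : Oˣ) (m : ℤ), x = ((u : O) : K) * (π : K) ^ m := by
  rcases O.mem_or_inv_mem x with h | h
  · obtain ⟨n, u, hu⟩ := IsDiscreteValuationRing.eq_unit_mul_pow_irreducible
      (x := (⟨x, h⟩ : O)) (fun h ↦ hx (congrArg Subtype.val h)) hπ
    exact ⟨u, n, by simpa using congrArg (Subtype.val) hu⟩
  · obtain ⟨n, u, hu⟩ := IsDiscreteValuationRing.eq_unit_mul_pow_irreducible
      (x := (⟨x⁻¹, h⟩ : O)) (fun h ↦ hx (inv_eq_zero.1 (congrArg Subtype.val h))) hπ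
    refine ⟨u⁻¹, -n, ?_⟩
    have h2 : x⁻¹ = ((u : O) : K) * (π : K) ^ n := by simpa using congrArg (Subtype.val) hu
    have h3 : (((u⁻¹ : Oˣ) : O) : K) = ((u : O) : K)⁻¹ := by
      refine eq_inv_of_mul_eq_one_left ?_
      exact congrArg (Subtype.val) u.inv_mul
    rw [h3, zpow_neg, zpow_natCast, ← mul_inv, ← h2, inv_inv]

theorem absInf_mul_zpow (u : Oˣ) {π : O} (hπ : Irreducible π) (m : ℤ) :
    absInf F O (((u : O) : K) * (π : K) ^ m) = (qInf O : ℝ) ^ (-m) := by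
  rw [map_mul, map_zpow₀, absInf_uniformizer F O hπ, absInf_coe_unit, one_mul, zpow_neg, inv_zpow]

theorem one_lt_qInf' (F : Type*) {K : Type*} [Field F] [Field K] [Algebra F K]
    [IsGlobalFunctionField F K] (O : ValuationSubring K) [IsDiscreteValuationRing O] :
    (1 : ℝ) < qInf O := by exact_mod_cast one_lt_qInf F O

theorem exists_absInf_eq {x : K} (hx : x ≠ 0) : ∃ m : ℤ, absInf F O x = (qInf O : ℝ) ^ m := by
  obtain ⟨π, hπ⟩ := IsDiscreteValuationRing.exists_irreducible O
  obtain ⟨u, m, rfl⟩ := exists_eq_mul_zpow hπ hx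
  exact ⟨-m, absInf_mul_zpow u hπ m⟩

theorem absInf_algebraMap {c : F} (hc : c ≠ 0) : absInf F O (algebraMap F K c) = 1 := by
  refine le_antisymm (absInf_le_one_iff.2 (constants_mem F O c)) ?_
  by_contra! h
  exact hc (algebraMap_notMem_nonunits (absInf_lt_one_iff.1 h))

theorem absInf_isNontrivial : (absInf F O).IsNontrivial := by
  obtain ⟨π, hπ⟩ := IsDiscreteValuationRing.exists_irreducible O
  refine ⟨π, fun h ↦ hπ.ne_zero (Subtype.ext h), ?_⟩
  rw [absInf_uniformizer F O hπ]
  exact (inv_lt_one_of_one_lt₀ (one_lt_qInf' F O)).ne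

theorem eq_of_absInf_isEquiv {W : ValuationSubring K} [IsDiscreteValuationRing W]
    (h : (absInf F O).IsEquiv (absInf F W)) : O = W := by
  ext x
  rw [← absInf_le_one_iff (F := F), h.le_one_iff, absInf_le_one_iff]

end AbsInf

end DrinfeldLattice

/-! ### Counting, approximation, and finiteness of the set of zeros -/

namespace DrinfeldLattice

theorem card_le_card_ker_mul {G H : Type*} [AddGroup G] [AddGroup H] [Finite H] (f : G →+ H) :
    Nat.card G ≤ Nat.card f.ker * Nat.card H := by
  rw [← AddSubgroup.card_mul_index f.ker, AddSubgroup.index_ker]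
  exact Nat.mul_le_mul_left _ (Nat.card_le_card_of_injective _ Subtype.val_injective)

/-- Every class modulo t^(k+1) is v + t^k u with representatives v modulo t^k and u modulo t. Only
the upper bound is needed, so uniqueness of such expansions plays no role. -/
theorem finite_quotient_pow {B : Type*} [CommRing B] (t : B) [Finite (B ⧸ Ideal.span {t})] (k : ℕ) :
    Finite (B ⧸ Ideal.span {t ^ k}) ∧
      Nat.card (B ⧸ Ideal.span {t ^ k}) ≤ Nat.card (B ⧸ Ideal.span {t}) ^ k := by
  induction k with
  | zero =>
    have : Subsingleton (B ⧸ Ideal.span {t ^ 0}) := by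
      rw [Ideal.Quotient.subsingleton_iff]; simp
    exact ⟨inferInstance, by simp⟩
  | succ k ih =>
    obtain ⟨h1, h2⟩ := ih
    let f : (B ⧸ Ideal.span {t}) × (B ⧸ Ideal.span {t ^ k}) → B ⧸ Ideal.span {t ^ (k + 1)} :=
      fun uv ↦ Ideal.Quotient.mk _ (uv.2.out + t ^ k * uv.1.out)
    have hf : Function.Surjective f := by
      intro b
      obtain ⟨b, rfl⟩ := Ideal.Quotient.mk_surjective b
      have hv : b - (Ideal.Quotient.mk (Ideal.span {t ^ k}) b).out ∈ Ideal.span {t ^ k} := by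
        rw [← Ideal.Quotient.mk_eq_mk_iff_sub_mem]
        exact (Quotient.out_eq (Ideal.Quotient.mk (Ideal.span {t ^ k}) b)).symm
      obtain ⟨c, hc⟩ := Ideal.mem_span_singleton.1 hv
      have hu : c - (Ideal.Quotient.mk (Ideal.span {t}) c).out ∈ Ideal.span {t} := by
        rw [← Ideal.Quotient.mk_eq_mk_iff_sub_mem]
        exact (Quotient.out_eq (Ideal.Quotient.mk (Ideal.span {t}) c)).symm
      obtain ⟨e, he⟩ := Ideal.mem_span_singleton.1 hu
      refine ⟨(Ideal.Quotient.mk _ c, Ideal.Quotient.mk _ b), ?_⟩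
      refine (Ideal.Quotient.mk_eq_mk_iff_sub_mem _ _).2 (Ideal.mem_span_singleton.2 ⟨-e, ?_⟩)
      simp only
      linear_combination -hc - t ^ k * he
    refine ⟨Finite.of_surjective f hf, (Nat.card_le_card_of_surjective f hf).trans ?_⟩
    rw [Nat.card_prod, pow_succ, mul_comm]
    exact Nat.mul_le_mul_right _ h2

section PolyComb

variable {F K : Type*} [Field F] [Field K] [Algebra F K]

/-- The `F`-linear map `(p_i) ↦ ∑ p_i(x) e_i` on families of polynomials of degree `< m`. -/
noncomputable def polyComb (x : K) {n : ℕ} (e : Fin n → K) (m : ℕ) :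
    (Fin n → degreeLT F m) →ₗ[F] K :=
  ∑ i, ((LinearMap.mulRight F (e i)).comp
    ((aeval x).toLinearMap.comp (degreeLT F m).subtype)).comp (LinearMap.proj i)

theorem polyComb_apply (x : K) {n : ℕ} (e : Fin n → K) (m : ℕ) (p : Fin n → degreeLT F m) :
    polyComb x e m p = ∑ i, aeval x (p i : F[X]) * e i := by
  simp [polyComb]

end PolyComb

section FunctionField

variable {F K : Type*} [Field F] [Field K] [Algebra F K] [IsGlobalFunctionField F K]

theorem adjoin_inv (x : K) : F⟮x⁻¹⟯ = F⟮x⟯ := by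
  apply le_antisymm
  · rw [IntermediateField.adjoin_simple_le_iff]
    exact inv_mem (IntermediateField.mem_adjoin_simple_self F x)
  · rw [IntermediateField.adjoin_simple_le_iff]
    have := inv_mem (IntermediateField.mem_adjoin_simple_self F x⁻¹)
    rwa [inv_inv] at this

theorem aeval_mem {W : ValuationSubring K} {x : K} (hx : x ∈ W) (p : F[X]) : aeval x p ∈ W := by
  have : aeval x p ∈ valSubalgebra F W := by
    have := (aeval (⟨x, hx⟩ : valSubalgebra F W) p).2
    rwa [← Subalgebra.coe_val, ← aeval_algHom_apply] at this
  exact this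

/-- `y` is algebraic over F[x], so some nonzero multiple g(x) y is integral over F[x], hence lies in
every valuation ring that contains `x`. -/
theorem exists_aeval_mul_mem {x : K} (hx : Transcendental F x) (y : K) :
    ∃ g : F[X], g ≠ 0 ∧ ∀ W : ValuationSubring K, x ∈ W → aeval x g * y ∈ W := by
  have := finiteDimensional_adjoin x hx
  have hy : IsAlgebraic (Algebra.adjoin F {x}) y := by
    open scoped IntermediateField.algebraAdjoinAdjoin in
    rw [IsFractionRing.isAlgebraic_iff (Algebra.adjoin F {x}) F⟮x⟯ K]
    exact Algebra.IsAlgebraic.isAlgebraic y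
  obtain ⟨g, hg0, hg⟩ := hy.exists_integral_multiple
  obtain ⟨p, hp⟩ := (Algebra.adjoin_singleton_eq_range_aeval F x).le g.2
  refine ⟨p, ?_, fun W hW ↦ ?_⟩
  · rintro rfl
    apply hg0
    apply Subtype.ext
    rw [← hp]
    simp
  · have h : (aeval x p : K) * y = g • y := by
      rw [Subalgebra.smul_def, smul_eq_mul, ← hp]; rfl
    rw [h]
    refine mem_of_isIntegral (B := Algebra.adjoin F {x}) (fun b ↦ ?_) hg
    obtain ⟨p, hp⟩ := (Algebra.adjoin_singleton_eq_range_aeval F x).le b.2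
    change (b : K) ∈ W
    rw [← hp]
    exact aeval_mem hW p

/-- Every nonconstant function has a pole: 1/y is not a unit of F[1/y], so some valuation ring
containing F[1/y] has 1/y in its maximal ideal. -/
theorem exists_isDiscreteValuationRing_notMem {y : K} (hy : Transcendental F y) :
    ∃ W : ValuationSubring K, IsDiscreteValuationRing W ∧ y ∉ W := by
  have hy0 : y ≠ 0 := by rintro rfl; exact hy isAlgebraic_zero
  let A : Subring K := (Algebra.adjoin F {y⁻¹}).toSubring
  let t : A := ⟨y⁻¹, Algebra.subset_adjoin rfl⟩
  have hI : Ideal.span {t} ≠ ⊤ := by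
    rw [Ne, Ideal.eq_top_iff_one, Ideal.mem_span_singleton]
    rintro ⟨c, hc⟩
    obtain ⟨p, hp⟩ := (Algebra.adjoin_singleton_eq_range_aeval F y⁻¹).le c.2
    have h1 : aeval y⁻¹ (X * p - 1 : F[X]) = 0 := by
      have := congrArg Subtype.val hc
      have hp' : aeval y⁻¹ p = (c : K) := hp
      rw [map_sub, map_mul, aeval_X, map_one, hp', sub_eq_zero]
      exact this.symm
    have h2 : (X * p - 1 : F[X]) ≠ 0 := by
      intro h
      have := congrArg (fun f ↦ coeff f 0) h
      simp at this
    exact hy (IsAlgebraic.inv_iff.1 ⟨_, h2, h1⟩)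
  obtain ⟨W, hW, hIW⟩ := Ideal.image_subset_nonunits_valuationSubring (Ideal.span {t}) hI
  have h3 : y⁻¹ ∈ W.nonunits := hIW ⟨t, Ideal.mem_span_singleton_self t, rfl⟩
  rw [W.inv_mem_nonunits_iff] at h3
  have h4 := h3.resolve_left hy0
  exact ⟨W, isDiscreteValuationRing_of_ne_top F W h4, h4⟩

theorem polyComb_injective {x : K} (hx : Transcendental F x) {n : ℕ} {e : Fin n → K}
    (he : LinearIndependent F⟮x⟯ e) (m : ℕ) :
    Function.Injective (polyComb (F := F) x e m) := by
  rw [injective_iff_map_eq_zero]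
  intro p hp
  rw [polyComb_apply] at hp
  have hmem : ∀ q : F[X], aeval x q ∈ F⟮x⟯ := fun q ↦
    IntermediateField.algebra_adjoin_le_adjoin F {x} (aeval_mem_adjoin_singleton F x)
  have := Fintype.linearIndependent_iff.1 he (fun i ↦ ⟨aeval x (p i : F[X]), hmem _⟩) hp
  funext i
  have h := congrArg Subtype.val (this i)
  apply Subtype.ext
  exact transcendental_iff.1 hx _ h

theorem card_polyComb_domain (n m : ℕ) :
    Nat.card (Fin n → degreeLT F m) = Nat.card F ^ (m * n) := by
  rw [Nat.card_pi]
  simp only [Nat.card_congr (degreeLTEquiv F m).toEquiv, Finset.prod_const, Finset.card_univ,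
    Fintype.card_fin, Nat.card_pi, pow_mul]

/-- A maximal family, linearly independent over `F(x)`, with values in all valuation rings
containing `x`. -/
theorem exists_linearIndependent_mem {x : K} (hx : Transcendental F x) :
    ∃ e : Fin (Module.finrank F⟮x⟯ K) → K, LinearIndependent F⟮x⟯ e ∧
      ∀ i, ∀ W : ValuationSubring K, x ∈ W → e i ∈ W := by
  have := finiteDimensional_adjoin x hx
  let b := Module.finBasis F⟮x⟯ K
  choose g hg0 hg using fun i ↦ exists_aeval_mul_mem hx (b i)
  refine ⟨fun i ↦ aeval x (g i) * b i, ?_, hg⟩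
  have hmem : ∀ q : F[X], aeval x q ∈ F⟮x⟯ := fun q ↦
    IntermediateField.algebra_adjoin_le_adjoin F {x} (aeval_mem_adjoin_singleton F x)
  have h0 : ∀ i, (⟨aeval x (g i), hmem _⟩ : F⟮x⟯) ≠ 0 := fun i h ↦
    hg0 i (transcendental_iff.1 hx _ (congrArg Subtype.val h))
  exact b.linearIndependent.units_smul fun i ↦ Units.mk0 _ (h0 i)

end FunctionField

section AbsInf

variable {F K : Type*} [Field F] [Field K] [Algebra F K] [IsGlobalFunctionField F K]
  {O : ValuationSubring K} [IsDiscreteValuationRing O]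

theorem absInf_sum_le {ι : Type*} (s : Finset ι) (f : ι → K) {M : ℝ} (hM : 0 ≤ M)
    (h : ∀ i ∈ s, absInf F O (f i) ≤ M) : absInf F O (∑ i ∈ s, f i) ≤ M := by
  classical
  induction s using Finset.induction_on with
  | empty => simpa
  | insert i s hi ih =>
    rw [Finset.sum_insert hi]
    refine (absInf_add_le_max O _ _).trans (max_le (h i (by simp)) (ih fun j hj ↦ h j (by simp [hj])))

theorem absInf_one_add {x : K} (hx : absInf F O x < 1) : absInf F O (1 + x) = 1 := by
  refine le_antisymm ((absInf_add_le_max O _ _).trans (by simp [hx.le])) ?_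
  by_contra! h
  have := absInf_add_le_max (F := F) O (1 + x) (-x)
  rw [add_neg_cancel_right, map_one, map_neg_eq_map] at this
  rcases le_max_iff.1 this with h2 | h2 <;> linarith

theorem absInf_aeval_le_one {x : K} (hx : x ∈ O) (p : F[X]) : absInf F O (aeval x p) ≤ 1 :=
  absInf_le_one_iff.2 (aeval_mem hx p)

/-- p(x) is its nonzero constant term times 1 plus a multiple of `x`, and |x| < 1. -/
theorem absInf_aeval_eq_one {x : K} (hx : x ∈ O.nonunits) {p : F[X]} (hp : ¬ X ∣ p) :
    absInf F O (aeval x p) = 1 := by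
  have hxO : x ∈ O := (ValuationSubring.mem_nonunits_iff_exists_mem_maximalIdeal.1 hx).1
  have hp0 : p.coeff 0 ≠ 0 := fun h ↦ hp (X_dvd_iff.2 h)
  have h : aeval x p = algebraMap F K (p.coeff 0) *
      (1 + x * aeval x (C (p.coeff 0)⁻¹ * p.divX)) := by
    conv_lhs => rw [← X_mul_divX_add p]
    simp only [map_add, map_mul, aeval_X, aeval_C]
    have : algebraMap F K (p.coeff 0) * algebraMap F K (p.coeff 0)⁻¹ = 1 := by
      rw [← map_mul, mul_inv_cancel₀ hp0, map_one]
    linear_combination (-x * aeval x p.divX) * this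
  rw [h, map_mul, absInf_algebraMap hp0, one_mul]
  apply absInf_one_add
  rw [map_mul]
  have h1 := absInf_lt_one_iff (F := F).2 hx
  have h2 := absInf_aeval_le_one hxO (C (p.coeff 0)⁻¹ * p.divX)
  nlinarith [(absInf F O).nonneg x]

theorem exists_one_lt_absInf_lt_one {ι : Type*} [Finite ι] (W : ι → ValuationSubring K)
    [∀ i, IsDiscreteValuationRing (W i)] (hW : Function.Injective W) (i : ι) :
    ∃ a : K, 1 < absInf F (W i) a ∧ ∀ j ≠ i, absInf F (W j) a < 1 :=
  AbsoluteValue.exists_one_lt_lt_one_pi_of_not_isEquiv (v := fun i ↦ absInf F (W i))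
    (fun _ ↦ absInf_isNontrivial) (fun _ _ hij h ↦ hij (hW (eq_of_absInf_isEquiv h))) i

/-- Weak approximation provides one element for each place which is a unit there and small at the
other places. These are independent modulo `s` in the intersection of the valuation rings, hence
independent over F(s), so there are at most [K : F(s)] of them. -/
theorem not_injective_of_mem_nonunits {s : K} (hs : Transcendental F s)
    (W : Fin (Module.finrank F⟮s⟯ K + 1) → ValuationSubring K)
    (hD : ∀ i, IsDiscreteValuationRing (W i)) (hsW : ∀ i, s ∈ (W i).nonunits) :
    ¬ Function.Injective W := by
  intro hW
  have := finiteDimensional_adjoin s hs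
  have hs0 : s ≠ 0 := by intro h; rw [h] at hs; exact hs isAlgebraic_zero
  choose a ha1 ha2 using exists_one_lt_absInf_lt_one (F := F) W hW
  have ha0 : ∀ i, a i ≠ 0 := fun i h ↦ by
    have := ha1 i; rw [h, map_zero] at this; linarith
  -- This is a/(1 + a): since a is large at the i-th place and small at the others, it is close to 1
  -- there and to 0 elsewhere.
  let e := fun i ↦ (1 + (a i)⁻¹)⁻¹
  have he1 : ∀ i, absInf F (W i) (e i) = 1 := fun i ↦ by
    simp only [e, map_inv₀]
    rw [absInf_one_add, inv_one]
    rw [map_inv₀]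
    exact inv_lt_one_of_one_lt₀ (ha1 i)
  have he2 : ∀ i j, j ≠ i → absInf F (W j) (e i) < 1 := fun i j hj ↦ by
    have h1 : absInf F (W j) (1 + a i) = 1 := absInf_one_add (ha2 i j hj)
    have h2 : (1 + a i) ≠ 0 := fun h ↦ by rw [h, map_zero] at h1; norm_num at h1
    have h3 : e i = a i * (1 + a i)⁻¹ := by
      simp only [e]
      have := ha0 i
      have h4 : 1 + (a i)⁻¹ = (1 + a i) * (a i)⁻¹ := by field_simp; ring
      rw [h4, mul_inv, inv_inv, mul_comm]
    rw [h3, map_mul, map_inv₀, h1, inv_one, mul_one]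
    exact ha2 i j hj
  let B : Subalgebra F K := ⨅ i, valSubalgebra F (W i)
  have hB : ∀ {x : K}, x ∈ B ↔ ∀ i, x ∈ W i := fun {x} ↦ by
    simp only [B, Algebra.mem_iInf, mem_valSubalgebra]
  have heB : ∀ i, e i ∈ B := fun i ↦ hB.2 fun j ↦ by
    rw [← absInf_le_one_iff (F := F)]
    rcases eq_or_ne j i with rfl | h
    · exact (he1 _).le
    · exact (he2 _ _ h).le
  have hsB : s ∈ B := hB.2 fun i ↦
    (ValuationSubring.mem_nonunits_iff_exists_mem_maximalIdeal.1 (hsW i)).1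
  have hli := linearIndependent_of_mk (B := B) ⟨s, hsB⟩ hs0 (fun i ↦ ⟨e i, heB i⟩) (by
    rw [Fintype.linearIndependent_iff]
    intro c hc i
    have h1 : Ideal.Quotient.mk (Ideal.span {(⟨s, hsB⟩ : B)})
        (∑ j, c j • (⟨e j, heB j⟩ : B)) = 0 := by
      rw [← hc]
      exact map_sum (Ideal.Quotient.mkₐ F (Ideal.span {(⟨s, hsB⟩ : B)})) _ _ |>.trans
        (Finset.sum_congr rfl fun j _ ↦ map_smul (Ideal.Quotient.mkₐ F _) _ _)
    rw [Ideal.Quotient.eq_zero_iff_mem, Ideal.mem_span_singleton] at h1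
    obtain ⟨y, hy⟩ := h1
    have h2 : ∑ j, algebraMap F K (c j) * e j = s * y := by
      have := congrArg (Subtype.val) hy
      simpa [Algebra.smul_def] using this
    by_contra hci
    -- At the i-th place every other term of the relation is a nonunit, so a nonzero `c i` would
    -- give a term of absolute value 1 with nothing to balance it.
    have h3 : absInf F (W i) (algebraMap F K (c i) * e i) = 1 := by
      rw [map_mul, absInf_algebraMap hci, he1, mul_one]
    have h4 : (algebraMap F K (c i) * e i) ∈ (W i).nonunits := by
      classical
      have h5 : algebraMap F K (c i) * e i = s * y +
          ∑ j ∈ Finset.univ.erase i, algebraMap F K (-c j) * e j := by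
        rw [← h2, ← Finset.add_sum_erase _ _ (Finset.mem_univ i)]
        simp
      rw [h5]
      have hn : ∀ x ∈ W i, ∀ z, z ∈ (W i).nonunits → x * z ∈ (W i).nonunits := by
        intro x hx z hz
        rw [← absInf_lt_one_iff (F := F)] at hz ⊢
        rw [map_mul]
        have := absInf_le_one_iff (F := F).2 hx
        nlinarith [(absInf F (W i)).nonneg x, (absInf F (W i)).nonneg z]
      have hadd : ∀ x z, x ∈ (W i).nonunits → z ∈ (W i).nonunits → x + z ∈ (W i).nonunits := by
        intro x z hx hz
        rw [← absInf_lt_one_iff (F := F)] at hx hz ⊢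
        exact (absInf_add_le_max _ _ _).trans_lt (max_lt hx hz)
      refine hadd _ _ ?_ ?_
      · rw [mul_comm]
        exact hn _ (hB.1 y.2 i) _ (hsW i)
      · refine Finset.sum_induction _ (· ∈ (W i).nonunits) (fun x z ↦ hadd x z) ?_ ?_
        · rw [← absInf_lt_one_iff (F := F)]; simp
        · intro j hj
          refine hn _ (constants_mem F _ _) _ ?_
          rw [← absInf_lt_one_iff (F := F)]
          exact he2 _ _ (Finset.ne_of_mem_erase hj).symm
    rw [← absInf_lt_one_iff (F := F), h3] at h4
    exact lt_irrefl _ h4)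
  have := hli.fintype_card_le_finrank
  simp at this

theorem finite_setOf_mem_nonunits {s : K} (hs : Transcendental F s) :
    {W : ValuationSubring K | IsDiscreteValuationRing W ∧ s ∈ W.nonunits}.Finite := by
  by_contra h
  have hinf : Infinite {W : ValuationSubring K // IsDiscreteValuationRing W ∧ s ∈ W.nonunits} :=
    Set.infinite_coe_iff.2 h
  let f := Infinite.natEmbedding {W : ValuationSubring K // IsDiscreteValuationRing W ∧ s ∈ W.nonunits}
  refine not_injective_of_mem_nonunits hs (fun i ↦ (f i).1) (fun i ↦ (f i).2.1)
    (fun i ↦ (f i).2.2) fun i j hij ↦ ?_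
  exact Fin.ext (f.injective (Subtype.ext hij))

end AbsInf

end DrinfeldLattice

/-! ### Nonconstant elements of `A` -/

namespace DrinfeldLattice

section Nonconstant

variable {F K : Type*} [Field F] [Field K] [Algebra F K] [IsGlobalFunctionField F K]
  (O : ValuationSubring K) [IsDiscreteValuationRing O]

/-- The elements of `K` integral at all places other than `O` where `s` vanishes. -/
def otherZeros (F : Type*) {K : Type*} [Field F] [Field K] [Algebra F K]
    [IsGlobalFunctionField F K] (O : ValuationSubring K) (s : K) : Subalgebra F K where
  carrier := {x | ∀ W : ValuationSubring K, IsDiscreteValuationRing W → W ≠ O →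
    s ∈ W.nonunits → x ∈ W}
  mul_mem' hx hy W h h' h'' := W.mul_mem _ _ (hx W h h' h'') (hy W h h' h'')
  add_mem' hx hy W h h' h'' := W.add_mem _ _ (hx W h h' h'') (hy W h h' h'')
  algebraMap_mem' c W _ _ _ := constants_mem F W c

theorem exists_mem_otherZeros {s : K} (hs : s ∈ O.nonunits) (hs0 : s ≠ 0) :
    ∃ y ∈ otherZeros F O s, 1 < absInf F O y := by
  let S := {W : ValuationSubring K | IsDiscreteValuationRing W ∧ s ∈ W.nonunits}
  have hS : Finite S := finite_setOf_mem_nonunits (F := F) (transcendental_of_mem_nonunits hs0 hs)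
  have hD : ∀ W : S, IsDiscreteValuationRing W.1 := fun W ↦ W.2.1
  obtain ⟨a, ha, ha2⟩ := exists_one_lt_absInf_lt_one (F := F) (fun W : S ↦ W.1)
    Subtype.val_injective ⟨O, inferInstance, hs⟩
  refine ⟨a, fun W hW hWO hsW ↦ ?_, ha⟩
  exact absInf_le_one_iff.1 (ha2 ⟨W, hW, hsW⟩ fun h ↦ hWO (congrArg Subtype.val h)).le

theorem self_mem_otherZeros (s : K) : s ∈ otherZeros F O s :=
  fun _ _ _ h ↦ (ValuationSubring.mem_nonunits_iff_exists_mem_maximalIdeal.1 h).1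

/-- The zero of `s` at `O` contributes to [K : F(s)] but is left out on the left. If equality held,
lifts of a basis modulo `s` would be a basis of `K` over F(s); solving for an arbitrary element of
the ring would bound its absolute value at `O`, contradicting approximation. -/
theorem finrank_otherZeros_lt {s : K} (hs : s ∈ O.nonunits) (hs0 : s ≠ 0) :
    Module.finrank F (otherZeros F O s ⧸ Ideal.span {(⟨s, self_mem_otherZeros O s⟩ :
      otherZeros F O s)}) < Module.finrank F⟮s⟯ K := by
  have hstr := transcendental_of_mem_nonunits (F := F) hs0 hs
  have := finiteDimensional_adjoin s hstr
  set B := otherZeros F O s with hBdef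
  set t : B := ⟨s, self_mem_otherZeros O s⟩
  obtain ⟨hfin, hle⟩ := finite_quotient_and_finrank_le (B := B) t hstr
  refine lt_of_le_of_ne hle fun heq ↦ ?_
  have : Module.Free F (B ⧸ Ideal.span {t}) := Module.Free.of_divisionRing F _
  let b := Module.finBasis F (B ⧸ Ideal.span {t})
  choose x hx using fun i ↦ Ideal.Quotient.mk_surjective (b i)
  obtain ⟨M, hM⟩ := Finset.exists_le (Finset.univ.image fun i ↦ absInf F O (x i : K))
  have hbound : ∀ y ∈ B, absInf F O y ≤ max M 0 := by
    intro y hy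
    let v : Option (Fin (Module.finrank F (B ⧸ Ideal.span {t}))) → K :=
      fun o ↦ o.elim y fun i ↦ (x i : K)
    have hv : ¬ LinearIndependent F⟮s⟯ v := fun h ↦ by
      have := h.fintype_card_le_finrank
      rw [Fintype.card_option, Fintype.card_fin, heq] at this
      change _ ≤ Module.finrank F⟮s⟯ K at this
      omega
    obtain ⟨p, ⟨o, ho⟩, hp⟩ := exists_dependence_of_not_linearIndependent hs0 hv
    rw [Fintype.sum_option] at hp
    simp only [v, Option.elim] at hp
    -- If the coefficient of `y` vanished modulo `s`, the relation would reduce to one among the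
    -- basis elements modulo `s`, forcing every coefficient to be divisible by `X`.
    have hnone : ¬ X ∣ p none := by
      rintro ⟨r, hr⟩
      have h0 : ∑ i, aeval t (p (some i)) * x i = t * (-aeval t r * ⟨y, hy⟩) := by
        apply Subtype.ext
        rw [hr] at hp
        simp only [map_mul, aeval_X] at hp
        have hco : ∀ q : F[X], ((aeval t q : B) : K) = aeval s q := fun q ↦
          (Subalgebra.aeval_coe _ t q).symm
        simp only [AddSubmonoidClass.coe_finsetSum, MulMemClass.coe_mul, NegMemClass.coe_neg, hco]
        linear_combination hp
      have h1 : ∑ i, (p (some i)).coeff 0 • b i = 0 := by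
        have h2 : Ideal.Quotient.mk (Ideal.span {t}) (∑ i, aeval t (p (some i)) * x i) = 0 := by
          rw [Ideal.Quotient.eq_zero_iff_mem, Ideal.mem_span_singleton]
          exact ⟨_, h0⟩
        rw [← h2, map_sum]
        refine Finset.sum_congr rfl fun i _ ↦ ?_
        rw [← hx]
        refine (map_smul (Ideal.Quotient.mkₐ F (Ideal.span {t})) _ (x i)).symm.trans ?_
        rw [Algebra.smul_def]
        refine ((Ideal.Quotient.mk_eq_mk_iff_sub_mem _ _).2 ?_).symm
        rw [← sub_mul]
        exact Ideal.mul_mem_right _ _ (aeval_sub_coeff_zero_mem_span t _)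
      have h3 := Fintype.linearIndependent_iff.1 b.linearIndependent _ h1
      rcases o with _ | i
      · exact ho ⟨r, hr⟩
      · exact ho (X_dvd_iff.2 (h3 i))
    have h4 : absInf F O y = absInf F O (∑ i, aeval s (p (some i)) * x i) := by
      have h5 : aeval s (p none) * y = -∑ i, aeval s (p (some i)) * (x i : K) := by
        linear_combination hp
      have h6 := congrArg (absInf F O) h5
      rwa [map_mul, absInf_aeval_eq_one hs hnone, one_mul, map_neg_eq_map] at h6
    rw [h4]
    refine absInf_sum_le _ _ (le_max_right _ _) fun i _ ↦ ?_
    rw [map_mul]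
    have h7 := absInf_aeval_le_one (F := F)
      (ValuationSubring.mem_nonunits_iff_exists_mem_maximalIdeal.1 hs).1 (p (some i))
    have h8 := hM _ (Finset.mem_image_of_mem _ (Finset.mem_univ i))
    refine (mul_le_of_le_one_left ((absInf F O).nonneg _) h7).trans (h8.trans (le_max_left _ _))
  -- Powers of an element that is large at `O` stay in the ring and are unbounded at `O`.
  obtain ⟨y, hy, hy1⟩ := exists_mem_otherZeros (F := F) O hs hs0
  obtain ⟨k, hk⟩ := pow_unbounded_of_one_lt (max M 0) hy1
  have := hbound (y ^ k) (pow_mem hy k)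
  rw [map_pow] at this
  linarith

variable {O}

/-- A nonconstant function has a pole somewhere, and for elements of `A` the only possible place is
`O`. -/
theorem one_lt_absInf_of_transcendental {a : K} (ha : a ∈ coeffRing F O)
    (hat : Transcendental F a) : 1 < absInf F O a := by
  obtain ⟨W, hW, haW⟩ := exists_isDiscreteValuationRing_notMem hat
  have hWO : W = O := by
    by_contra h
    exact haW (ha W hW h)
  subst hWO
  by_contra! h
  exact haW (absInf_le_one_iff.1 h)

theorem one_le_absInf {a : K} (ha : a ∈ coeffRing F O) (ha0 : a ≠ 0) : 1 ≤ absInf F O a := by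
  by_contra! h
  have := one_lt_absInf_of_transcendental ha
    (transcendental_of_mem_nonunits ha0 (absInf_lt_one_iff.1 h))
  linarith

theorem transcendental_of_one_lt {a : K} (h : 1 < absInf F O a) : Transcendental F a := by
  intro halg
  obtain ⟨c, rfl⟩ := IsGlobalFunctionField.constants_closed (F := F) a halg
  have := absInf_le_one_iff (F := F).2 (constants_mem F O c)
  linarith

theorem finite_constants_of (F K : Type*) [Field F] [Field K] [Algebra F K]
    [IsGlobalFunctionField F K] : Finite F :=
  IsGlobalFunctionField.finite_constants (F := F) (K := K)

theorem pow_mul_aeval_inv_mem {B : Subalgebra F K} {s : K} (hs0 : s ≠ 0) (hs : s ∈ B) {M : ℕ}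
    {p : F[X]} (hp : p ∈ degreeLT F (M + 1)) : s ^ M * aeval s⁻¹ p ∈ B := by
  rw [mem_degreeLT] at hp
  have hp' : p.natDegree < M + 1 := by
    rcases eq_or_ne p 0 with rfl | h
    · simp
    · exact (natDegree_lt_iff_degree_lt h).2 hp
  rw [aeval_eq_sum_range' hp', Finset.mul_sum]
  refine Subalgebra.sum_mem _ fun i hi ↦ ?_
  have hi' : i ≤ M := by simp at hi; omega
  have : s ^ M * p.coeff i • s⁻¹ ^ i = p.coeff i • s ^ (M - i) := by
    rw [mul_smul_comm, inv_pow, ← div_eq_mul_inv, pow_sub₀ _ hs0 hi', div_eq_mul_inv]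
  rw [this]
  exact B.smul_mem (pow_mem hs _) _

/-- If g(s) y is integral wherever `s` is, write g = X^c h with h(0) ≠ 0; then h(s) is a unit at
every zero of `s`. -/
theorem exists_pow_mul_mem_otherZeros {s : K} (hs : Transcendental F s) (y : K) :
    ∃ c : ℕ, s ^ c * y ∈ otherZeros F O s := by
  obtain ⟨g, hg0, hg⟩ := exists_aeval_mul_mem hs y
  obtain ⟨h, hh, hX⟩ := Polynomial.exists_eq_pow_rootMultiplicity_mul_and_not_dvd g hg0 0
  refine ⟨g.rootMultiplicity 0, fun W hW _ hsW ↦ ?_⟩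
  rw [C_0, sub_zero] at hh hX
  have h1 := hg W (ValuationSubring.mem_nonunits_iff_exists_mem_maximalIdeal.1 hsW).1
  rw [← absInf_le_one_iff (F := F)] at h1 ⊢
  rw [hh, map_mul, map_mul, map_mul, map_pow, aeval_X, absInf_aeval_eq_one hsW hX, mul_one] at h1
  rwa [map_mul]

/-- A count in the style of Riemann's inequality. With `s` a uniformizer at `O`, combinations of
`n'` independent elements with polynomials of degree ≤ M in 1/s have poles only at zeros of `s`. To
have no pole outside `O` is a condition modulo s^(M+c0) in `otherZeros`, with at most q^(P(M+c0))
residues. If `A` consisted of constants, at most q combinations could satisfy it, which fails for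
large M because P < n'. -/
theorem exists_nonconstant (F : Type*) {K : Type*} [Field F] [Field K] [Algebra F K]
    [IsGlobalFunctionField F K] (O : ValuationSubring K) [IsDiscreteValuationRing O] :
    ∃ a ∈ coeffRing F O, 1 < absInf F O a := by
  have := finite_constants_of F K
  by_contra! hcon
  have hconst : ∀ a ∈ coeffRing F O, a ∈ Set.range (algebraMap F K) := fun a ha ↦ by
    by_contra h
    have h2 := one_lt_absInf_of_transcendental ha fun h3 ↦
      h (IsGlobalFunctionField.constants_closed a h3)
    linarith [hcon a ha]
  obtain ⟨π, hπ⟩ := IsDiscreteValuationRing.exists_irreducible O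
  obtain ⟨s, hsdef⟩ : ∃ s : K, s = (π : K) := ⟨_, rfl⟩
  have hs0 : s ≠ 0 := fun h ↦ hπ.ne_zero (Subtype.ext (hsdef.symm.trans h))
  have hs : s ∈ O.nonunits := by
    rw [← absInf_lt_one_iff (F := F), hsdef, absInf_uniformizer F O hπ]
    exact inv_lt_one_of_one_lt₀ (one_lt_qInf' F O)
  have hstr := transcendental_of_mem_nonunits (F := F) hs0 hs
  have hxtr : Transcendental F s⁻¹ := fun h ↦ hstr (IsAlgebraic.inv_iff.1 h)
  have hsO : s⁻¹ ∉ O := by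
    have : (s⁻¹)⁻¹ ∈ O.nonunits := by rwa [inv_inv]
    rw [O.inv_mem_nonunits_iff] at this
    exact this.resolve_left (inv_ne_zero hs0)
  have hlt := finrank_otherZeros_lt (F := F) O hs hs0
  have hex := exists_linearIndependent_mem hxtr
  rw [show Module.finrank F⟮s⁻¹⟯ K = Module.finrank F⟮s⟯ K by rw [adjoin_inv]] at hex
  set n' := Module.finrank F⟮s⟯ K
  obtain ⟨e, he, heW⟩ := hex
  set B := otherZeros F O s with hB
  set t : B := ⟨s, self_mem_otherZeros O s⟩ with ht
  set P := Module.finrank F (B ⧸ Ideal.span {t}) with hP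
  have hfinm : Module.Finite F (B ⧸ Ideal.span {t}) :=
    (finite_quotient_and_finrank_le (B := B) t hstr).1
  have hfinB : Finite (B ⧸ Ideal.span {t}) := Module.finite_of_finite F
  choose c hc using fun i ↦ exists_pow_mul_mem_otherZeros (O := O) hstr (e i)
  obtain ⟨c0, hc0⟩ := Finset.exists_le (Finset.univ.image c)
  have hce : ∀ i, s ^ c0 * e i ∈ B := fun i ↦ by
    have h1 : c i ≤ c0 := hc0 _ (Finset.mem_image_of_mem _ (Finset.mem_univ i))
    rw [← Nat.sub_add_cancel h1, pow_add, mul_assoc]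
    exact mul_mem (pow_mem (self_mem_otherZeros O s) _) (hc i)
  -- Since n' ≥ P + 1, it suffices that P c0 < P + M.
  obtain ⟨M, hM⟩ : ∃ M : ℕ, 1 + P * (M + c0) < n' * (M + 1) := by
    refine ⟨P * c0 + 1, ?_⟩
    have : P + 1 ≤ n' := hlt
    have := Nat.mul_le_mul_right (P * c0 + 1 + 1) this
    nlinarith
  have hmem : ∀ p, s ^ (M + c0) * polyComb (F := F) s⁻¹ e (M + 1) p ∈ B := fun p ↦ by
    rw [polyComb_apply, Finset.mul_sum]
    refine Subalgebra.sum_mem _ fun i _ ↦ ?_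
    rw [pow_add, mul_mul_mul_comm]
    exact mul_mem (pow_mul_aeval_inv_mem hs0 (self_mem_otherZeros O s) (p i).2) (hce i)
  let L : (Fin n' → degreeLT F (M + 1)) →ₗ[F] B :=
    LinearMap.codRestrict (Subalgebra.toSubmodule B)
      ((LinearMap.mulLeft F (s ^ (M + c0))).comp (polyComb (F := F) s⁻¹ e (M + 1))) hmem
  have hL : ∀ p, (L p : K) = s ^ (M + c0) * polyComb (F := F) s⁻¹ e (M + 1) p := fun p ↦ rfl
  obtain ⟨hf, hcard⟩ := finite_quotient_pow t (M + c0)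
  let G : (Fin n' → degreeLT F (M + 1)) →+ B ⧸ Ideal.span {t ^ (M + c0)} :=
    (Ideal.Quotient.mk (Ideal.span {t ^ (M + c0)})).toAddMonoidHom.comp L.toAddMonoidHom
  have hker : ∀ p : G.ker, ∃ d : F, algebraMap F K d = polyComb (F := F) s⁻¹ e (M + 1) p.1 := by
    intro p
    apply hconst
    have h1 : L p.1 ∈ Ideal.span {t ^ (M + c0)} := Ideal.Quotient.eq_zero_iff_mem.1 p.2
    obtain ⟨y, hy⟩ := Ideal.mem_span_singleton.1 h1
    have h2 : polyComb (F := F) s⁻¹ e (M + 1) p.1 = y := by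
      have h3 := congrArg (Subtype.val) hy
      rw [hL] at h3
      exact mul_left_cancel₀ (pow_ne_zero _ hs0) h3
    intro W hW hWO
    -- Either 1/s is integral at `W`, and then so is each combination, or `W` is a zero of `s`,
    -- where divisibility by s^(M+c0) gives integrality.
    by_cases hsW : s⁻¹ ∈ W
    · rw [polyComb_apply]
      refine sum_mem fun i _ ↦ W.mul_mem _ _ (aeval_mem hsW _) (heW i W hsW)
    · have : s ∈ W.nonunits := by
        have h4 := (W.inv_mem_nonunits_iff (x := s⁻¹)).2 (Or.inr hsW)
        rwa [inv_inv] at h4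
      rw [h2]
      exact y.2 W hW hWO this
  choose d hd using hker
  have hdinj : Function.Injective d := fun p p' h ↦ by
    apply Subtype.ext
    apply polyComb_injective hxtr he (M + 1)
    rw [← hd, ← hd, h]
  have h1 := card_le_card_ker_mul G
  rw [card_polyComb_domain] at h1
  have h2 := Nat.card_le_card_of_injective d hdinj
  have h3 : Nat.card (B ⧸ Ideal.span {t}) = Nat.card F ^ P := Module.natCard_eq_pow_finrank
  have h4 : Nat.card F ^ ((M + 1) * n') ≤ Nat.card F ^ (1 + P * (M + c0)) := by
    refine h1.trans ((Nat.mul_le_mul h2 hcard).trans ?_)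
    rw [h3, ← pow_mul, pow_add, pow_one]
  have h5 := (Nat.pow_le_pow_iff_right (Finite.one_lt_card (α := F))).1 h4
  rw [mul_comm] at h5
  omega

/-- Every element of `K` is a quotient of elements of `A`. -/
theorem exists_div_eq (x : K) : ∃ a b : coeffRing F O, b ≠ 0 ∧ x = (a : K) / b := by
  obtain ⟨y, hyA, hy⟩ := exists_nonconstant F O
  have hyt := transcendental_of_one_lt hy
  obtain ⟨g, hg0, hg⟩ := exists_aeval_mul_mem hyt x
  have hgy : aeval y g ≠ 0 := fun h ↦ hg0 (transcendental_iff.1 hyt _ h)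
  have hgA : aeval y g ∈ coeffRing F O := fun W hW hWO ↦ aeval_mem (hyA W hW hWO) g
  refine ⟨⟨_, fun W hW hWO ↦ hg W (hyA W hW hWO)⟩, ⟨_, hgA⟩, fun h ↦ hgy (congrArg Subtype.val h), ?_⟩
  simp only
  field_simp

end Nonconstant

end DrinfeldLattice

/-! ### The product formula for elements of `A` -/

namespace DrinfeldLattice

/-- Removes the constants from the asymptotic counts below by letting the exponent tend to infinity.
-/
theorem le_of_forall_pow_le_mul_pow {x y c : ℝ} (hy : 0 < y)
    (h : ∀ k : ℕ, x ^ k ≤ c * y ^ k) : x ≤ y := by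
  by_contra! hlt
  obtain ⟨k, hk⟩ := pow_unbounded_of_one_lt c ((one_lt_div hy).2 hlt)
  rw [div_pow, lt_div_iff₀ (pow_pos hy k)] at hk
  linarith [h k]

section ProductFormula

variable {F K : Type*} [Field F] [Field K] [Algebra F K] [IsGlobalFunctionField F K]
  {O : ValuationSubring K} [IsDiscreteValuationRing O]

theorem card_quotient_span_pow {π : O} (hπ : Irreducible π) (j : ℕ) :
    Nat.card (O ⧸ Ideal.span {π ^ j}) = qInf O ^ j := by
  rw [← Ideal.span_singleton_pow, ← hπ.maximalIdeal_eq, ← Submodule.cardQuot_apply,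
    cardQuot_pow_of_prime (IsDiscreteValuationRing.not_a_field O), Submodule.cardQuot_apply]
  rfl

theorem finite_quotient_span_pow (F : Type*) {K : Type*} [Field F] [Field K] [Algebra F K]
    [IsGlobalFunctionField F K] {O : ValuationSubring K} [IsDiscreteValuationRing O]
    {π : O} (hπ : Irreducible π) (j : ℕ) : Finite (O ⧸ Ideal.span {π ^ j}) := by
  apply Nat.finite_of_card_ne_zero
  rw [card_quotient_span_pow hπ]
  have := one_lt_qInf' F O
  have : (1 : ℕ) < qInf O := by exact_mod_cast this
  positivity

/-- Multiply by π^j and reduce modulo π^(j+1). This is injective, since a difference in the kernel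
would be a nonzero element of `A` of absolute value < 1. -/
theorem finite_ball_zpow_and_card_le (j : ℕ) :
    Finite {a : coeffRing F O // absInf F O (a : K) ≤ (qInf O : ℝ) ^ j} ∧
    Nat.card {a : coeffRing F O // absInf F O (a : K) ≤ (qInf O : ℝ) ^ j} ≤ qInf O ^ (j + 1) := by
  obtain ⟨π, hπ⟩ := IsDiscreteValuationRing.exists_irreducible O
  have hq := one_lt_qInf' F O
  have hπ0 : (π : K) ≠ 0 := fun h ↦ hπ.ne_zero (Subtype.ext h)
  have := finite_quotient_span_pow F hπ (j + 1)
  have hmem : ∀ a : {a : coeffRing F O // absInf F O (a : K) ≤ (qInf O : ℝ) ^ j},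
      ((a : coeffRing F O) : K) * (π : K) ^ j ∈ O := fun a ↦ by
    rw [← absInf_le_one_iff (F := F), map_mul, map_pow, absInf_uniformizer F O hπ]
    have h2 : (0 : ℝ) < (qInf O : ℝ) ^ j := by positivity
    rw [inv_pow, ← div_eq_mul_inv, div_le_one h2]
    exact a.2
  let f : {a : coeffRing F O // absInf F O (a : K) ≤ (qInf O : ℝ) ^ j} →
      O ⧸ Ideal.span {π ^ (j + 1)} := fun a ↦ Ideal.Quotient.mk _ ⟨_, hmem a⟩
  have hf : Function.Injective f := by
    intro a b hab
    obtain ⟨c, hc⟩ := Ideal.mem_span_singleton.1 ((Ideal.Quotient.mk_eq_mk_iff_sub_mem _ _).1 hab)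
    have h1 : ((a : coeffRing F O) - (b : coeffRing F O) : K) = π * c := by
      have h2 := congrArg (Subtype.val) hc
      have h3 : ((a : coeffRing F O) : K) * (π : K) ^ j - ((b : coeffRing F O) : K) * (π : K) ^ j
        = (π : K) ^ (j + 1) * c := h2
      apply mul_right_cancel₀ (pow_ne_zero j hπ0)
      linear_combination h3
    apply Subtype.ext
    by_contra hne
    have h4 : ((a : coeffRing F O) - (b : coeffRing F O) : K) ≠ 0 :=
      fun h ↦ hne (Subtype.ext (sub_eq_zero.1 h))
    have h5 := one_le_absInf ((coeffRing F O).sub_mem a.1.2 b.1.2) h4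
    rw [h1, map_mul, absInf_uniformizer F O hπ] at h5
    have h6 := absInf_coe_le_one (F := F) O c
    have h7 := inv_lt_one_of_one_lt₀ hq
    have h8 : (0 : ℝ) < (qInf O : ℝ)⁻¹ := by positivity
    nlinarith
  refine ⟨Finite.of_injective f hf, ?_⟩
  rw [← card_quotient_span_pow hπ]
  exact Nat.card_le_card_of_injective f hf

theorem finite_ball (R : ℝ) : Finite {a : coeffRing F O // absInf F O (a : K) ≤ R} := by
  obtain ⟨j, hj⟩ := pow_unbounded_of_one_lt R (one_lt_qInf' F O)
  have := (finite_ball_zpow_and_card_le (F := F) (O := O) j).1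
  exact Finite.of_injective (fun a : {a : coeffRing F O // absInf F O (a : K) ≤ R} ↦
    (⟨a.1, a.2.trans hj.le⟩ : {a : coeffRing F O // absInf F O (a : K) ≤ (qInf O : ℝ) ^ j}))
    fun a b h ↦ Subtype.ext (congrArg (fun x ↦ x.1) h)

/-- The elements of `A` of absolute value at most `R`. -/
def ballA (F : Type*) {K : Type*} [Field F] [Field K] [Algebra F K]
    [IsGlobalFunctionField F K] (O : ValuationSubring K) [IsDiscreteValuationRing O] (R : ℝ)
    (hR : 0 ≤ R) : AddSubgroup (coeffRing F O) where
  carrier := {a | absInf F O (a : K) ≤ R}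
  add_mem' ha hb := (absInf_add_le_max O _ _).trans (max_le ha hb)
  zero_mem' := by simpa
  neg_mem' := by simp

/-- |x| is the order of O/(x⁻¹), whose dimension over `F` is at most [K : F(x⁻¹)] = [K : F(x)]. -/
theorem absInf_le_pow_finrank {x : K} (hx : 1 < absInf F O x) :
    absInf F O x ≤ (Nat.card F : ℝ) ^ Module.finrank F⟮x⟯ K := by
  have hFf := finite_constants_of F K
  obtain ⟨π, hπ⟩ := IsDiscreteValuationRing.exists_irreducible O
  have hx0 : x ≠ 0 := by rintro rfl; rw [map_zero] at hx; linarith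
  have hxi : absInf F O x⁻¹ < 1 := by rw [map_inv₀]; exact inv_lt_one_of_one_lt₀ hx
  have hxO : x⁻¹ ∈ O := absInf_le_one_iff.1 hxi.le
  have htr := transcendental_of_mem_nonunits (F := F) (inv_ne_zero hx0)
    (absInf_lt_one_iff.1 hxi)
  obtain ⟨m, u, hu⟩ := IsDiscreteValuationRing.eq_unit_mul_pow_irreducible
      (x := (⟨x⁻¹, hxO⟩ : O)) (fun h ↦ inv_ne_zero hx0 (congrArg Subtype.val h)) hπ
  have habs : absInf F O x = (qInf O : ℝ) ^ m := by
    have h1 : x⁻¹ = ((u : O) : K) * (π : K) ^ m := by simpa using congrArg (Subtype.val) hu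
    have h2 := congrArg (absInf F O) h1
    rw [map_inv₀, map_mul, absInf_coe_unit, map_pow, absInf_uniformizer F O hπ, one_mul, inv_pow,
      inv_inj] at h2
    exact h2
  have hspan : Ideal.span {(⟨x⁻¹, hxO⟩ : O)} = Ideal.span {π ^ m} := by
    rw [Ideal.span_singleton_eq_span_singleton, hu]
    exact (associated_unit_mul_left _ _ u.isUnit)
  obtain ⟨h1, h2⟩ := finite_quotient_and_finrank_le (B := valSubalgebra F O) ⟨x⁻¹, hxO⟩ htr
  have h3 : Nat.card (valSubalgebra F O ⧸ Ideal.span {(⟨x⁻¹, hxO⟩ : valSubalgebra F O)}) =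
      qInf O ^ m := by
    rw [← card_quotient_span_pow hπ, ← hspan]
    rfl
  rw [Module.natCard_eq_pow_finrank (K := F)] at h3
  rw [habs]
  have h4 : Nat.card F ^ Module.finrank F (valSubalgebra F O ⧸
      Ideal.span {(⟨x⁻¹, hxO⟩ : valSubalgebra F O)}) ≤ Nat.card F ^ Module.finrank F⟮x⁻¹⟯ K :=
    Nat.pow_le_pow_right (Finite.one_lt_card (α := F)).le h2
  rw [h3, adjoin_inv] at h4
  exact_mod_cast h4

/-- Balls in `A` have at least as many elements as expected. -/
theorem exists_pow_le_card_ballA {x : K} (hxA : x ∈ coeffRing F O) (hx : 1 < absInf F O x) :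
    ∃ j : ℕ, ∀ k : ℕ, Nat.card F ^ ((k + 1) * Module.finrank F⟮x⟯ K) ≤
      Nat.card {a : coeffRing F O // absInf F O (a : K) ≤ (qInf O : ℝ) ^ j * absInf F O x ^ k} := by
  have htr := transcendental_of_one_lt hx
  obtain ⟨e, he, heW⟩ := exists_linearIndependent_mem htr
  obtain ⟨M, hM⟩ := Finset.exists_le (Finset.univ.image fun i ↦ absInf F O (e i))
  obtain ⟨j, hj⟩ := pow_unbounded_of_one_lt M (one_lt_qInf' F O)
  refine ⟨j, fun k ↦ ?_⟩
  rw [← card_polyComb_domain (F := F)]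
  have := finite_ball (F := F) (O := O) ((qInf O : ℝ) ^ j * absInf F O x ^ k)
  -- The elements counted are Σ p_i(x) e_i with deg p_i ≤ k; q_∞^j bounds the |e_i|, and |x|^k
  -- bounds the |p_i(x)|.
  have hb : ∀ p, absInf F O (polyComb (F := F) x e (k + 1) p) ≤
      (qInf O : ℝ) ^ j * absInf F O x ^ k := fun p ↦ by
    rw [polyComb_apply]
    refine absInf_sum_le _ _ (by positivity) fun i _ ↦ ?_
    rw [map_mul, mul_comm]
    refine mul_le_mul ((hM _ (Finset.mem_image_of_mem _ (Finset.mem_univ i))).trans hj.le) ?_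
      ((absInf F O).nonneg _) (by positivity)
    have hp' : (p i : F[X]).natDegree < k + 1 := by
      have := mem_degreeLT.1 (p i).2
      rcases eq_or_ne (p i : F[X]) 0 with h | h
      · simp [h]
      · exact (natDegree_lt_iff_degree_lt h).2 this
    rw [aeval_eq_sum_range' hp']
    refine absInf_sum_le _ _ (by positivity) fun l hl ↦ ?_
    rw [Algebra.smul_def, map_mul, map_pow]
    have h1 := absInf_le_one_iff (F := F).2 (constants_mem F O ((p i : F[X]).coeff l))
    refine (mul_le_of_le_one_left (by positivity) h1).trans (pow_le_pow_right₀ hx.le ?_)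
    simp at hl; omega
  have hA : ∀ p, polyComb (F := F) x e (k + 1) p ∈ coeffRing F O := fun p W hW hWO ↦ by
    rw [polyComb_apply]
    exact sum_mem fun i _ ↦ W.mul_mem _ _ (aeval_mem (hxA W hW hWO) _) (heW i W (hxA W hW hWO))
  refine Nat.card_le_card_of_injective (fun p ↦ ⟨⟨_, hA p⟩, hb p⟩) fun p p' h ↦ ?_
  exact polyComb_injective htr he (k + 1) (congrArg (fun y ↦ ((y.1 : coeffRing F O) : K)) h)

/-- The lower bound for the number of elements of `A` in a ball meets the upper bound from reduction
modulo powers of a uniformizer. Both grow geometrically in k, so the rates can be compared. -/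
theorem pow_finrank_le_absInf {x : K} (hxA : x ∈ coeffRing F O) (hx : 1 < absInf F O x) :
    (Nat.card F : ℝ) ^ Module.finrank F⟮x⟯ K ≤ absInf F O x := by
  have hFf := finite_constants_of F K
  have hq := one_lt_qInf' F O
  obtain ⟨j, hj⟩ := exists_pow_le_card_ballA hxA hx
  have hx0 : x ≠ 0 := by rintro rfl; rw [map_zero] at hx; linarith
  obtain ⟨m, hm⟩ := exists_absInf_eq (F := F) (O := O) hx0
  have hm0 : 0 ≤ m := by
    by_contra! h
    rw [hm] at hx
    exact absurd hx (zpow_lt_one_of_neg₀ hq h).not_gt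
  lift m to ℕ using hm0
  rw [zpow_natCast] at hm
  apply le_of_forall_pow_le_mul_pow (c := (qInf O : ℝ) ^ (j + 1)) (by linarith)
  intro k
  have h1 : (Nat.card F : ℝ) ^ ((k + 1) * Module.finrank F⟮x⟯ K) ≤
      (qInf O : ℝ) ^ (j + m * k + 1) := by
    have h2 := (finite_ball_zpow_and_card_le (F := F) (O := O) (j + m * k)).2
    have h3 : (qInf O : ℝ) ^ (j + m * k) = (qInf O : ℝ) ^ j * absInf F O x ^ k := by
      rw [hm]; ring
    rw [h3] at h2
    exact_mod_cast (hj k).trans h2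
  have h4 : (1 : ℝ) ≤ Nat.card F := by exact_mod_cast (Finite.one_lt_card (α := F)).le
  calc ((Nat.card F : ℝ) ^ Module.finrank F⟮x⟯ K) ^ k
      ≤ (Nat.card F : ℝ) ^ ((k + 1) * Module.finrank F⟮x⟯ K) := by
        rw [← pow_mul]
        apply pow_le_pow_right₀ h4
        nlinarith
    _ ≤ _ := h1
    _ = _ := by rw [hm]; ring

/-- Elements of the larger ball that vanish modulo `x` are x b with |b| ≤ R. -/
theorem card_ballA_le {x : coeffRing F O} (hx0 : x ≠ 0) [Finite (coeffRing F O ⧸ Ideal.span {x})]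
    (R : ℝ) (hR : 0 ≤ R) :
    Nat.card {a : coeffRing F O // absInf F O (a : K) ≤ R * absInf F O (x : K)} ≤
      Nat.card {a : coeffRing F O // absInf F O (a : K) ≤ R} *
        Nat.card (coeffRing F O ⧸ Ideal.span {x}) := by
  have hx0' : 0 < absInf F O (x : K) := (absInf F O).pos fun h ↦ hx0 (Subtype.ext h)
  let G : ballA F O (R * absInf F O (x : K)) (by positivity) →+ coeffRing F O ⧸ Ideal.span {x} :=
    (Ideal.Quotient.mk (Ideal.span {x})).toAddMonoidHom.comp (AddSubgroup.subtype _)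
  refine (card_le_card_ker_mul G).trans (Nat.mul_le_mul_right _ ?_)
  have h1 : ∀ a : G.ker, ∃ b : coeffRing F O, (a.1 : coeffRing F O) = x * b := fun a ↦
    Ideal.mem_span_singleton.1 (Ideal.Quotient.eq_zero_iff_mem.1 a.2)
  choose b hb using h1
  have := finite_ball (F := F) (O := O) R
  refine Nat.card_le_card_of_injective (fun a ↦ ⟨b a, ?_⟩) fun a a' h ↦ ?_
  · have h2 := a.1.2
    change absInf F O ((a.1 : coeffRing F O) : K) ≤ _ at h2
    rw [hb, MulMemClass.coe_mul, map_mul, mul_comm] at h2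
    exact le_of_mul_le_mul_right h2 hx0'
  · have h3 : b a = b a' := congrArg (fun y ↦ y.1) h
    apply Subtype.ext
    apply Subtype.ext
    rw [hb, hb, h3]

/-- Each enlargement of the radius by |x| multiplies the count by at most q^(deg x), while
polynomial combinations give growth by q^[K : F(x)]. -/
theorem finrank_le_degA {x : coeffRing F O} (hx : 1 < absInf F O (x : K))
    [Module.Finite F (coeffRing F O ⧸ Ideal.span {x})] :
    Module.finrank F⟮(x : K)⟯ K ≤ degA F O x := by
  have hFf := finite_constants_of F K
  have : Finite (coeffRing F O ⧸ Ideal.span {x}) := Module.finite_of_finite F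
  have hx0 : x ≠ 0 := by rintro rfl; simp at hx; linarith
  obtain ⟨j, hj⟩ := exists_pow_le_card_ballA x.2 hx
  have h1 : ∀ k : ℕ, Nat.card {a : coeffRing F O // absInf F O (a : K) ≤
      (qInf O : ℝ) ^ j * absInf F O (x : K) ^ k} ≤ Nat.card {a : coeffRing F O //
        absInf F O (a : K) ≤ (qInf O : ℝ) ^ j} * (Nat.card F ^ degA F O x) ^ k := by
    intro k
    induction k with
    | zero => simp
    | succ k ih =>
      have := card_ballA_le hx0 ((qInf O : ℝ) ^ j * absInf F O (x : K) ^ k) (by positivity)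
      rw [mul_assoc, ← pow_succ] at this
      refine this.trans ((Nat.mul_le_mul_right _ ih).trans ?_)
      have hcard : Nat.card (coeffRing F O ⧸ Ideal.span {x}) = Nat.card F ^ degA F O x :=
        Module.natCard_eq_pow_finrank
      rw [hcard, mul_assoc, ← pow_succ]
  have h2 : (Nat.card F : ℝ) ^ Module.finrank F⟮(x : K)⟯ K ≤ (Nat.card F : ℝ) ^ degA F O x := by
    have hF : (1 : ℝ) ≤ Nat.card F := by exact_mod_cast (Finite.one_lt_card (α := F)).le
    apply le_of_forall_pow_le_mul_pow (c := Nat.card {a : coeffRing F O //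
        absInf F O (a : K) ≤ (qInf O : ℝ) ^ j}) (by positivity)
    intro k
    calc ((Nat.card F : ℝ) ^ Module.finrank F⟮(x : K)⟯ K) ^ k
        ≤ (Nat.card F : ℝ) ^ ((k + 1) * Module.finrank F⟮(x : K)⟯ K) := by
          rw [← pow_mul]
          apply pow_le_pow_right₀ hF
          nlinarith
      _ ≤ _ := by exact_mod_cast (hj k).trans (h1 k)
  have hF : (1 : ℝ) < Nat.card F := by exact_mod_cast (Finite.one_lt_card (α := F))
  exact (pow_le_pow_iff_right₀ hF).1 h2

/-- The residue ring `A / (a)` is finite. -/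
theorem finite_quotient_coeffRing {a : coeffRing F O} (ha : a ≠ 0) :
    Module.Finite F (coeffRing F O ⧸ Ideal.span {a}) := by
  have ha0 : (a : K) ≠ 0 := fun h ↦ ha (Subtype.ext h)
  by_cases hat : Transcendental F (a : K)
  · exact (finite_quotient_and_finrank_le a hat).1
  · obtain ⟨c, hc⟩ := IsGlobalFunctionField.constants_closed (F := F) (a : K) (not_not.1 hat)
    have hc' : algebraMap F (coeffRing F O) c = a := Subtype.ext hc
    have hu : IsUnit a := by
      rw [← hc']
      refine (IsUnit.mk0 c ?_).map _
      rintro rfl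
      apply ha
      rw [← hc', map_zero]
    have : Subsingleton (coeffRing F O ⧸ Ideal.span {a}) := by
      rw [Ideal.Quotient.subsingleton_iff, Ideal.span_singleton_eq_top]; exact hu
    infer_instance

theorem finite_quotient_coeffRing' {a : coeffRing F O} (ha : a ≠ 0) :
    Finite (coeffRing F O ⧸ Ideal.span {a}) := by
  have hFf := finite_constants_of F K
  have := finite_quotient_coeffRing ha
  exact Module.finite_of_finite F

theorem card_quotient_coeffRing {a : coeffRing F O} (ha : a ≠ 0) :
    Nat.card (coeffRing F O ⧸ Ideal.span {a}) = Nat.card F ^ degA F O a := by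
  have := finite_quotient_coeffRing ha
  exact Module.natCard_eq_pow_finrank

/-- The product formula for elements of `A`. -/
theorem absInf_eq_pow_degA {a : coeffRing F O} (ha : a ≠ 0) :
    absInf F O (a : K) = (Nat.card F : ℝ) ^ degA F O a := by
  have hFf := finite_constants_of F K
  have ha0 : (a : K) ≠ 0 := fun h ↦ ha (Subtype.ext h)
  have hfin := finite_quotient_coeffRing ha
  by_cases hat : Transcendental F (a : K)
  · have h1 := one_lt_absInf_of_transcendental a.2 hat
    have h2 := (finite_quotient_and_finrank_le a hat).2
    rw [← degA] at h2
    -- Both sides are compared with q^[K : F(a)].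
    rw [← le_antisymm (finrank_le_degA h1) h2]
    exact le_antisymm (absInf_le_pow_finrank h1) (pow_finrank_le_absInf a.2 h1)
  · obtain ⟨c, hc⟩ := IsGlobalFunctionField.constants_closed (F := F) (a : K) (not_not.1 hat)
    have hc' : algebraMap F (coeffRing F O) c = a := Subtype.ext hc
    have hc0 : c ≠ 0 := by
      rintro rfl
      apply ha
      rw [← hc', map_zero]
    have hu : IsUnit a := by
      rw [← hc']
      exact (IsUnit.mk0 c hc0).map _
    have : Subsingleton (coeffRing F O ⧸ Ideal.span {a}) := by
      rw [Ideal.Quotient.subsingleton_iff, Ideal.span_singleton_eq_top]; exact hu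
    rw [degA, Module.finrank_zero_of_subsingleton, pow_zero, ← hc, absInf_algebraMap hc0]

end ProductFormula

end DrinfeldLattice

/-! ### F-linear polynomials and finite F-subspaces -/

namespace DrinfeldLattice

section QLinear

variable {F : Type*} [Field F] [Finite F]

theorem add_pow_card_pow (F : Type*) [Field F] [Finite F] {R : Type*} [CommRing R] [Algebra F R]
    (x y : R) (k : ℕ) :
    (x + y) ^ Nat.card F ^ k = x ^ Nat.card F ^ k + y ^ Nat.card F ^ k := by
  have := Fintype.ofFinite F
  rw [Nat.card_eq_fintype_card]
  induction k with
  | zero => simp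
  | succ k ih =>
    simp only [pow_succ, pow_mul, ih]
    exact map_add (FiniteField.frobeniusAlgHom F R) _ _

theorem sub_pow_card_pow (F : Type*) [Field F] [Finite F] {R : Type*} [CommRing R] [Algebra F R]
    (x y : R) (k : ℕ) :
    (x - y) ^ Nat.card F ^ k = x ^ Nat.card F ^ k - y ^ Nat.card F ^ k := by
  rw [eq_sub_iff_add_eq, ← add_pow_card_pow, sub_add_cancel]

theorem algebraMap_pow_card_pow {R : Type*} [CommRing R] [Algebra F R] (c : F) (k : ℕ) :
    (algebraMap F R c) ^ Nat.card F ^ k = algebraMap F R c := by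
  have := Fintype.ofFinite F
  rw [Nat.card_eq_fintype_card, ← map_pow, FiniteField.pow_card_pow]

theorem sum_pow_card (F : Type*) [Field F] [Finite F] {R : Type*} [CommRing R] [Algebra F R]
    {ι : Type*} (s : Finset ι) (f : ι → R) :
    (∑ i ∈ s, f i) ^ Nat.card F = ∑ i ∈ s, f i ^ Nat.card F := by
  have := Fintype.ofFinite F
  rw [Nat.card_eq_fintype_card]
  exact map_sum (FiniteField.frobeniusAlgHom F R) _ _

variable {C : Type*} [Field C] [Algebra F C]

/-- The `C`-space of polynomials in which only the monomials `X ^ (q ^ j)` occur. -/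
def qLinear (F : Type*) (C : Type*) [Field F] [Field C] : Submodule C C[X] where
  carrier := {P | ∀ i, P.coeff i ≠ 0 → ∃ j, i = Nat.card F ^ j}
  add_mem' {P Q} hP hQ i hi := by
    by_cases h : P.coeff i = 0
    · rw [coeff_add, h, zero_add] at hi
      exact hQ i hi
    · exact hP i h
  zero_mem' := by simp
  smul_mem' c P hP i hi := by
    rw [coeff_smul, smul_eq_mul] at hi
    exact hP i (right_ne_zero_of_mul hi)

theorem X_mem_qLinear : (X : C[X]) ∈ qLinear F C := fun i hi ↦
  ⟨0, by rw [coeff_X] at hi; by_contra h; simp at h; simp [Ne.symm h] at hi⟩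

theorem pow_card_mem_qLinear {P : C[X]} (hP : P ∈ qLinear F C) : P ^ Nat.card F ∈ qLinear F C := by
  rw [P.as_sum_support, sum_pow_card F]
  refine Submodule.sum_mem _ fun i hi k hk ↦ ?_
  obtain ⟨j, rfl⟩ := hP i (mem_support_iff.1 hi)
  rw [monomial_pow, coeff_monomial] at hk
  refine ⟨j + 1, ?_⟩
  by_contra h
  rw [pow_succ] at h
  exact hk (if_neg (Ne.symm h))

theorem aeval_add_of_mem_qLinear {R : Type*} [CommRing R] [Algebra F R] [Algebra C R] {P : C[X]}
    (hP : P ∈ qLinear F C) (x y : R) : aeval (x + y) P = aeval x P + aeval y P := by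
  simp only [aeval_eq_sum_range, ← Finset.sum_add_distrib]
  refine Finset.sum_congr rfl fun i _ ↦ ?_
  by_cases h : P.coeff i = 0
  · simp [h]
  · obtain ⟨j, rfl⟩ := hP i h
    rw [add_pow_card_pow, smul_add]

theorem eval_smul_of_mem_qLinear {P : C[X]} (hP : P ∈ qLinear F C) (c : F) (x : C) :
    eval (c • x) P = c • eval x P := by
  simp only [eval_eq_sum_range, Finset.smul_sum]
  refine Finset.sum_congr rfl fun i _ ↦ ?_
  by_cases h : P.coeff i = 0
  · simp [h]
  · obtain ⟨j, rfl⟩ := hP i h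
    rw [Algebra.smul_def, mul_pow, algebraMap_pow_card_pow, Algebra.smul_def]
    ring

theorem comp_X_sub_C_of_mem_qLinear {P : C[X]} (hP : P ∈ qLinear F C) (t : C) :
    P.comp (X - Polynomial.C t) = P - Polynomial.C (P.eval t) := by
  have h1 := aeval_add_of_mem_qLinear hP (X - Polynomial.C t) (Polynomial.C t)
  rw [sub_add_cancel, aeval_X_left_apply] at h1
  have h2 : aeval (Polynomial.C t) P = Polynomial.C (P.eval t) := aeval_algebraMap_apply_eq_algebraMap_eval t P
  rw [eq_sub_iff_add_eq, ← h2]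
  exact h1.symm

theorem prod_X_sub_C_finite (F : Type*) [Field F] [Fintype F] :
    ∏ c : F, (X - Polynomial.C c) = X ^ Fintype.card F - X := by
  have hq := Fintype.one_lt_card (α := F)
  have hmonic : (X ^ Fintype.card F - X : F[X]).Monic := monic_X_pow_sub (by
    rw [degree_X]; exact_mod_cast hq)
  have hroots := FiniteField.roots_X_pow_card_sub_X F
  have := Polynomial.prod_multiset_X_sub_C_of_monic_of_roots_card_eq hmonic (by
    rw [hroots, FiniteField.X_pow_card_sub_X_natDegree_eq F hq]; rfl)
  rw [hroots] at this
  exact this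

/-- For `b` ≠ 0, substitute Y/b into ∏ (X - c) = X^q - X and clear b^q. -/
theorem prod_sub_C_smul [Fintype F] (Y : C[X]) (b : C) :
    ∏ c : F, (Y - Polynomial.C (c • b)) =
      Y ^ Fintype.card F - Polynomial.C (b ^ (Fintype.card F - 1)) * Y := by
  have hq := Fintype.one_lt_card (α := F)
  rcases eq_or_ne b 0 with rfl | hb
  · have : Fintype.card F - 1 ≠ 0 := by omega
    simp [this]
  · have h := congrArg (aeval (Polynomial.C b⁻¹ * Y)) (prod_X_sub_C_finite F)
    simp only [map_prod, map_sub, map_pow, aeval_X, aeval_C] at h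
    have h2 : ∀ c : F, (Y - Polynomial.C (c • b)) =
        Polynomial.C b * (Polynomial.C b⁻¹ * Y - algebraMap F C[X] c) := fun c ↦ by
      rw [mul_sub, ← mul_assoc, ← C_mul, mul_inv_cancel₀ hb, C_1, one_mul, Algebra.smul_def,
        C_mul, mul_comm]
      rfl
    simp only [h2, Finset.prod_mul_distrib, h, Finset.prod_const, Finset.card_univ]
    have hbq : b ^ Fintype.card F = b ^ (Fintype.card F - 1) * b := by
      rw [← pow_succ, Nat.sub_add_cancel hq.le]
    have h3 : b * b⁻¹ = 1 := mul_inv_cancel₀ hb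
    rw [mul_sub, mul_pow, ← mul_assoc, ← mul_pow, ← C_mul, h3, C_1, one_pow, one_mul, ← C_pow,
      hbq, ← mul_assoc, ← C_mul, mul_assoc, h3, mul_one]

end QLinear

section FiniteSubspace

variable {F C : Type*} [Field F] [Field C] [Algebra F C]

/-- The elements of a finite `F`-subspace, as a finset. -/
noncomputable def elems (V : Submodule F C) [Finite V] : Finset C :=
  (Set.toFinite (V : Set C)).toFinset

theorem mem_elems {V : Submodule F C} [Finite V] {x : C} : x ∈ elems V ↔ x ∈ V := by
  simp [elems]

open Classical in
/-- The non-zero elements of a finite `F`-subspace. -/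
noncomputable def nzElems (V : Submodule F C) [Finite V] : Finset C := (elems V).erase 0

theorem mem_nzElems {V : Submodule F C} [Finite V] {x : C} : x ∈ nzElems V ↔ x ∈ V ∧ x ≠ 0 := by
  simp [nzElems, mem_elems, and_comm]

theorem card_elems (V : Submodule F C) [Finite V] : (elems V).card = Nat.card V := by
  rw [elems, ← Nat.card_eq_card_finite_toFinset]; rfl

theorem card_nzElems_add_one (V : Submodule F C) [Finite V] :
    (nzElems V).card + 1 = Nat.card V := by
  classical
  rw [nzElems, Finset.card_erase_add_one (mem_elems.2 V.zero_mem), card_elems]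

theorem prod_elems {M : Type*} [CommMonoid M] (V : Submodule F C) [Finite V] (f : C → M) :
    ∏ x ∈ elems V, f x = f 0 * ∏ x ∈ nzElems V, f x := by
  classical
  rw [nzElems, Finset.mul_prod_erase _ _ (mem_elems.2 V.zero_mem)]

theorem prod_elems_sup {M : Type*} [CommMonoid M] {V T V' : Submodule F C} [Finite V] [Finite T]
    [Finite V'] (hd : Disjoint V T) (hV' : V ⊔ T = V') (f : C → M) :
    ∏ x ∈ elems V', f x = ∏ t ∈ elems T, ∏ v ∈ elems V, f (v + t) := by
  rw [← Finset.prod_product']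
  symm
  refine Finset.prod_bij (fun p _ ↦ p.2 + p.1) ?_ ?_ ?_ fun _ _ ↦ rfl
  · rintro ⟨t, v⟩ h
    rw [Finset.mem_product, mem_elems, mem_elems] at h
    rw [mem_elems, ← hV']
    exact Submodule.add_mem_sup h.2 h.1
  · rintro ⟨t, v⟩ h ⟨t', v'⟩ h' heq
    rw [Finset.mem_product, mem_elems, mem_elems] at h h'
    simp only at heq h h'
    have h1 : v - v' = t' - t := by linear_combination heq
    have h2 : v - v' ∈ V := V.sub_mem h.2 h'.2
    have h3 : v - v' ∈ T := by rw [h1]; exact T.sub_mem h'.1 h.1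
    have h4 := Submodule.disjoint_def.1 hd _ h2 h3
    have h5 := h4
    rw [h1] at h5
    rw [sub_eq_zero.1 h4, sub_eq_zero.1 h5]
  · intro x hx
    rw [mem_elems, ← hV', Submodule.mem_sup] at hx
    obtain ⟨v, hv, t, ht, rfl⟩ := hx
    exact ⟨(t, v), by simp [mem_elems, hv, ht], rfl⟩

/-- The monic polynomial vanishing on a finite subspace. -/
noncomputable def vanPoly (V : Submodule F C) [Finite V] : C[X] :=
  ∏ v ∈ elems V, (X - Polynomial.C v)

/-- The coefficient of `X` in `vanPoly`. -/
noncomputable def nzProd (V : Submodule F C) [Finite V] : C := ∏ v ∈ nzElems V, (-v)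

theorem nzProd_ne_zero (V : Submodule F C) [Finite V] : nzProd V ≠ 0 :=
  Finset.prod_ne_zero_iff.2 fun _ h ↦ neg_ne_zero.2 (mem_nzElems.1 h).2

theorem eval_vanPoly (V : Submodule F C) [Finite V] (z : C) :
    (vanPoly V).eval z = ∏ v ∈ elems V, (z - v) := by
  simp [vanPoly, eval_prod]

theorem eval_vanPoly_eq_zero {V : Submodule F C} [Finite V] {z : C} :
    (vanPoly V).eval z = 0 ↔ z ∈ V := by
  rw [eval_vanPoly, Finset.prod_eq_zero_iff]
  constructor
  · rintro ⟨v, hv, h⟩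
    rw [sub_eq_zero.1 h]
    exact mem_elems.1 hv
  · exact fun h ↦ ⟨z, mem_elems.2 h, sub_self z⟩

theorem coeff_zero_prod_X_sub_C {ι : Type*} (s : Finset ι) (f : ι → C) :
    (∏ i ∈ s, (X - Polynomial.C (f i))).coeff 0 = ∏ i ∈ s, (- f i) := by
  simp [coeff_zero_eq_eval_zero, eval_prod]

theorem coeff_one_vanPoly (V : Submodule F C) [Finite V] : (vanPoly V).coeff 1 = nzProd V := by
  rw [vanPoly, prod_elems, C_0, sub_zero, coeff_X_mul, coeff_zero_prod_X_sub_C, nzProd]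

theorem vanPoly_sup_comp {V T V' : Submodule F C} [Finite V] [Finite T] [Finite V']
    (hd : Disjoint V T) (hV' : V ⊔ T = V') :
    vanPoly V' = ∏ t ∈ elems T, (vanPoly V).comp (X - Polynomial.C t) := by
  rw [vanPoly, prod_elems_sup hd hV']
  refine Finset.prod_congr rfl fun t _ ↦ ?_
  rw [vanPoly, prod_comp]
  refine Finset.prod_congr rfl fun v _ ↦ ?_
  rw [sub_comp, X_comp, C_comp, C_add]
  ring

/-- Induction on generators. If P belongs to V and w is new, additivity gives P(X - cw) = P - cP(w),
so V ⊕ Fw has the polynomial P^q - P(w)^(q-1) P, which is again F-linear. -/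
theorem vanPoly_span_mem_qLinear [Finite F] {S : Set C} (hS : S.Finite)
    [Finite (Submodule.span F S)] : vanPoly (Submodule.span F S) ∈ qLinear F C := by
  rename_i hfin
  revert hfin
  induction S, hS using Set.Finite.induction_on with
  | empty =>
    intro hfin
    have : elems (Submodule.span F (∅ : Set C)) = {0} := by
      ext x; rw [mem_elems]; simp
    rw [vanPoly, this, Finset.prod_singleton, C_0, sub_zero]
    exact X_mem_qLinear
  | @insert w S hw hS ih =>
    intro hfin
    have := Fintype.ofFinite F
    have hmf : Module.Finite F (Submodule.span F S) := Module.Finite.span_of_finite F hS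
    have hfin1 : Finite (Submodule.span F S) := Module.finite_of_finite F
    have ih1 := @ih hfin1
    by_cases hwS : w ∈ Submodule.span F S
    · have : Submodule.span F (insert w S) = Submodule.span F S :=
        Submodule.span_insert_eq_span hwS
      have he : elems (Submodule.span F (insert w S)) = elems (Submodule.span F S) := by
        ext x; rw [mem_elems, mem_elems, this]
      rw [vanPoly, he]
      exact ih1
    · have hw0 : w ≠ 0 := by rintro rfl; exact hwS (Submodule.zero_mem _)
      have hmf2 : Module.Finite F (Submodule.span F {w}) := Module.Finite.span_singleton F w
      have hfin2 : Finite (Submodule.span F {w}) := Module.finite_of_finite F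
      have hd : Disjoint (Submodule.span F S) (Submodule.span F {w}) :=
        Submodule.disjoint_span_singleton.2 fun h ↦ absurd h hwS
      rw [vanPoly_sup_comp hd (by rw [sup_comm, Submodule.span_insert])]
      have h1 : ∏ t ∈ elems (Submodule.span F {w}), (vanPoly (Submodule.span F S)).comp
          (X - Polynomial.C t) = ∏ c : F, (vanPoly (Submodule.span F S)).comp
            (X - Polynomial.C (c • w)) := by
        symm
        refine Finset.prod_bij (fun c _ ↦ c • w) ?_ ?_ ?_ fun _ _ ↦ rfl
        · intro c _
          rw [mem_elems]
          exact Submodule.smul_mem _ _ (Submodule.mem_span_singleton_self w)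
        · intro c _ c' _ h
          exact smul_left_injective F hw0 h
        · intro t ht
          obtain ⟨c, rfl⟩ := Submodule.mem_span_singleton.1 (mem_elems.1 ht)
          exact ⟨c, Finset.mem_univ _, rfl⟩
      rw [h1]
      simp only [comp_X_sub_C_of_mem_qLinear ih1, eval_smul_of_mem_qLinear ih1]
      rw [prod_sub_C_smul, ← Nat.card_eq_fintype_card]
      refine Submodule.sub_mem _ (pow_card_mem_qLinear ih1) ?_
      rw [← smul_eq_C_mul]
      exact Submodule.smul_mem _ _ ih1

theorem vanPoly_mem_qLinear [Finite F] (V : Submodule F C) [Finite V] : vanPoly V ∈ qLinear F C := by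
  have h : Submodule.span F (V : Set C) = V := Submodule.span_eq V
  have hfin : Finite (Submodule.span F (V : Set C)) := by rw [h]; infer_instance
  have he : elems (Submodule.span F (V : Set C)) = elems V := by
    ext x; rw [mem_elems, mem_elems, h]
  have := vanPoly_span_mem_qLinear (F := F) (Set.toFinite (V : Set C))
  rw [vanPoly, he] at this
  exact this

theorem vanPoly_sup [Finite F] {V T V' : Submodule F C} [Finite V] [Finite T] [Finite V']
    (hd : Disjoint V T) (hV' : V ⊔ T = V') :
    vanPoly V' = ∏ t ∈ elems T, (vanPoly V - Polynomial.C ((vanPoly V).eval t)) := by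
  rw [vanPoly_sup_comp hd hV']
  simp only [comp_X_sub_C_of_mem_qLinear (vanPoly_mem_qLinear V)]

theorem eval_vanPoly_zero (V : Submodule F C) [Finite V] : (vanPoly V).eval 0 = 0 :=
  eval_vanPoly_eq_zero.2 V.zero_mem

/-- Comparison of linear coefficients in the factorization of `vanPoly V'`: the factor with t = 0
has no constant term, so it contributes its linear coefficient and the others their constant terms.
-/
theorem nzProd_sup [Finite F] {V T V' : Submodule F C} [Finite V] [Finite T] [Finite V']
    (hd : Disjoint V T) (hV' : V ⊔ T = V') :
    nzProd V' = nzProd V * ∏ t ∈ nzElems T, (-(vanPoly V).eval t) := by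
  rw [← coeff_one_vanPoly, vanPoly_sup hd hV', prod_elems, eval_vanPoly_zero, C_0, sub_zero,
    mul_coeff_one, coeff_zero_eq_eval_zero, eval_vanPoly_zero, zero_mul, zero_add,
    coeff_one_vanPoly, coeff_zero_eq_eval_zero, eval_prod]
  simp [eval_vanPoly_zero]

end FiniteSubspace

end DrinfeldLattice

/-! ### Exponential functions and isogenies over ultrametric fields -/

namespace DrinfeldLattice

open Filter Topology

section Ultrametric

variable {C : Type*} [NormedField C] [IsUltrametricDist C]

theorem norm_one_sub_eq_one {x : C} (hx : ‖x‖ < 1) : ‖1 - x‖ = 1 := by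
  have := IsUltrametricDist.norm_add_eq_max_of_norm_ne_norm (x := (1 : C)) (y := -x)
    (by rw [norm_one, norm_neg]; exact hx.ne')
  rw [sub_eq_add_neg, this, norm_one, norm_neg, max_eq_left hx.le]

theorem norm_one_sub_div {x z : C} (h : ‖z‖ < ‖x‖) : ‖1 - z / x‖ = 1 := by
  apply norm_one_sub_eq_one
  rw [norm_div]
  exact (div_lt_one ((norm_nonneg z).trans_lt h)).2 h

theorem norm_prod_sub_one_le {ι : Type*} (s : Finset ι) (f : ι → C) {δ : ℝ} (hδ : 0 ≤ δ)
    (hf : ∀ i ∈ s, ‖f i‖ ≤ 1) (h : ∀ i ∈ s, ‖f i - 1‖ ≤ δ) : ‖∏ i ∈ s, f i - 1‖ ≤ δ := by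
  classical
  induction s using Finset.induction_on with
  | empty => simpa
  | insert i s hi ih =>
    rw [Finset.prod_insert hi]
    have h1 : f i * ∏ j ∈ s, f j - 1 = f i * (∏ j ∈ s, f j - 1) + (f i - 1) := by ring
    rw [h1]
    refine (IsUltrametricDist.norm_add_le_max _ _).trans (max_le ?_ (h i (by simp)))
    rw [norm_mul]
    have h2 := ih (fun j hj ↦ hf j (by simp [hj])) (fun j hj ↦ h j (by simp [hj]))
    exact (mul_le_of_le_one_left (norm_nonneg _) (hf i (by simp))).trans h2

end Ultrametric

section Discrete

variable {F C : Type*} [Field F] [NormedField C] [Algebra F C]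

/-- An `F`-subspace having finite intersection with each ball. -/
class IsDiscreteSubspace (Λ : Submodule F C) : Prop where
  finite_ball : ∀ R : ℝ, {x : C | x ∈ Λ ∧ ‖x‖ ≤ R}.Finite

/-- The exponential function of a discrete subspace. -/
noncomputable def latExp (Λ : Submodule F C) (z : C) : C :=
  z * ∏' x : {x : C // x ∈ Λ ∧ x ≠ 0}, (1 - z / x)

theorem latExp_of_finite (V : Submodule F C) [Finite V] (z : C) :
    latExp V z = z * ∏ x ∈ nzElems V, (1 - z / x) := by
  rw [latExp, ← Finset.tprod_subtype]
  congr 1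
  exact (Equiv.subtypeEquivRight fun x ↦ mem_nzElems.symm).tprod_eq
    (fun x : {x // x ∈ nzElems V} ↦ 1 - z / (x : C))

/-- Both sides have the same zeros; one is normalized by its linear and the other by its leading
coefficient, and `nzProd` is the conversion factor. -/
theorem nzProd_mul_latExp (V : Submodule F C) [Finite V] (z : C) :
    nzProd V * latExp V z = (vanPoly V).eval z := by
  rw [latExp_of_finite, eval_vanPoly, prod_elems, sub_zero, nzProd, mul_left_comm,
    ← Finset.prod_mul_distrib]
  congr 1
  refine Finset.prod_congr rfl fun x hx ↦ ?_
  have := (mem_nzElems.1 hx).2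
  field_simp
  ring

theorem latExp_eq_div (V : Submodule F C) [Finite V] (z : C) :
    latExp V z = (vanPoly V).eval z / nzProd V := by
  rw [← nzProd_mul_latExp, mul_div_cancel_left₀ _ (nzProd_ne_zero V)]

variable [IsUltrametricDist C] [Finite F]

theorem norm_algebraMap_eq_one {c : F} (hc : c ≠ 0) : ‖algebraMap F C c‖ = 1 := by
  have := Fintype.ofFinite F
  have h : (algebraMap F C c) ^ (Fintype.card F - 1) = 1 := by
    rw [← map_pow, FiniteField.pow_card_sub_one_eq_one c hc, map_one]
  have hpos : 0 < Fintype.card F - 1 := by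
    have := Fintype.one_lt_card (α := F); omega
  have h2 := congrArg norm h
  rw [norm_pow, norm_one] at h2
  exact (pow_eq_one_iff_of_nonneg (norm_nonneg _) hpos.ne').1 h2

theorem norm_smul_le_self (c : F) (x : C) : ‖c • x‖ ≤ ‖x‖ := by
  rw [Algebra.smul_def, norm_mul]
  rcases eq_or_ne c 0 with rfl | hc
  · simp
  · rw [norm_algebraMap_eq_one hc, one_mul]

/-- The subspace of elements of norm at most `R` (at most `0` for `R < 0`). -/
def ballSub (Λ : Submodule F C) (R : ℝ) : Submodule F C where
  carrier := {x | x ∈ Λ ∧ ‖x‖ ≤ max R 0}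
  add_mem' hx hy := ⟨Λ.add_mem hx.1 hy.1,
    (IsUltrametricDist.norm_add_le_max _ _).trans (max_le hx.2 hy.2)⟩
  zero_mem' := ⟨Λ.zero_mem, by simp⟩
  smul_mem' c x hx := ⟨Λ.smul_mem c hx.1, (norm_smul_le_self c x).trans hx.2⟩

theorem mem_ballSub {Λ : Submodule F C} {R : ℝ} (hR : 0 ≤ R) {x : C} :
    x ∈ ballSub Λ R ↔ x ∈ Λ ∧ ‖x‖ ≤ R := by
  change x ∈ Λ ∧ ‖x‖ ≤ max R 0 ↔ _
  rw [max_eq_left hR]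

variable (Λ : Submodule F C) [IsDiscreteSubspace Λ]

instance (R : ℝ) : Finite (ballSub Λ R) :=
  (IsDiscreteSubspace.finite_ball (Λ := Λ) (max R 0)).to_subtype

/-- Factors with ‖x‖ > ‖z‖ have norm 1, so enlarging the ball beyond ‖z‖ changes nothing. -/
theorem norm_latExp_ballSub {R : ℝ} {z : C} (h : ‖z‖ ≤ R) :
    ‖latExp (ballSub Λ R) z‖ = ‖latExp (ballSub Λ ‖z‖) z‖ := by
  have hR : 0 ≤ R := (norm_nonneg z).trans h
  rw [latExp_of_finite, latExp_of_finite, norm_mul, norm_mul, norm_prod, norm_prod]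
  congr 1
  symm
  refine Finset.prod_subset (fun x hx ↦ ?_) fun x hx hx' ↦ ?_
  · rw [mem_nzElems, mem_ballSub (norm_nonneg z)] at hx
    rw [mem_nzElems, mem_ballSub hR]
    exact ⟨⟨hx.1.1, hx.1.2.trans h⟩, hx.2⟩
  · rw [mem_nzElems, mem_ballSub hR] at hx
    rw [mem_nzElems, mem_ballSub (norm_nonneg z)] at hx'
    refine norm_one_sub_div ?_
    by_contra! h2
    exact hx' ⟨⟨hx.1.1, h2⟩, hx.2⟩

variable [CompleteSpace C]

/-- Only the finitely many factors with ‖x‖ ≤ ‖z‖ can have norm > 1, so partial products are bounded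
by `B`. Beyond radius R > ‖z‖ each factor, hence each finite product of them, is within ‖z‖/R of 1.
-/
theorem multipliable_one_sub_div (z : C) :
    Multipliable fun x : {x : C // x ∈ Λ ∧ x ≠ 0} ↦ 1 - z / (x : C) := by
  classical
  set f := fun x : {x : C // x ∈ Λ ∧ x ≠ 0} ↦ 1 - z / (x : C) with hf
  have hfin : ∀ R : ℝ, {x : {x : C // x ∈ Λ ∧ x ≠ 0} | ‖(x : C)‖ ≤ R}.Finite := fun R ↦
    Set.Finite.of_finite_image ((IsDiscreteSubspace.finite_ball (Λ := Λ) R).subset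
      (by rintro _ ⟨x, hx, rfl⟩; exact ⟨x.2.1, hx⟩)) Subtype.val_injective.injOn
  have hf1 : ∀ x : {x : C // x ∈ Λ ∧ x ≠ 0}, ‖z‖ < ‖(x : C)‖ → ‖f x‖ = 1 :=
    fun x hx ↦ norm_one_sub_div hx
  set B : ℝ := ∏ x ∈ (hfin ‖z‖).toFinset, max 1 ‖f x‖ with hB
  have hB1 : ∀ s : Finset {x : C // x ∈ Λ ∧ x ≠ 0}, ‖∏ x ∈ s, f x‖ ≤ B := by
    intro s
    rw [norm_prod]
    calc ∏ x ∈ s, ‖f x‖ ≤ ∏ x ∈ s, max 1 ‖f x‖ :=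
          Finset.prod_le_prod (fun _ _ ↦ norm_nonneg _) fun _ _ ↦ le_max_right _ _
      _ = ∏ x ∈ s ∩ (hfin ‖z‖).toFinset, max 1 ‖f x‖ := by
          symm
          refine Finset.prod_subset Finset.inter_subset_left fun x hx hx' ↦ ?_
          rw [Finset.mem_inter, not_and, Set.Finite.mem_toFinset] at hx'
          rw [hf1 x (not_le.1 (hx' hx)), max_self]
      _ ≤ B := Finset.prod_le_prod_of_subset_of_one_le Finset.inter_subset_right
          (fun _ _ ↦ zero_le_one.trans (le_max_left _ _)) (fun _ _ _ ↦ le_max_left _ _)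
  have hBpos : 0 < B := Finset.prod_pos fun _ _ ↦ lt_max_of_lt_left one_pos
  have hcau : CauchySeq fun s : Finset {x : C // x ∈ Λ ∧ x ≠ 0} ↦ ∏ x ∈ s, f x := by
    rw [Metric.cauchySeq_iff']
    intro ε hε
    -- The first term makes the outer factors have norm 1, the second makes ‖z‖ B / R at most ε / 2.
    set R := max (‖z‖ + 1) (2 * B * ‖z‖ / ε)
    have hR : ‖z‖ < R := lt_of_lt_of_le (by linarith) (le_max_left _ _)
    have hR0 : 0 < R := (norm_nonneg z).trans_lt hR
    refine ⟨(hfin R).toFinset, fun s hs ↦ ?_⟩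
    have hs' : (hfin R).toFinset ⊆ s := hs
    rw [← Finset.prod_sdiff hs', dist_eq_norm, ← sub_one_mul, norm_mul]
    have h1 : ‖∏ x ∈ s \ (hfin R).toFinset, f x - 1‖ ≤ ‖z‖ / R := by
      have h2 : ∀ x ∈ s \ (hfin R).toFinset, R < ‖(x : C)‖ := fun x hx ↦ by
        rw [Finset.mem_sdiff, Set.Finite.mem_toFinset] at hx
        exact not_le.1 hx.2
      refine norm_prod_sub_one_le _ _ (by positivity) (fun x hx ↦ ?_) fun x hx ↦ ?_
      · exact (hf1 x (hR.trans (h2 x hx))).le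
      · simp only [hf]
        rw [sub_sub_cancel_left, norm_neg, norm_div]
        exact div_le_div_of_nonneg_left (norm_nonneg _) hR0 (h2 x hx).le
    calc _ ≤ ‖z‖ / R * B := mul_le_mul h1 (hB1 _) (norm_nonneg _) (by positivity)
      _ ≤ ε / 2 := by
        rw [div_mul_eq_mul_div, div_le_iff₀ hR0]
        have h3 : 2 * B * ‖z‖ / ε ≤ R := le_max_right _ _
        rw [div_le_iff₀ hε] at h3
        linarith
      _ < ε := by linarith
  obtain ⟨a, ha⟩ := cauchySeq_tendsto_of_complete hcau
  exact ⟨a, ha⟩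

/-- Balls are cofinal among the finite subsets. This is how algebraic identities for finite
subspaces pass to lattices. -/
theorem tendsto_latExp_ballSub (z : C) :
    Tendsto (fun R : ℝ ↦ latExp (ballSub Λ R) z) atTop (𝓝 (latExp Λ z)) := by
  classical
  have hfin : ∀ R : ℝ, {x : {x : C // x ∈ Λ ∧ x ≠ 0} | ‖(x : C)‖ ≤ max R 0}.Finite := fun R ↦
    Set.Finite.of_finite_image ((IsDiscreteSubspace.finite_ball (Λ := Λ) (max R 0)).subset
      (by rintro _ ⟨x, hx, rfl⟩; exact ⟨x.2.1, hx⟩)) Subtype.val_injective.injOn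
  have h1 : Tendsto (fun R : ℝ ↦ (hfin R).toFinset) atTop atTop := by
    refine tendsto_atTop_finset_of_monotone (fun R R' h ↦ ?_) fun x ↦ ⟨‖(x : C)‖, by simp⟩
    intro x hx
    rw [Set.Finite.mem_toFinset] at hx ⊢
    exact hx.trans (max_le_max h le_rfl)
  have h2 : Tendsto (fun s : Finset {x : C // x ∈ Λ ∧ x ≠ 0} ↦ ∏ x ∈ s, (1 - z / (x : C))) atTop
      (𝓝 (∏' x : {x : C // x ∈ Λ ∧ x ≠ 0}, (1 - z / x))) := (multipliable_one_sub_div Λ z).hasProd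
  refine ((h2.comp h1).const_mul z).congr fun R ↦ ?_
  rw [latExp_of_finite]
  congr 1
  refine Finset.prod_bij (fun x _ ↦ (x : C)) ?_ ?_ ?_ fun _ _ ↦ rfl
  · intro x hx
    rw [Set.Finite.mem_toFinset] at hx
    exact mem_nzElems.2 ⟨⟨x.2.1, hx⟩, x.2.2⟩
  · exact fun _ _ _ _ h ↦ Subtype.ext h
  · intro x hx
    obtain ⟨⟨h3, h4⟩, h5⟩ := mem_nzElems.1 hx
    exact ⟨⟨x, h3, h5⟩, by rw [Set.Finite.mem_toFinset]; exact h4, rfl⟩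

theorem norm_latExp (z : C) : ‖latExp Λ z‖ = ‖latExp (ballSub Λ ‖z‖) z‖ := by
  refine tendsto_nhds_unique (tendsto_latExp_ballSub Λ z).norm ?_
  refine tendsto_const_nhds.congr' ?_
  filter_upwards [eventually_ge_atTop ‖z‖] with R hR
  exact (norm_latExp_ballSub Λ hR).symm

theorem latExp_eq_zero_iff {z : C} : latExp Λ z = 0 ↔ z ∈ Λ := by
  rw [← norm_eq_zero, norm_latExp, norm_eq_zero, latExp_eq_div, div_eq_zero_iff,
    or_iff_left (nzProd_ne_zero _), eval_vanPoly_eq_zero, mem_ballSub (norm_nonneg z),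
    and_iff_left le_rfl]

/-- Near 0 there are no nonzero lattice points of norm ≤ ‖z‖, so the product is empty. It follows
later that the exponential takes infinitely many values. -/
theorem exists_norm_latExp_eq : ∃ ε > 0, ∀ z : C, ‖z‖ < ε → ‖latExp Λ z‖ = ‖z‖ := by
  obtain ⟨ε, hε, h⟩ : ∃ ε > 0, ∀ x ∈ nzElems (ballSub Λ 1), ε ≤ ‖x‖ := by
    rcases (nzElems (ballSub Λ 1)).eq_empty_or_nonempty with h | h
    · exact ⟨1, one_pos, by simp [h]⟩
    · obtain ⟨y, hy, hmin⟩ := Finset.exists_min_image _ (fun x ↦ ‖x‖) h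
      exact ⟨‖y‖, norm_pos_iff.2 (mem_nzElems.1 hy).2, hmin⟩
  refine ⟨min ε 1, lt_min hε one_pos, fun z hz ↦ ?_⟩
  rw [norm_latExp, latExp_of_finite]
  have : nzElems (ballSub Λ ‖z‖) = ∅ := by
    rw [Finset.eq_empty_iff_forall_notMem]
    intro x hx
    rw [mem_nzElems, mem_ballSub (norm_nonneg z)] at hx
    have h1 := h x (mem_nzElems.2 ⟨(mem_ballSub zero_le_one).2
      ⟨hx.1.1, hx.1.2.trans (hz.le.trans (min_le_right _ _))⟩, hx.2⟩)
    have h2 := hz.trans_le (min_le_left _ _)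
    linarith [hx.1.2]
  rw [this, Finset.prod_empty, mul_one]

theorem latExp_add (x y : C) : latExp Λ (x + y) = latExp Λ x + latExp Λ y := by
  refine tendsto_nhds_unique (tendsto_latExp_ballSub Λ (x + y))
    (((tendsto_latExp_ballSub Λ x).add (tendsto_latExp_ballSub Λ y)).congr fun R ↦ ?_)
  rw [latExp_eq_div, latExp_eq_div, latExp_eq_div, ← add_div]
  congr 1
  simpa using (aeval_add_of_mem_qLinear (vanPoly_mem_qLinear (ballSub Λ R)) x y).symm

theorem latExp_smul (c : F) (x : C) : latExp Λ (c • x) = c • latExp Λ x := by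
  refine tendsto_nhds_unique (tendsto_latExp_ballSub Λ (c • x)) ?_
  simp only [Algebra.smul_def c (latExp Λ x)]
  refine ((tendsto_latExp_ballSub Λ x).const_mul _).congr fun R ↦ ?_
  rw [latExp_eq_div, latExp_eq_div,
    eval_smul_of_mem_qLinear (vanPoly_mem_qLinear (ballSub Λ R)), Algebra.smul_def, mul_div_assoc]

/-- The exponential function as an `F`-linear map. -/
noncomputable def latExpLin : C →ₗ[F] C where
  toFun := latExp Λ
  map_add' := latExp_add Λ
  map_smul' := latExp_smul Λ

/-- A polynomial is determined by its composition with the exponential function. -/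
theorem eq_of_eval_latExp_eq {y : C} (hy : y ≠ 0) (hy1 : ‖y‖ < 1) {φ ψ : C[X]}
    (h : ∀ z, φ.eval (latExp Λ z) = ψ.eval (latExp Λ z)) : φ = ψ := by
  obtain ⟨ε, hε, hnorm⟩ := exists_norm_latExp_eq Λ
  obtain ⟨k, hk⟩ := exists_pow_lt_of_lt_one hε hy1
  have hn : ∀ n : ℕ, ‖latExp Λ (y ^ (k + n))‖ = ‖y‖ ^ (k + n) := fun n ↦ by
    rw [hnorm, norm_pow]
    rw [norm_pow]
    exact (pow_le_pow_of_le_one (norm_nonneg _) hy1.le (Nat.le_add_right _ _)).trans_lt hk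
  -- The values at high powers of `y` have pairwise different norms.
  refine Polynomial.eq_of_infinite_eval_eq _ _ (Set.infinite_of_injective_forall_mem
    (f := fun n : ℕ ↦ latExp Λ (y ^ (k + n))) (fun n m hnm ↦ ?_) fun n ↦ h _)
  have h1 := congrArg norm hnm
  simp only [hn] at h1
  have := pow_right_injective₀ (norm_pos_iff.2 hy) hy1.ne h1
  omega

end Discrete

section Isogeny

variable {F C : Type*} [Field F] [Finite F] [NormedField C] [IsUltrametricDist C] [CompleteSpace C]
  [Algebra F C] {Λ T Λ' : Submodule F C} [IsDiscreteSubspace Λ] [Finite T] [IsDiscreteSubspace Λ']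

theorem exists_norm_le (T : Submodule F C) [Finite T] : ∃ R : ℝ, 0 ≤ R ∧ ∀ t ∈ T, ‖t‖ ≤ R := by
  obtain ⟨R, hR⟩ := Finset.exists_le ((elems T).image norm)
  exact ⟨max R 0, le_max_right _ _, fun t ht ↦
    (hR _ (Finset.mem_image_of_mem _ (mem_elems.2 ht))).trans (le_max_left _ _)⟩

/-- Once `R` exceeds all norms in `T`, adding an element of `T` does not move a vector into or out
of the ball. -/
theorem eventually_ballSub_sup (hT : Λ ⊔ T = Λ') :
    ∀ᶠ R : ℝ in atTop, ballSub Λ R ⊔ T = ballSub Λ' R := by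
  obtain ⟨R₀, hR₀, h⟩ := exists_norm_le T
  filter_upwards [eventually_ge_atTop R₀] with R hR
  have hR0 := hR₀.trans hR
  apply le_antisymm
  · refine sup_le (fun x hx ↦ ?_) fun x hx ↦ ?_
    · rw [mem_ballSub hR0] at hx ⊢
      exact ⟨hT ▸ Submodule.mem_sup_left hx.1, hx.2⟩
    · rw [mem_ballSub hR0]
      exact ⟨hT ▸ Submodule.mem_sup_right hx, (h x hx).trans hR⟩
  · intro x hx
    rw [mem_ballSub hR0, ← hT, Submodule.mem_sup] at hx
    obtain ⟨⟨y, hy, t, ht, rfl⟩, hx⟩ := hx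
    refine Submodule.add_mem_sup ((mem_ballSub hR0).2 ⟨hy, ?_⟩) ht
    have := IsUltrametricDist.norm_add_le_max (y + t) (-t)
    rw [add_neg_cancel_right, norm_neg] at this
    exact this.trans (max_le hx ((h t ht).trans hR))

theorem disjoint_ballSub (hd : Disjoint Λ T) (R : ℝ) : Disjoint (ballSub Λ R) T :=
  hd.mono_left fun _ hx ↦ hx.1

theorem eventually_card_ballSub (hd : Disjoint Λ T) (hT : Λ ⊔ T = Λ') :
    ∀ᶠ R : ℝ in atTop, Nat.card (ballSub Λ' R) = Nat.card T * Nat.card (ballSub Λ R) := by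
  filter_upwards [eventually_ballSub_sup hT] with R hR
  -- The product of the constant 2 turns the bijection into an equality of powers of 2, hence of
  -- cardinalities.
  have h := prod_elems_sup (disjoint_ballSub hd R) hR fun _ ↦ 2
  simp only [Finset.prod_const, card_elems, ← pow_mul] at h
  rw [mul_comm]
  exact Nat.pow_right_injective le_rfl h

variable (Λ T) in
/-- The isogeny polynomial of `Λ ⊂ Λ ⊕ T`. -/
noncomputable def isogPoly : C[X] :=
  Polynomial.C (∏ t ∈ nzElems T, (-latExp Λ t)⁻¹) * ∏ t ∈ elems T, (X - Polynomial.C (latExp Λ t))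

theorem latExp_ne_zero (hd : Disjoint Λ T) {t : C} (ht : t ∈ nzElems T) : latExp Λ t ≠ 0 := by
  rw [Ne, latExp_eq_zero_iff]
  intro h
  rw [mem_nzElems] at ht
  exact ht.2 (Submodule.disjoint_def.1 hd t h ht.1)

theorem isogConst_ne_zero (hd : Disjoint Λ T) : ∏ t ∈ nzElems T, (-latExp Λ t)⁻¹ ≠ 0 :=
  Finset.prod_ne_zero_iff.2 fun _ ht ↦ inv_ne_zero (neg_ne_zero.2 (latExp_ne_zero hd ht))

theorem leadingCoeff_isogPoly :
    (isogPoly Λ T).leadingCoeff = ∏ t ∈ nzElems T, (-latExp Λ t)⁻¹ := by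
  rw [isogPoly, leadingCoeff_mul, leadingCoeff_C,
    (monic_prod_of_monic _ _ fun _ _ ↦ monic_X_sub_C _).leadingCoeff, mul_one]

theorem natDegree_isogPoly (hd : Disjoint Λ T) : (isogPoly Λ T).natDegree = Nat.card T := by
  rw [isogPoly, natDegree_C_mul (isogConst_ne_zero hd),
    natDegree_prod_of_monic _ _ fun _ _ ↦ monic_X_sub_C _]
  simp [card_elems]

theorem latExp_zero : latExp Λ 0 = 0 := by simp [latExp]

theorem coeff_one_isogPoly (hd : Disjoint Λ T) : (isogPoly Λ T).coeff 1 = 1 := by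
  rw [isogPoly, prod_elems, latExp_zero, C_0, sub_zero, coeff_C_mul, coeff_X_mul,
    coeff_zero_prod_X_sub_C, ← Finset.prod_mul_distrib]
  exact Finset.prod_eq_one fun t ht ↦ inv_mul_cancel₀ (neg_ne_zero.2 (latExp_ne_zero hd ht))

/-- The exponential maps `T` isomorphically onto a finite F-subspace, and the product is the
polynomial of that subspace. -/
theorem isogPoly_mem_qLinear (hd : Disjoint Λ T) : isogPoly Λ T ∈ qLinear F C := by
  rw [isogPoly, ← smul_eq_C_mul]
  refine Submodule.smul_mem _ _ ?_
  have hfin : Finite (T.map (latExpLin Λ)) := Set.Finite.to_subtype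
    ((Set.toFinite (T : Set C)).image (latExpLin Λ))
  have h : ∏ t ∈ elems T, (X - Polynomial.C (latExp Λ t)) = vanPoly (T.map (latExpLin Λ)) := by
    rw [vanPoly]
    refine Finset.prod_bij (fun t _ ↦ latExp Λ t) ?_ ?_ ?_ fun _ _ ↦ rfl
    · intro t ht
      exact mem_elems.2 ⟨t, mem_elems.1 ht, rfl⟩
    · intro t ht t' ht' h
      have h1 : latExpLin Λ (t - t') = 0 := by rw [map_sub, sub_eq_zero]; exact h
      have h2 : t - t' ∈ Λ := (latExp_eq_zero_iff Λ).1 h1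
      exact sub_eq_zero.1 (Submodule.disjoint_def.1 hd _ h2
        (T.sub_mem (mem_elems.1 ht) (mem_elems.1 ht')))
    · intro x hx
      obtain ⟨t, ht, rfl⟩ := mem_elems.1 hx
      exact ⟨t, mem_elems.2 ht, rfl⟩
  rw [h]
  exact vanPoly_mem_qLinear _

theorem tendsto_isogConst (hd : Disjoint Λ T) :
    Tendsto (fun R : ℝ ↦ ∏ t ∈ nzElems T, (-latExp (ballSub Λ R) t)⁻¹) atTop
      (𝓝 (∏ t ∈ nzElems T, (-latExp Λ t)⁻¹)) :=
  tendsto_finsetProd _ fun t ht ↦ (tendsto_latExp_ballSub Λ t).neg.inv₀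
    (neg_ne_zero.2 (latExp_ne_zero hd ht))

theorem nzProd_ballSub_sup (hd : Disjoint Λ T) {R : ℝ} (hR : ballSub Λ R ⊔ T = ballSub Λ' R) :
    nzProd (ballSub Λ' R) = nzProd (ballSub Λ R) ^ Nat.card T *
      ∏ t ∈ nzElems T, (-latExp (ballSub Λ R) t) := by
  rw [nzProd_sup (disjoint_ballSub hd R) hR, ← card_nzElems_add_one, pow_succ', mul_assoc,
    ← Finset.prod_const, ← Finset.prod_mul_distrib]
  congr 1
  refine Finset.prod_congr rfl fun t _ ↦ ?_
  rw [← nzProd_mul_latExp]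
  ring

/-- For large `R` the quotient is exactly the leading coefficient of the isogeny of finite
subspaces; the exponentials in it converge. All the absolute values of discriminants come from this
limit. -/
theorem tendsto_nzProd_div (hd : Disjoint Λ T) (hT : Λ ⊔ T = Λ') :
    Tendsto (fun R : ℝ ↦ nzProd (ballSub Λ R) ^ Nat.card T / nzProd (ballSub Λ' R)) atTop
      (𝓝 (isogPoly Λ T).leadingCoeff) := by
  rw [leadingCoeff_isogPoly]
  refine (tendsto_isogConst hd).congr' ?_
  filter_upwards [eventually_ballSub_sup hT] with R hR
  have h := nzProd_ballSub_sup hd hR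
  have h0 := nzProd_ne_zero (ballSub Λ' R)
  have h1 := nzProd_ne_zero (ballSub Λ R)
  rw [h] at h0 ⊢
  rw [Finset.prod_inv_distrib]
  have h2 := right_ne_zero_of_mul h0
  field_simp

/-- At finite level this is the factorization of `vanPoly` over cosets of Λ_R in Λ'_R, divided by
the linear coefficients. -/
theorem latExp_eq_eval_isogPoly (hd : Disjoint Λ T) (hT : Λ ⊔ T = Λ') (z : C) :
    latExp Λ' z = (isogPoly Λ T).eval (latExp Λ z) := by
  refine tendsto_nhds_unique (tendsto_latExp_ballSub Λ' z) ?_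
  have h1 : Tendsto (fun R : ℝ ↦ (∏ t ∈ nzElems T, (-latExp (ballSub Λ R) t)⁻¹) *
      ∏ t ∈ elems T, (latExp (ballSub Λ R) z - latExp (ballSub Λ R) t)) atTop
      (𝓝 ((∏ t ∈ nzElems T, (-latExp Λ t)⁻¹) * ∏ t ∈ elems T, (latExp Λ z - latExp Λ t))) :=
    (tendsto_isogConst hd).mul (tendsto_finsetProd _ fun t _ ↦
      (tendsto_latExp_ballSub Λ z).sub (tendsto_latExp_ballSub Λ t))
  have h2 : (isogPoly Λ T).eval (latExp Λ z) =
      (∏ t ∈ nzElems T, (-latExp Λ t)⁻¹) * ∏ t ∈ elems T, (latExp Λ z - latExp Λ t) := by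
    simp [isogPoly, eval_prod]
  rw [h2]
  refine h1.congr' ?_
  filter_upwards [eventually_ballSub_sup hT] with R hR
  have h := nzProd_ballSub_sup hd hR
  have h0 := nzProd_ne_zero (ballSub Λ' R)
  have hc := nzProd_ne_zero (ballSub Λ R)
  rw [latExp_eq_div (ballSub Λ' R), vanPoly_sup (disjoint_ballSub hd R) hR, eval_prod]
  simp only [eval_sub, eval_C, ← nzProd_mul_latExp, ← mul_sub]
  rw [Finset.prod_mul_distrib, Finset.prod_const, card_elems, h, Finset.prod_inv_distrib]
  rw [h] at h0
  have h3 := right_ne_zero_of_mul h0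
  field_simp

end Isogeny

end DrinfeldLattice

/-! ### The value group of `CInf` -/

namespace DrinfeldLattice

section CInf

variable {F K : Type*} [Field F] [Field K] [Algebra F K] [IsGlobalFunctionField F K]
  {O : ValuationSubring K} [IsDiscreteValuationRing O]

instance : IsUltrametricDist (KInfAlg F O) :=
  IsUltrametricDist.isUltrametricDist_of_forall_norm_add_le_max_norm fun x y ↦
    isNonarchimedean_spectralNorm (K := KInf F O) (L := KInfAlg F O) x y

instance : IsUltrametricDist (CInf F O) := by
  refine IsUltrametricDist.isUltrametricDist_of_forall_norm_add_le_max_norm fun x y ↦ ?_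
  refine UniformSpace.Completion.induction_on₂ (α := KInfAlg F O) (β := KInfAlg F O)
    (p := fun x y ↦ ‖x + y‖ ≤ max ‖x‖ ‖y‖) x y
    (isClosed_le (by fun_prop) (by fun_prop)) fun a b ↦ ?_
  rw [← UniformSpace.Completion.coe_add]
  simp only [UniformSpace.Completion.norm_coe]
  exact IsUltrametricDist.norm_add_le_max a b

/-- An approximation at distance less than ‖x‖ has the same norm as `x`. -/
theorem exists_coe_norm_eq {E : Type*} [NormedField E] [IsUltrametricDist E]
    (hE : IsUltrametricDist (UniformSpace.Completion E)) (x : UniformSpace.Completion E)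
    (hx : x ≠ 0) : ∃ y : E, ‖y‖ = ‖x‖ := by
  obtain ⟨y, hy⟩ := UniformSpace.Completion.denseRange_coe.exists_dist_lt x (norm_pos_iff.2 hx)
  refine ⟨y, ?_⟩
  rw [← UniformSpace.Completion.norm_coe y]
  by_contra hne
  have h1 := IsUltrametricDist.norm_add_eq_max_of_norm_ne_norm (x := x)
    (y := -(y : UniformSpace.Completion E)) (by rw [norm_neg]; exact Ne.symm hne)
  rw [← sub_eq_add_neg, ← dist_eq_norm] at h1
  have := le_max_left ‖x‖ ‖-(y : UniformSpace.Completion E)‖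
  linarith

theorem exists_norm_KInf_eq (x : KInf F O) (hx : x ≠ 0) : ∃ m : ℤ, ‖x‖ = (qInf O : ℝ) ^ m := by
  have hu : IsUltrametricDist (WithAbs (absInf F O)) :=
    IsUltrametricDist.isUltrametricDist_of_forall_norm_add_le_max_norm fun x y ↦
      absInf_add_le_max (F := F) O x.ofAbs y.ofAbs
  obtain ⟨y, hy⟩ := exists_coe_norm_eq (inferInstanceAs (IsUltrametricDist (KInf F O))) x hx
  have hy0 : y.ofAbs ≠ 0 := by
    intro h
    have h2 : ‖y‖ = absInf F O y.ofAbs := rfl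
    rw [h2, h, map_zero] at hy
    exact hx (norm_eq_zero.1 hy.symm)
  obtain ⟨m, hm⟩ := exists_absInf_eq (F := F) (O := O) hy0
  exact ⟨m, hy.symm.trans hm⟩

theorem norm_algebraMap_KInfAlg (x : KInf F O) : ‖algebraMap (KInf F O) (KInfAlg F O) x‖ = ‖x‖ :=
  spectralNorm_extends _

/-- In an ultrametric field, a vanishing sum has two terms of the same norm. -/
theorem exists_norm_eq_of_sum_eq_zero {E : Type*} [NormedField E] [IsUltrametricDist E] {ι : Type*}
    {s : Finset ι} (hs : s.Nonempty) {f : ι → E} (hf : ∀ i ∈ s, f i ≠ 0) (h : ∑ i ∈ s, f i = 0) :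
    ∃ i ∈ s, ∃ j ∈ s, i ≠ j ∧ ‖f i‖ = ‖f j‖ := by
  by_contra! hcon
  have h1 := IsUltrametricDist.norm_sum_eq_sup'_of_pairwise_ne hs (f := f)
    fun i hi j hj hij ↦ hcon i hi j hj hij
  rw [h, norm_zero] at h1
  obtain ⟨i, hi⟩ := hs
  have h2 := Finset.le_sup' (fun i ↦ ‖f i‖) hi
  rw [← h1] at h2
  exact hf i hi (norm_le_zero_iff.1 h2)

/-- In a polynomial relation for `x` two terms have equal norm; their quotient expresses a power of
‖x‖ through norms from `KInf`. -/
theorem exists_norm_KInfAlg_pow_eq (x : KInfAlg F O) (hx : x ≠ 0) :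
    ∃ n : ℕ, 0 < n ∧ ∃ m : ℤ, ‖x‖ ^ n = (qInf O : ℝ) ^ m := by
  obtain ⟨p, hp0, hp⟩ := Algebra.IsAlgebraic.isAlgebraic (R := KInf F O) x
  have hq : (0 : ℝ) < qInf O := zero_lt_one.trans (one_lt_qInf' F O)
  rw [aeval_eq_sum_range] at hp
  have hp' : ∑ i ∈ p.support, p.coeff i • x ^ i = 0 := by
    rw [← hp]
    refine Finset.sum_subset (fun i hi ↦ ?_) fun i _ hi ↦ ?_
    · exact Finset.mem_range_succ_iff.2 (le_natDegree_of_mem_supp i hi)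
    · rw [notMem_support_iff.1 hi, zero_smul]
  have hn : ∀ i, ‖p.coeff i • x ^ i‖ = ‖p.coeff i‖ * ‖x‖ ^ i := fun i ↦ by
    rw [Algebra.smul_def, norm_mul, norm_algebraMap_KInfAlg, norm_pow]
  obtain ⟨i, hi, j, hj, hij, h⟩ := exists_norm_eq_of_sum_eq_zero (support_nonempty.2 hp0)
    (fun i hi ↦ by
      rw [Algebra.smul_def]
      refine mul_ne_zero ?_ (pow_ne_zero _ hx)
      rw [Ne, FaithfulSMul.algebraMap_eq_zero_iff]
      exact mem_support_iff.1 hi) hp'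
  rw [hn, hn] at h
  have hx' : 0 < ‖x‖ := norm_pos_iff.2 hx
  wlog hlt : i < j generalizing i j
  · exact this j hj i hi hij.symm h.symm (lt_of_le_of_ne (not_lt.1 hlt) hij.symm)
  obtain ⟨a, ha⟩ := exists_norm_KInf_eq (p.coeff i) (mem_support_iff.1 hi)
  obtain ⟨b, hb⟩ := exists_norm_KInf_eq (p.coeff j) (mem_support_iff.1 hj)
  refine ⟨j - i, Nat.sub_pos_of_lt hlt, a - b, ?_⟩
  rw [ha, hb] at h
  rw [pow_sub₀ _ hx'.ne' hlt.le, zpow_sub₀ hq.ne']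
  field_simp
  linarith

theorem exists_norm_pow_eq (x : CInf F O) (hx : x ≠ 0) :
    ∃ n : ℕ, 0 < n ∧ ∃ m : ℤ, ‖x‖ ^ n = (qInf O : ℝ) ^ m := by
  obtain ⟨y, hy⟩ := exists_coe_norm_eq (inferInstanceAs (IsUltrametricDist (CInf F O))) x hx
  have hy0 : y ≠ 0 := by
    rintro rfl
    rw [norm_zero] at hy
    exact hx (norm_eq_zero.1 hy.symm)
  obtain ⟨n, hn, m, hm⟩ := exists_norm_KInfAlg_pow_eq y hy0
  refine ⟨n, hn, m, ?_⟩
  rw [← hm, hy]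
  rfl

noncomputable instance : Algebra F (CInf F O) :=
  ((algebraMap K (CInf F O)).comp (algebraMap F K)).toAlgebra

theorem coeffRing_smul_def (a : coeffRing F O) (x : CInf F O) :
    a • x = algebraMap K (CInf F O) a * x := by
  rw [← Algebra.smul_def]
  rfl

instance : IsScalarTower F (coeffRing F O) (CInf F O) := by
  refine ⟨fun c a x ↦ ?_⟩
  rw [coeffRing_smul_def, coeffRing_smul_def, Algebra.smul_def c a,
    Algebra.smul_def c (algebraMap K (CInf F O) a * x), MulMemClass.coe_mul, map_mul, mul_assoc]
  rfl

end CInf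

end DrinfeldLattice

/-! ### Indices of submodules and finite complements -/

namespace DrinfeldLattice

section Index

variable {A V : Type*} [CommRing A] [IsDomain A] [AddCommGroup V] [Module A V]

theorem finite_of_fg_of_torsion (hA : ∀ b : A, b ≠ 0 → Finite (A ⧸ Ideal.span {b}))
    [Module.Finite A V] (hV : ∀ x : V, ∃ c : A, c ≠ 0 ∧ c • x = 0) : Finite V := by
  obtain ⟨n, s, hs⟩ := Module.Finite.exists_fin (R := A) (M := V)
  choose c hc0 hc using fun i ↦ hV (s i)
  have := fun i ↦ hA (c i) (hc0 i)
  let f : (∀ i, A ⧸ Ideal.span {c i}) → V := fun u ↦ ∑ i, (u i).out • s i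
  refine Finite.of_surjective f fun x ↦ ?_
  have hx : x ∈ Submodule.span A (Set.range s) := by rw [hs]; trivial
  obtain ⟨u, rfl⟩ := (Submodule.mem_span_range_iff_exists_fun A).1 hx
  refine ⟨fun i ↦ Ideal.Quotient.mk _ (u i), Finset.sum_congr rfl fun i _ ↦ ?_⟩
  have h : u i - (Ideal.Quotient.mk (Ideal.span {c i}) (u i)).out ∈ Ideal.span {c i} := by
    rw [← Ideal.Quotient.mk_eq_mk_iff_sub_mem]
    exact (Quotient.out_eq (Ideal.Quotient.mk (Ideal.span {c i}) (u i))).symm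
  obtain ⟨e, he⟩ := Ideal.mem_span_singleton.1 h
  have h2 : u i • s i - (Ideal.Quotient.mk (Ideal.span {c i}) (u i)).out • s i = 0 := by
    rw [← sub_smul, he, mul_comm, mul_smul, hc, smul_zero]
  exact (sub_eq_zero.1 h2).symm

theorem exists_smul_mem_span {r : ℕ} {Λ : Submodule A V} (hfg : Λ.FG)
    (hr : Module.finrank A Λ = r) {b : Fin r → V} (hb : LinearIndependent A b) (hbΛ : ∀ i, b i ∈ Λ)
    {x : V} (hx : x ∈ Λ) : ∃ c : A, c ≠ 0 ∧ c • x ∈ Submodule.span A (Set.range b) := by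
  have : Module.Finite A Λ := Module.Finite.iff_fg.2 hfg
  let v : Option (Fin r) → Λ := fun o ↦ o.elim ⟨x, hx⟩ fun i ↦ ⟨b i, hbΛ i⟩
  have hv : ¬ LinearIndependent A v := fun h ↦ by
    have := h.fintype_card_le_finrank
    rw [Fintype.card_option, Fintype.card_fin, hr] at this
    omega
  rw [Fintype.linearIndependent_iff] at hv
  push Not at hv
  obtain ⟨g, hg, o, ho⟩ := hv
  have hg' : g none • x + ∑ i, g (some i) • b i = 0 := by
    have := congrArg (Subtype.val) hg
    rw [Fintype.sum_option] at this
    simpa [v] using this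
  refine ⟨g none, fun h0 ↦ ?_, ?_⟩
  · rw [h0, zero_smul, zero_add] at hg'
    have := Fintype.linearIndependent_iff.1 hb _ hg'
    rcases o with _ | i
    · exact ho h0
    · exact ho (this i)
  · rw [eq_neg_of_add_eq_zero_left hg']
    exact Submodule.neg_mem _ (Submodule.sum_mem _ fun i _ ↦ Submodule.smul_mem _ _
      (Submodule.subset_span ⟨i, rfl⟩))

theorem relIndex_ne_zero (hA : ∀ b : A, b ≠ 0 → Finite (A ⧸ Ideal.span {b}))
    {Λ Λ' : Submodule A V} (hfg : Λ'.FG)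
    (h : ∀ x ∈ Λ', ∃ c : A, c ≠ 0 ∧ c • x ∈ Λ) :
    Λ.toAddSubgroup.relIndex Λ'.toAddSubgroup ≠ 0 := by
  have : Module.Finite A Λ' := Module.Finite.iff_fg.2 hfg
  have hfin : Finite (Λ' ⧸ Λ.comap Λ'.subtype) := by
    refine finite_of_fg_of_torsion hA fun x ↦ ?_
    obtain ⟨x, rfl⟩ := Submodule.Quotient.mk_surjective _ x
    obtain ⟨c, hc0, hc⟩ := h x x.2
    refine ⟨c, hc0, ?_⟩
    rw [← Submodule.Quotient.mk_smul, Submodule.Quotient.mk_eq_zero]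
    exact hc
  have : Nat.card (Λ' ⧸ Λ.comap Λ'.subtype) ≠ 0 := Nat.card_pos.ne'
  exact this

theorem exists_linearIndependent_of_finrank {r : ℕ} {Λ : Submodule A V}
    (hr : Module.finrank A Λ = r) :
    ∃ b : Fin r → V, LinearIndependent A b ∧ ∀ i, b i ∈ Λ := by
  obtain ⟨b, hb⟩ := exists_linearIndependent_of_le_finrank hr.ge
  exact ⟨fun i ↦ b i, hb.map' Λ.subtype Λ.ker_subtype, fun i ↦ (b i).2⟩

theorem relIndex_ne_zero_of_finrank_eq (hA : ∀ b : A, b ≠ 0 → Finite (A ⧸ Ideal.span {b}))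
    {Λ Λ' : Submodule A V} (hfg : Λ'.FG) (hle : Λ ≤ Λ')
    (hr : Module.finrank A Λ = Module.finrank A Λ') :
    Λ.toAddSubgroup.relIndex Λ'.toAddSubgroup ≠ 0 := by
  obtain ⟨b, hb, hbΛ⟩ := exists_linearIndependent_of_finrank hr
  refine relIndex_ne_zero hA hfg fun x hx ↦ ?_
  obtain ⟨c, hc0, hc⟩ := exists_smul_mem_span hfg rfl hb (fun i ↦ hle (hbΛ i)) hx
  exact ⟨c, hc0, Submodule.span_le.2 (by rintro _ ⟨i, rfl⟩; exact hbΛ i) hc⟩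

/-- In coordinates the span is A^r, and its multiple by `a` is the kernel of A^r → (A/a)^r. -/
theorem relIndex_smul_range {r : ℕ} {b : Fin r → V} (hb : LinearIndependent A b) (a : A) :
    ((Submodule.span A (Set.range b)).map (LinearMap.lsmul A V a)).toAddSubgroup.relIndex
      (Submodule.span A (Set.range b)).toAddSubgroup = Nat.card (A ⧸ Ideal.span {a}) ^ r := by
  let g : (Fin r → A) →+ V := (Fintype.linearCombination A b).toAddMonoidHom
  have hg : Function.Injective g := linearIndependent_iff_injective_fintypeLinearCombination.1 hb
  let ρ : (Fin r → A) →+ (Fin r → A ⧸ Ideal.span {a}) :=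
    (Ideal.Quotient.mk (Ideal.span {a})).toAddMonoidHom.compLeft (Fin r)
  have hρ : ∀ u i, ρ u i = Ideal.Quotient.mk (Ideal.span {a}) (u i) := fun _ _ ↦ rfl
  have hρs : Function.Surjective ρ := fun v ↦
    ⟨fun i ↦ (v i).out, funext fun i ↦ Quotient.out_eq (v i)⟩
  have hgu : ∀ u, g u = ∑ i, u i • b i := fun u ↦ rfl
  have h1 : (Submodule.span A (Set.range b)).toAddSubgroup = (⊤ : AddSubgroup (Fin r → A)).map g := by
    ext x
    rw [Submodule.mem_toAddSubgroup, Submodule.mem_span_range_iff_exists_fun]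
    simp [AddSubgroup.mem_map, hgu]
  have h2 : ((Submodule.span A (Set.range b)).map (LinearMap.lsmul A V a)).toAddSubgroup =
      ρ.ker.map g := by
    ext x
    rw [Submodule.mem_toAddSubgroup, Submodule.mem_map, AddSubgroup.mem_map]
    constructor
    · rintro ⟨y, hy, rfl⟩
      obtain ⟨u, rfl⟩ := (Submodule.mem_span_range_iff_exists_fun A).1 hy
      refine ⟨a • u, ?_, ?_⟩
      · rw [AddMonoidHom.mem_ker]
        funext i
        rw [hρ]
        exact Ideal.Quotient.eq_zero_iff_mem.2 (Ideal.mul_mem_right _ _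
          (Ideal.mem_span_singleton_self a))
      · rw [hgu, LinearMap.lsmul_apply, Finset.smul_sum]
        simp [mul_smul]
    · rintro ⟨u, hu, rfl⟩
      have h3 : ∀ i, ∃ e, u i = a * e := fun i ↦ by
        have := congrFun (AddMonoidHom.mem_ker.1 hu) i
        exact Ideal.mem_span_singleton.1 (Ideal.Quotient.eq_zero_iff_mem.1 this)
      choose e he using h3
      refine ⟨∑ i, e i • b i, (Submodule.mem_span_range_iff_exists_fun A).2 ⟨e, rfl⟩, ?_⟩
      rw [hgu, LinearMap.lsmul_apply, Finset.smul_sum]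
      simp [mul_smul, he]
  rw [h1, h2, AddSubgroup.relIndex_map_map_of_injective _ _ hg, AddSubgroup.relIndex_top_right,
    AddSubgroup.index_ker, AddMonoidHom.range_eq_top.2 hρs]
  rw [Nat.card_congr (AddSubgroup.topEquiv (G := Fin r → A ⧸ Ideal.span {a})).toEquiv, Nat.card_pi]
  simp

/-- The index of `a Λ` in a torsion-free module `Λ` of rank `r` is `#(A / a) ^ r`. -/
theorem relIndex_smul [Module.IsTorsionFree A V]
    (hA : ∀ b : A, b ≠ 0 → Finite (A ⧸ Ideal.span {b})) {r : ℕ}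
    {Λ : Submodule A V} (hfg : Λ.FG) (hr : Module.finrank A Λ = r) {a : A} (ha : a ≠ 0) :
    (Λ.map (LinearMap.lsmul A V a)).toAddSubgroup.relIndex Λ.toAddSubgroup =
      Nat.card (A ⧸ Ideal.span {a}) ^ r := by
  obtain ⟨b, hb, hbΛ⟩ := exists_linearIndependent_of_finrank hr
  rw [← relIndex_smul_range hb a]
  set N := Submodule.span A (Set.range b)
  have hN : N ≤ Λ := Submodule.span_le.2 (by rintro _ ⟨i, rfl⟩; exact hbΛ i)
  have h0 : N.toAddSubgroup.relIndex Λ.toAddSubgroup ≠ 0 :=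
    relIndex_ne_zero hA hfg fun x hx ↦ exists_smul_mem_span hfg hr hb hbΛ hx
  have hle : ∀ M : Submodule A V, (M.map (LinearMap.lsmul A V a)) ≤ M := by
    rintro M _ ⟨x, hx, rfl⟩
    exact M.smul_mem a hx
  have hmap : ∀ M : Submodule A V, (M.map (LinearMap.lsmul A V a)).toAddSubgroup =
      M.toAddSubgroup.map (LinearMap.lsmul A V a).toAddMonoidHom := fun M ↦ rfl
  have hinj : Function.Injective (LinearMap.lsmul A V a).toAddMonoidHom := fun x y h ↦
    smul_right_injective V ha h
  -- With N free in Λ, the index [Λ : aN] is computed through N and through aΛ. As [aΛ : aN] = [Λ :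
  -- N] is finite, it cancels, reducing to the free case.
  have h1 := AddSubgroup.relIndex_mul_relIndex
    (N.map (LinearMap.lsmul A V a)).toAddSubgroup N.toAddSubgroup Λ.toAddSubgroup (hle N) hN
  have h2 := AddSubgroup.relIndex_mul_relIndex
    (N.map (LinearMap.lsmul A V a)).toAddSubgroup (Λ.map (LinearMap.lsmul A V a)).toAddSubgroup
    Λ.toAddSubgroup (Submodule.map_mono hN) (hle Λ)
  have h3 : (N.map (LinearMap.lsmul A V a)).toAddSubgroup.relIndex
      (Λ.map (LinearMap.lsmul A V a)).toAddSubgroup = N.toAddSubgroup.relIndex Λ.toAddSubgroup := by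
    rw [hmap, hmap, AddSubgroup.relIndex_map_map_of_injective _ _ hinj]
  rw [← h1, h3, mul_comm] at h2
  exact mul_right_cancel₀ h0 h2

end Index

section Complement

variable {F V : Type*} [Field F] [AddCommGroup V] [Module F V]

/-- Intersect a complement of Λ in the whole space with Λ'; the modular law shows that the sum is
still Λ'. The complement is only F-linear, not stable under `A`. -/
theorem exists_complement {Λ Λ' : Submodule F V} (hle : Λ ≤ Λ')
    (h0 : Λ.toAddSubgroup.relIndex Λ'.toAddSubgroup ≠ 0) :
    ∃ T : Submodule F V, Finite T ∧ Disjoint Λ T ∧ Λ ⊔ T = Λ' ∧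
      Nat.card T = Λ.toAddSubgroup.relIndex Λ'.toAddSubgroup := by
  obtain ⟨T₀, hT₀⟩ := Submodule.exists_isCompl Λ
  have hd : Disjoint Λ (T₀ ⊓ Λ') := hT₀.disjoint.mono_right inf_le_left
  have hs : Λ ⊔ T₀ ⊓ Λ' = Λ' := by
    rw [← sup_inf_assoc_of_le T₀ hle, hT₀.sup_eq_top, top_inf_eq]
  have hcard : Nat.card (T₀ ⊓ Λ' : Submodule F V) = Λ.toAddSubgroup.relIndex Λ'.toAddSubgroup := by
    have h1 : Λ'.toAddSubgroup = (T₀ ⊓ Λ').toAddSubgroup ⊔ Λ.toAddSubgroup := by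
      rw [← Submodule.sup_toAddSubgroup, sup_comm, hs]
    have h2 : Λ.toAddSubgroup ⊓ (T₀ ⊓ Λ').toAddSubgroup = ⊥ := by
      rw [eq_bot_iff]
      exact fun x hx ↦ (Submodule.disjoint_def.1 hd) x hx.1 hx.2
    rw [h1, AddSubgroup.relIndex_sup_right, ← AddSubgroup.inf_relIndex_right, h2,
      AddSubgroup.relIndex_bot_left]
    rfl
  exact ⟨_, Nat.finite_of_card_ne_zero (hcard ▸ h0), hd, hs, hcard⟩

end Complement

end DrinfeldLattice

/-! ### Laurent series with eventually geometric coefficients -/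

namespace DrinfeldLattice

section ZSeries

/-- The value at `1` of a rational function. -/
noncomputable def ratValOne (f : RatFunc ℚ) : ℚ := f.num.eval 1 / f.denom.eval 1

/-- The derivative at `1` of a rational function. -/
noncomputable def ratDerivOne (f : RatFunc ℚ) : ℚ :=
  ((derivative f.num).eval 1 * f.denom.eval 1 - f.num.eval 1 * (derivative f.denom).eval 1) /
      f.denom.eval 1 ^ 2

/-- Differentiate the cross-multiplied identity at 1. Nothing is required of Q(1), since only the
reduced denominator is divided by. -/
theorem eval_one_of_mul_eq {f : RatFunc ℚ} (hf : f.denom.eval 1 ≠ 0) {P Q : ℚ[X]}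
    (h : f * algebraMap ℚ[X] (RatFunc ℚ) Q = algebraMap ℚ[X] (RatFunc ℚ) P) :
    P.eval 1 = ratValOne f * Q.eval 1 ∧
      (derivative P).eval 1 = ratDerivOne f * Q.eval 1 + ratValOne f * (derivative Q).eval 1 := by
  have h1 : f.num * Q = P * f.denom := by
    apply RatFunc.algebraMap_injective ℚ
    rw [map_mul, map_mul, ← h]
    have h2 := RatFunc.num_div_denom f
    have h3 : algebraMap ℚ[X] (RatFunc ℚ) f.denom ≠ 0 :=
      RatFunc.algebraMap_ne_zero f.denom_ne_zero
    rw [div_eq_iff h3] at h2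
    rw [h2]
    ring
  have h4 := congrArg (eval 1) h1
  have h5 := congrArg (fun p ↦ eval 1 (derivative p)) h1
  simp only [derivative_mul, eval_add, eval_mul] at h4 h5
  have h6 : P.eval 1 = ratValOne f * Q.eval 1 := by
    rw [ratValOne]; field_simp; linarith
  refine ⟨h6, ?_⟩
  rw [h6] at h5
  rw [ratValOne] at h5 ⊢
  rw [ratDerivOne]
  field_simp at h5 ⊢
  linear_combination -h5

theorem algebraMap_monomial_laurent (n : ℕ) (c : ℚ) :
    algebraMap ℚ[X] ℚ⸨X⸩ (Polynomial.C c * X ^ n) = HahnSeries.single (n : ℤ) c := by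
  have h1 : algebraMap ℚ[X] ℚ⸨X⸩ X = HahnSeries.single 1 1 := by
    rw [IsScalarTower.algebraMap_apply ℚ[X] (RatFunc ℚ) ℚ⸨X⸩, RatFunc.algebraMap_X, RatFunc.coe_X]
  have h2 : algebraMap ℚ[X] ℚ⸨X⸩ (Polynomial.C c) = HahnSeries.single 0 c := by
    have h3 := RatFunc.coe_coe (Polynomial.C c)
    rw [Polynomial.coe_C, PowerSeries.coe_C, RatFunc.coePolynomial,
      ← IsScalarTower.algebraMap_apply] at h3
    exact h3.symm
  rw [map_mul, map_pow, h1, h2, HahnSeries.single_pow, HahnSeries.single_mul_single]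
  simp

variable {h : ℤ → ℚ} {k e : ℕ} {c : ℚ} {M : ℤ}

/-- The numerator of the rational function with Laurent coefficients `h`, where
`h m = c * h (m - e)` for `m > M`. -/
noncomputable def zNum (h : ℤ → ℚ) (k e : ℕ) (c : ℚ) (M : ℤ) : ℚ[X] :=
  ∑ m ∈ Finset.Icc (-(k : ℤ)) M, Polynomial.C (h m - c * h (m - e)) * X ^ (m + k).toNat

/-- The denominator of the rational function with Laurent coefficients `h`. -/
noncomputable def zDen (k e : ℕ) (c : ℚ) : ℚ[X] := X ^ k * (1 - Polynomial.C c * X ^ e)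

/-- The difference h(m) - c h(m - e) vanishes below -k by the support condition and above M by the
recursion, so the finite window misses nothing. -/
theorem coeff_algebraMap_zNum (h0 : ∀ m < -(k : ℤ), h m = 0) (h1 : ∀ m > M, h m = c * h (m - e))
    (j : ℤ) : (algebraMap ℚ[X] ℚ⸨X⸩ (zNum h k e c M)).coeff j = h (j - k) - c * h (j - k - e) := by
  have h2 : algebraMap ℚ[X] ℚ⸨X⸩ (zNum h k e c M) =
      ∑ m ∈ Finset.Icc (-(k : ℤ)) M, HahnSeries.single (m + k) (h m - c * h (m - e)) := by
    rw [zNum, map_sum]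
    refine Finset.sum_congr rfl fun m hm ↦ ?_
    rw [algebraMap_monomial_laurent, Int.toNat_of_nonneg]
    rw [Finset.mem_Icc] at hm
    omega
  rw [h2, HahnSeries.coeff_sum]
  by_cases hj : j - k ∈ Finset.Icc (-(k : ℤ)) M
  · rw [Finset.sum_eq_single_of_mem (j - k) hj]
    · rw [sub_add_cancel, HahnSeries.coeff_single_same]
    · intro m _ hm
      rw [HahnSeries.coeff_single_of_ne]
      omega
  · rw [Finset.sum_eq_zero]
    · rw [Finset.mem_Icc, not_and_or, not_le, not_le] at hj
      rcases hj with hj | hj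
      · rw [h0 _ hj, h0 _ (by omega)]; simp
      · rw [h1 _ hj, sub_self]
    · intro m hm
      rw [HahnSeries.coeff_single_of_ne]
      rintro rfl
      rw [add_sub_cancel_right] at hj
      exact hj hm

theorem coeff_mul_algebraMap_zDen (H : ℚ⸨X⸩) (j : ℤ) :
    (H * algebraMap ℚ[X] ℚ⸨X⸩ (zDen k e c)).coeff j =
      H.coeff (j - k) - c * H.coeff (j - k - e) := by
  have h1 : algebraMap ℚ[X] ℚ⸨X⸩ (X ^ k) = HahnSeries.single (k : ℤ) 1 := by
    rw [← algebraMap_monomial_laurent, C_1, one_mul]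
  rw [zDen, map_mul, map_sub, map_one, h1, algebraMap_monomial_laurent, ← mul_assoc, mul_sub,
    mul_one, HahnSeries.coeff_sub, HahnSeries.coeff_mul_single, HahnSeries.coeff_mul_single,
    HahnSeries.coeff_mul_single, mul_one, mul_one, sub_right_comm, mul_comm c]

theorem zDen_eval_one : (zDen k e c).eval 1 = 1 - c := by simp [zDen]

theorem zDen_derivative_eval_one (k e : ℕ) (c : ℚ) :
    (derivative (zDen k e c)).eval 1 = k * (1 - c) - c * e := by
  simp [zDen, derivative_mul, derivative_X_pow]
  ring

theorem zNum_eval_one : (zNum h k e c M).eval 1 =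
    ∑ m ∈ Finset.Icc (-(k : ℤ)) M, (h m - c * h (m - e)) := by
  simp [zNum, eval_finsetSum]

theorem zNum_derivative_eval_one : (derivative (zNum h k e c M)).eval 1 =
    ∑ m ∈ Finset.Icc (-(k : ℤ)) M, (h m - c * h (m - e)) * (m + k) := by
  rw [zNum, derivative_sum, eval_finsetSum]
  refine Finset.sum_congr rfl fun m hm ↦ ?_
  rw [Finset.mem_Icc] at hm
  have h3 : (((m + k).toNat : ℕ) : ℚ) = m + k := by
    have h4 : (((m + k).toNat : ℕ) : ℤ) = m + k := Int.toNat_of_nonneg (by omega)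
    exact_mod_cast congrArg (Int.cast : ℤ → ℚ) h4
  simp [derivative_mul, derivative_X_pow, h3]

theorem ratFunc_mul_zDen_eq {f : RatFunc ℚ} (hf : ∀ m, (algebraMap (RatFunc ℚ) ℚ⸨X⸩ f).coeff m = h m)
    (h0 : ∀ m < -(k : ℤ), h m = 0) (h1 : ∀ m > M, h m = c * h (m - e)) :
    f * algebraMap ℚ[X] (RatFunc ℚ) (zDen k e c) = algebraMap ℚ[X] (RatFunc ℚ) (zNum h k e c M) := by
  apply (algebraMap (RatFunc ℚ) ℚ⸨X⸩).injective
  rw [map_mul, ← IsScalarTower.algebraMap_apply, ← IsScalarTower.algebraMap_apply]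
  ext j
  rw [coeff_mul_algebraMap_zDen, coeff_algebraMap_zNum h0 h1, hf, hf]

/-- The value and the derivative at `1` of a rational function in terms of its coefficients. -/
theorem sum_eq_of_coeff_eq {f : RatFunc ℚ}
    (hf : ∀ m, (algebraMap (RatFunc ℚ) ℚ⸨X⸩ f).coeff m = h m) (hd : f.denom.eval 1 ≠ 0)
    (h0 : ∀ m < -(k : ℤ), h m = 0) (h1 : ∀ m > M, h m = c * h (m - e)) :
    ∑ m ∈ Finset.Icc (-(k : ℤ)) M, (h m - c * h (m - e)) = ratValOne f * (1 - c) ∧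
    ∑ m ∈ Finset.Icc (-(k : ℤ)) M, m * (h m - c * h (m - e)) =
      ratDerivOne f * (1 - c) - c * e * ratValOne f := by
  obtain ⟨h2, h3⟩ := eval_one_of_mul_eq hd (ratFunc_mul_zDen_eq hf h0 h1)
  rw [zNum_eval_one, zDen_eval_one] at h2
  rw [zNum_derivative_eval_one, zDen_eval_one, zDen_derivative_eval_one] at h3
  refine ⟨h2, ?_⟩
  -- The weights m + k come from the factor X^k clearing the pole at 0; the identity for the values
  -- removes the k.
  have h4 : ∑ m ∈ Finset.Icc (-(k : ℤ)) M, (h m - c * h (m - e)) * (m + k) =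
      ∑ m ∈ Finset.Icc (-(k : ℤ)) M, m * (h m - c * h (m - e)) +
        k * ∑ m ∈ Finset.Icc (-(k : ℤ)) M, (h m - c * h (m - e)) := by
    rw [Finset.mul_sum, ← Finset.sum_add_distrib]
    exact Finset.sum_congr rfl fun _ _ ↦ by ring
  rw [h4, h2] at h3
  linear_combination h3

theorem exists_ratFunc_coeff_eq (h0 : ∀ m < -(k : ℤ), h m = 0)
    (h1 : ∀ m > M, h m = c * h (m - e)) (hc : c ≠ 1) :
    ∃ f : RatFunc ℚ, (∀ m, (algebraMap (RatFunc ℚ) ℚ⸨X⸩ f).coeff m = h m) ∧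
      f.denom.eval 1 ≠ 0 := by
  have hQ1 : (zDen k e c).eval 1 ≠ 0 := by rw [zDen_eval_one, sub_ne_zero]; exact hc.symm
  have hQ : zDen k e c ≠ 0 := fun h ↦ hQ1 (by rw [h, eval_zero])
  have hb : BddBelow (Function.support h) := ⟨-k, fun m hm ↦ by
    by_contra! h2
    exact hm (h0 m h2)⟩
  let H : ℚ⸨X⸩ := HahnSeries.ofSuppBddBelow h hb
  have hH : H * algebraMap ℚ[X] ℚ⸨X⸩ (zDen k e c) = algebraMap ℚ[X] ℚ⸨X⸩ (zNum h k e c M) := by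
    ext j
    rw [coeff_mul_algebraMap_zDen, coeff_algebraMap_zNum h0 h1]
    rfl
  have hQ' : algebraMap ℚ[X] ℚ⸨X⸩ (zDen k e c) ≠ 0 := by
    rw [IsScalarTower.algebraMap_apply ℚ[X] (RatFunc ℚ) ℚ⸨X⸩]
    exact (_root_.map_ne_zero _).2 (RatFunc.algebraMap_ne_zero hQ)
  refine ⟨algebraMap ℚ[X] (RatFunc ℚ) (zNum h k e c M) / algebraMap ℚ[X] (RatFunc ℚ) (zDen k e c),
    fun m ↦ ?_, fun h2 ↦ ?_⟩
  · rw [map_div₀, ← IsScalarTower.algebraMap_apply, ← IsScalarTower.algebraMap_apply, ← hH,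
      mul_div_cancel_right₀ _ hQ']
    rfl
  -- The reduced denominator divides `zDen`, whose value at 1 is 1 - c ≠ 0.
  · obtain ⟨p, hp⟩ := RatFunc.denom_div_dvd (zNum h k e c M) (zDen k e c)
    apply hQ1
    rw [hp, eval_mul, h2, zero_mul]

end ZSeries

end DrinfeldLattice

/-! ### Scaling and sphere counts -/

namespace DrinfeldLattice

open Filter Topology

section Scaling

variable {F C : Type*} [Field F] [Field C] [Algebra F C] {α : C}

/-- A product over `αV` is a product over `V`. -/
theorem prod_elems_mul {M : Type*} [CommMonoid M] (hα : α ≠ 0) {V V₁ : Submodule F C} [Finite V]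
    [Finite V₁] (h : ∀ x, α * x ∈ V₁ ↔ x ∈ V) (f : C → M) :
    ∏ x ∈ elems V₁, f x = ∏ x ∈ elems V, f (α * x) := by
  symm
  refine Finset.prod_bij (fun x _ ↦ α * x) (fun x hx ↦ mem_elems.2 ((h x).2 (mem_elems.1 hx)))
    (fun x _ y _ hxy ↦ mul_left_cancel₀ hα hxy) (fun y hy ↦ ?_) fun _ _ ↦ rfl
  have h1 : α * (α⁻¹ * y) = y := mul_inv_cancel_left₀ hα y
  exact ⟨α⁻¹ * y, mem_elems.2 ((h _).1 (by rw [h1]; exact mem_elems.1 hy)), h1⟩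

theorem card_mul (hα : α ≠ 0) {V V₁ : Submodule F C} [Finite V] [Finite V₁]
    (h : ∀ x, α * x ∈ V₁ ↔ x ∈ V) : Nat.card V₁ = Nat.card V := by
  have h := prod_elems_mul hα h fun _ ↦ 2
  simp only [Finset.prod_const, card_elems] at h
  exact Nat.pow_right_injective le_rfl h

/-- There are #V - 1 nonzero elements to scale; the extra factor α on the left avoids the
subtraction. -/
theorem nzProd_mul (hα : α ≠ 0) {V V₁ : Submodule F C} [Finite V] [Finite V₁]
    (h : ∀ x, α * x ∈ V₁ ↔ x ∈ V) : α * nzProd V₁ = α ^ Nat.card V * nzProd V := by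
  classical
  have h1 := prod_elems_mul hα h fun x ↦ if x = 0 then 1 else -x
  have h2 : ∀ (W : Submodule F C) [Finite W] (β : C), β ≠ 0 →
      ∏ x ∈ elems W, (if β * x = 0 then 1 else -(β * x)) = ∏ x ∈ nzElems W, (β * -x) := by
    intro W _ β hβ
    rw [prod_elems, mul_zero, if_pos rfl, one_mul]
    refine Finset.prod_congr rfl fun x hx ↦ ?_
    rw [if_neg (mul_ne_zero hβ (mem_nzElems.1 hx).2), mul_neg]
  have h3 := h2 V₁ 1 one_ne_zero
  simp only [one_mul] at h3
  rw [h3, h2 V α hα, Finset.prod_mul_distrib, Finset.prod_const] at h1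
  rw [nzProd, h1, ← mul_assoc, ← pow_succ', card_nzElems_add_one, nzProd]

end Scaling

section NormedScaling

variable {F C : Type*} [Field F] [Finite F] [NormedField C] [IsUltrametricDist C]
  [Algebra F C] {α : C} {Λ Λ₁ : Submodule F C}

theorem mul_mem_ballSub_iff (hα : α ≠ 0) (h : ∀ x, α * x ∈ Λ₁ ↔ x ∈ Λ) {R : ℝ} (hR : 0 ≤ R)
    (x : C) : α * x ∈ ballSub Λ₁ (‖α‖ * R) ↔ x ∈ ballSub Λ R := by
  rw [mem_ballSub (mul_nonneg (norm_nonneg _) hR), mem_ballSub hR, h, norm_mul,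
    mul_le_mul_iff_right₀ (norm_pos_iff.2 hα)]

theorem latExp_mul (hα : α ≠ 0) (h : ∀ x, α * x ∈ Λ₁ ↔ x ∈ Λ) (z : C) :
    latExp Λ₁ (α * z) = α * latExp Λ z := by
  rw [latExp, latExp, mul_assoc]
  congr 2
  let e : {x : C // x ∈ Λ ∧ x ≠ 0} ≃ {x : C // x ∈ Λ₁ ∧ x ≠ 0} :=
    (Equiv.mulLeft₀ α hα).subtypeEquiv fun x ↦ by
      simp [h, hα]
  rw [← e.tprod_eq]
  congr 1
  funext x
  change 1 - α * z / (α * (x : C)) = _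
  rw [mul_div_mul_left _ _ hα]

theorem card_norm_eq_mul (hα : α ≠ 0) (h : ∀ x, α * x ∈ Λ₁ ↔ x ∈ Λ) (ρ : ℝ) :
    Nat.card {x : C // x ∈ Λ₁ ∧ ‖x‖ = ‖α‖ * ρ} = Nat.card {x : C // x ∈ Λ ∧ ‖x‖ = ρ} := by
  symm
  refine Nat.card_congr ((Equiv.mulLeft₀ α hα).subtypeEquiv fun x ↦ ?_)
  rw [Equiv.mulLeft₀_apply, h, norm_mul, mul_right_inj' (norm_ne_zero_iff.2 hα)]

/-- In `Λ ⊕ T`, each large sphere is the sum of `T` and the sphere in `Λ`. -/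
theorem card_norm_eq_sup {T Λ' : Submodule F C} (hd : Disjoint Λ T) (hT : Λ ⊔ T = Λ') {ρ : ℝ}
    (hρ : ∀ t ∈ T, ‖t‖ < ρ) : Nat.card {x : C // x ∈ Λ' ∧ ‖x‖ = ρ} =
      Nat.card T * Nat.card {x : C // x ∈ Λ ∧ ‖x‖ = ρ} := by
  -- Adding a vector of norm < ρ preserves membership in the sphere of radius ρ, so that sphere is a
  -- union of cosets of `T`.
  have hn : ∀ x : C, ∀ t ∈ T, (‖t + x‖ = ρ ↔ ‖x‖ = ρ) := by
    intro x t ht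
    rcases eq_or_ne ‖x‖ ‖t‖ with h | h
    · have h1 := IsUltrametricDist.norm_add_le_max t x
      rw [h, max_self] at h1
      have h2 := hρ t ht
      exact iff_of_false (by linarith [h1.trans_lt h2]) (by rw [h]; exact h2.ne)
    · rw [IsUltrametricDist.norm_add_eq_max_of_norm_ne_norm h.symm]
      rcases max_cases ‖t‖ ‖x‖ with ⟨h1, h2⟩ | ⟨h1, h2⟩
      · rw [h1]
        exact iff_of_false (hρ t ht).ne (h2.trans_lt (hρ t ht)).ne
      · rw [h1]
  rw [← Nat.card_prod]
  symm
  let f : T × {x : C // x ∈ Λ ∧ ‖x‖ = ρ} → {x : C // x ∈ Λ' ∧ ‖x‖ = ρ} := fun p ↦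
    ⟨p.1 + p.2, by
      rw [← hT]
      exact add_mem (le_sup_right (a := Λ) p.1.2) (le_sup_left (b := T) p.2.2.1),
      (hn _ _ p.1.2).2 p.2.2.2⟩
  refine Nat.card_congr (Equiv.ofBijective f ⟨fun p p' h ↦ ?_, fun x ↦ ?_⟩)
  · have h1 : (p.1 : C) + p.2 = p'.1 + p'.2 := congrArg Subtype.val h
    have h2 : (p.1 : C) - p'.1 = p'.2 - p.2 := by linear_combination h1
    have h3 : (p.1 : C) - p'.1 = 0 := Submodule.disjoint_def.1 hd _
      (by rw [h2]; exact sub_mem p'.2.2.1 p.2.2.1) (sub_mem p.1.2 p'.1.2)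
    refine Prod.ext (Subtype.ext (sub_eq_zero.1 h3)) (Subtype.ext ?_)
    rw [h3] at h2
    exact (sub_eq_zero.1 h2.symm).symm
  · have hx : (x : C) ∈ Λ ⊔ T := hT.ge x.2.1
    obtain ⟨y, hy, t, ht, hyt⟩ := Submodule.mem_sup.1 hx
    refine ⟨⟨⟨t, ht⟩, ⟨y, hy, (hn y t ht).1 ?_⟩⟩, Subtype.ext ?_⟩
    · rw [add_comm, hyt, x.2.2]
    · exact (add_comm t y).trans hyt

end NormedScaling

end DrinfeldLattice

/-! ### Lattices as discrete F-subspaces -/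

namespace DrinfeldLattice

open Filter Topology

section LatticePairs

variable {F K : Type*} [Field F] [Field K] [Algebra F K] [IsGlobalFunctionField F K]
  {O : ValuationSubring K} [IsDiscreteValuationRing O]
  {Λ Λ' : Submodule (coeffRing F O) (CInf F O)} {r : ℕ} {a : coeffRing F O}

theorem algebraMap_coeffRing_ne_zero (ha : a ≠ 0) : algebraMap K (CInf F O) a ≠ 0 := by
  rw [Ne, _root_.map_eq_zero]
  exact fun h ↦ ha (Subtype.ext h)

instance : Module.IsTorsionFree (coeffRing F O) (CInf F O) := by
  refine ⟨fun a ha x y hxy ↦ ?_⟩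
  simp only [coeffRing_smul_def] at hxy
  exact mul_left_cancel₀ (algebraMap_coeffRing_ne_zero ha.ne_zero) hxy

/-- The lattice `Λ` as an `F`-subspace. -/
noncomputable abbrev lsub (Λ : Submodule (coeffRing F O) (CInf F O)) : Submodule F (CInf F O) :=
  Λ.restrictScalars F

theorem IsLattice.isDiscreteSubspace (hΛ : IsLattice Λ r) : IsDiscreteSubspace (lsub Λ) :=
  ⟨hΛ.discrete⟩

theorem expFn_eq_latExp (z : CInf F O) : expFn Λ z = latExp (lsub Λ) z := rfl

/-- The lattice `aΛ`. -/
noncomputable abbrev smulLat (a : coeffRing F O) (Λ : Submodule (coeffRing F O) (CInf F O)) :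
    Submodule (coeffRing F O) (CInf F O) :=
  Λ.map (LinearMap.lsmul _ _ a)

theorem mul_mem_smulLat_iff (ha : a ≠ 0) (x : CInf F O) :
    algebraMap K (CInf F O) a * x ∈ lsub (smulLat a Λ) ↔ x ∈ lsub Λ := by
  rw [Submodule.restrictScalars_mem, Submodule.restrictScalars_mem, Submodule.mem_map]
  simp only [LinearMap.lsmul_apply, coeffRing_smul_def]
  constructor
  · rintro ⟨y, hy, h⟩
    rwa [← mul_left_cancel₀ (algebraMap_coeffRing_ne_zero ha) h]
  · exact fun h ↦ ⟨x, h, rfl⟩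

theorem smulLat_le : smulLat a Λ ≤ Λ := by
  rintro _ ⟨x, hx, rfl⟩
  exact Λ.smul_mem a hx

theorem IsLattice.isDiscreteSubspace_smulLat (hΛ : IsLattice Λ r) :
    IsDiscreteSubspace (lsub (smulLat a Λ)) :=
  ⟨fun R ↦ (hΛ.discrete R).subset fun _ hx ↦ ⟨smulLat_le hx.1, hx.2⟩⟩

theorem IsLattice.latticeIndex_ne_zero (hΛ : IsLattice Λ r) (hΛ' : IsLattice Λ' r) (hle : Λ ≤ Λ') :
    latticeIndex Λ Λ' ≠ 0 :=
  relIndex_ne_zero_of_finrank_eq (fun _ hb ↦ finite_quotient_coeffRing' hb) hΛ'.fg hle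
    (hΛ.finrank_eq.trans hΛ'.finrank_eq.symm)

theorem IsLattice.latticeIndex_smulLat (hΛ : IsLattice Λ r) (ha : a ≠ 0) :
    latticeIndex (smulLat a Λ) Λ = Nat.card F ^ (r * degA F O a) := by
  rw [latticeIndex, relIndex_smul (fun _ hb ↦ finite_quotient_coeffRing' hb) hΛ.fg hΛ.finrank_eq ha,
    card_quotient_coeffRing ha, ← pow_mul, mul_comm]

theorem exists_lattice_complement (hle : Λ ≤ Λ') (h0 : latticeIndex Λ Λ' ≠ 0) :
    ∃ T : Submodule F (CInf F O), Finite T ∧ Disjoint (lsub Λ) T ∧ lsub Λ ⊔ T = lsub Λ' ∧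
      Nat.card T = latticeIndex Λ Λ' :=
  exists_complement (F := F) (Λ := lsub Λ) (Λ' := lsub Λ') hle h0

theorem IsLattice.exists_complement_smulLat (hΛ : IsLattice Λ r) (ha : a ≠ 0) :
    ∃ T : Submodule F (CInf F O), Finite T ∧ Disjoint (lsub (smulLat a Λ)) T ∧
      lsub (smulLat a Λ) ⊔ T = lsub Λ ∧ Nat.card T = Nat.card F ^ (r * degA F O a) := by
  have := finite_constants_of F K
  have h := hΛ.latticeIndex_smulLat ha
  rw [← h]
  refine exists_lattice_complement smulLat_le ?_
  rw [h]
  exact pow_ne_zero _ Nat.card_pos.ne'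

theorem one_lt_card_constants (F K : Type*) [Field F] [Field K] [Algebra F K]
    [IsGlobalFunctionField F K] : 1 < Nat.card F := by
  have := finite_constants_of F K
  exact Finite.one_lt_card

theorem norm_algebraMap_coeffRing (ha : a ≠ 0) :
    ‖algebraMap K (CInf F O) a‖ = (Nat.card F : ℝ) ^ degA F O a := by
  rw [norm_algebraMap_CInf, absInf_eq_pow_degA ha]

variable (F O) in
/-- There is an element of `A` of positive degree. -/
theorem exists_degA_pos : ∃ a : coeffRing F O, a ≠ 0 ∧ 0 < degA F O a := by
  obtain ⟨a, ha, h⟩ := exists_nonconstant F O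
  have h0 : (⟨a, ha⟩ : coeffRing F O) ≠ 0 := by
    intro h0
    have h1 : a = 0 := congrArg Subtype.val h0
    rw [h1, map_zero] at h
    linarith
  refine ⟨⟨a, ha⟩, h0, Nat.pos_of_ne_zero fun h2 ↦ ?_⟩
  have h3 := absInf_eq_pow_degA h0
  rw [h2, pow_zero] at h3
  exact h.ne' h3

/-- `log ‖c‖` where `c` is the product of the nonzero elements of `Λ` of norm at most `q ^ N`,
up to sign. -/
noncomputable def logProd (Λ : Submodule F (CInf F O)) [Finite F] [IsDiscreteSubspace Λ] (N : ℕ) :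
    ℝ :=
  Real.logb (Nat.card F) ‖nzProd (ballSub Λ ((Nat.card F : ℝ) ^ N))‖

/-- The number of elements of `Λ` of norm at most `q ^ N`. -/
noncomputable def ballCard (Λ : Submodule F (CInf F O)) [Finite F] [IsDiscreteSubspace Λ] (N : ℕ) :
    ℕ :=
  Nat.card (ballSub Λ ((Nat.card F : ℝ) ^ N))

theorem tendsto_card_pow (F K : Type*) [Field F] [Field K] [Algebra F K]
    [IsGlobalFunctionField F K] : Tendsto (fun N : ℕ ↦ (Nat.card F : ℝ) ^ N) atTop atTop :=
  tendsto_pow_atTop_atTop_of_one_lt (by exact_mod_cast one_lt_card_constants F K)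

theorem logProd_eq_sum [Finite F] (Λ : Submodule F (CInf F O)) [IsDiscreteSubspace Λ] (N : ℕ) :
    logProd Λ N = ∑ x ∈ nzElems (ballSub Λ ((Nat.card F : ℝ) ^ N)), logq x := by
  rw [logProd, nzProd, norm_prod, Real.logb_prod]
  · simp only [norm_neg, logq]
  · intro x hx
    rw [norm_neg, norm_ne_zero_iff]
    exact (mem_nzElems.1 hx).2

end LatticePairs

end DrinfeldLattice

/-! ### The coefficients of Z_Λ -/

namespace DrinfeldLattice

open Filter Topology

section ZFunction

variable {F K : Type*} [Field F] [Field K] [Algebra F K] [IsGlobalFunctionField F K]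
  {O : ValuationSubring K} [IsDiscreteValuationRing O]
  {Λ Λ' : Submodule (coeffRing F O) (CInf F O)} {r : ℕ} {a : coeffRing F O}

/-- The number of elements of `Λ` of logarithm `m / n`. -/
noncomputable def zCount (Λ : Submodule (coeffRing F O) (CInf F O)) (n : ℕ) (m : ℤ) : ℕ :=
  Nat.card {x : CInf F O // x ∈ Λ ∧ x ≠ 0 ∧ logq x = m / n}

theorem ne_zero_and_logq_eq_iff {x : CInf F O} {t : ℝ} :
    x ≠ 0 ∧ logq x = t ↔ ‖x‖ = (Nat.card F : ℝ) ^ t := by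
  have hq : (1 : ℝ) < Nat.card F := by exact_mod_cast one_lt_card_constants F K
  constructor
  · rintro ⟨hx, rfl⟩
    rw [logq, Real.rpow_logb (by linarith) hq.ne' (norm_pos_iff.2 hx)]
  · intro h
    have hx : 0 < ‖x‖ := h ▸ Real.rpow_pos_of_pos (by linarith) t
    refine ⟨norm_pos_iff.1 hx, ?_⟩
    rw [logq, h, Real.logb_rpow (by linarith) hq.ne']

theorem zCount_eq_card_norm (n : ℕ) (m : ℤ) : zCount Λ n m =
    Nat.card {x : CInf F O // x ∈ lsub Λ ∧ ‖x‖ = (Nat.card F : ℝ) ^ ((m : ℝ) / n)} :=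
  Nat.card_congr (Equiv.subtypeEquivRight fun _ ↦ and_congr_right fun _ ↦ ne_zero_and_logq_eq_iff)

/-- Write Λ = aΛ ⊕ T with #T = q^(rd). A sphere beyond `T` is `T` plus a sphere of aΛ, which is `a`
times a sphere of Λ with logarithm smaller by d. This recursion makes Z_Λ rational. -/
theorem exists_zCount_eq_mul (hΛ : IsLattice Λ r) (ha : a ≠ 0) {n : ℕ} (hn : 0 < n) :
    ∃ M : ℤ, ∀ m > M, zCount Λ n m =
      Nat.card F ^ (r * degA F O a) * zCount Λ n (m - (degA F O a * n : ℕ)) := by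
  have := finite_constants_of F K
  have hq : (1 : ℝ) < Nat.card F := by exact_mod_cast one_lt_card_constants F K
  have hn' : (0 : ℝ) < n := by exact_mod_cast hn
  obtain ⟨T, hTf, hd, hT, hTc⟩ := hΛ.exists_complement_smulLat ha
  obtain ⟨R, hR, hTR⟩ := exists_norm_le T
  obtain ⟨N, hN⟩ := ((tendsto_card_pow F K).eventually_ge_atTop R).exists
  refine ⟨n * N, fun m hm ↦ ?_⟩
  have hm' : (n * N : ℝ) < m := by exact_mod_cast hm
  rw [zCount_eq_card_norm, zCount_eq_card_norm, card_norm_eq_sup hd hT, hTc,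
    ← card_norm_eq_mul (Λ := lsub Λ) (Λ₁ := lsub (smulLat a Λ)) (algebraMap_coeffRing_ne_zero ha)
      (mul_mem_smulLat_iff ha)]
  · have h : ‖algebraMap K (CInf F O) a‖ *
        (Nat.card F : ℝ) ^ (((m - (degA F O a * n : ℕ) : ℤ) : ℝ) / n) =
        (Nat.card F : ℝ) ^ ((m : ℝ) / n) := by
      rw [norm_algebraMap_coeffRing ha, ← Real.rpow_natCast, ← Real.rpow_add (by linarith)]
      congr 1
      push_cast
      field_simp
      ring
    rw [h]
  · intro t ht
    refine ((hTR t ht).trans hN).trans_lt ?_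
    rw [← Real.rpow_natCast]
    refine Real.rpow_lt_rpow_of_exponent_lt hq ?_
    rw [lt_div_iff₀ hn']
    linarith

/-- The logarithms of the nonzero elements of a lattice are bounded below. -/
theorem exists_le_logq (hΛ : IsLattice Λ r) : ∃ B : ℝ, ∀ x ∈ Λ, x ≠ 0 → B ≤ logq x := by
  have := finite_constants_of F K
  have := hΛ.isDiscreteSubspace
  have hq : (1 : ℝ) < Nat.card F := by exact_mod_cast one_lt_card_constants F K
  obtain ⟨B, hB⟩ := ((nzElems (ballSub (lsub Λ) 1)).image logq).bddBelow
  refine ⟨min B 0, fun x hx hx0 ↦ ?_⟩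
  rcases le_total ‖x‖ 1 with h | h
  · exact (min_le_left _ _).trans (hB (Finset.mem_coe.2 (Finset.mem_image_of_mem _
      (mem_nzElems.2 ⟨(mem_ballSub zero_le_one).2 ⟨hx, h⟩, hx0⟩))))
  · exact (min_le_right _ _).trans (Real.logb_nonneg hq h)

theorem exists_zCount_eq_zero (hΛ : IsLattice Λ r) {n : ℕ} (hn : 0 < n) :
    ∃ k : ℕ, ∀ m < -(k : ℤ), zCount Λ n m = 0 := by
  have hn' : (0 : ℝ) < n := by exact_mod_cast hn
  obtain ⟨B, hB⟩ := exists_le_logq hΛ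
  obtain ⟨k, hk⟩ := exists_nat_ge (-(n * B))
  refine ⟨k, fun m hm ↦ ?_⟩
  have : IsEmpty {x : CInf F O // x ∈ Λ ∧ x ≠ 0 ∧ logq x = m / n} := by
    refine ⟨fun ⟨x, hx, hx0, h⟩ ↦ ?_⟩
    have h1 := hB x hx hx0
    rw [h, le_div_iff₀ hn'] at h1
    have h2 : (m : ℝ) < -k := by exact_mod_cast hm
    linarith
  exact Nat.card_of_isEmpty

/-- Norms are roots of powers of q_∞. An element of `A` of positive degree d satisfies q^d = q_∞^j
with j > 0, so log q_∞ is rational. -/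
theorem exists_mul_logq_eq (x : CInf F O) (hx : x ≠ 0) :
    ∃ n : ℕ, 0 < n ∧ ∃ m : ℤ, n * logq x = m := by
  have hq : (1 : ℝ) < Nat.card F := by exact_mod_cast one_lt_card_constants F K
  have hQ := one_lt_qInf' F O
  obtain ⟨n, hn, m, hm⟩ := exists_norm_pow_eq x hx
  obtain ⟨a, ha, hd⟩ := exists_degA_pos F O
  obtain ⟨j, hj⟩ := exists_absInf_eq (F := F) (O := O) (x := (a : K))
    (fun h ↦ ha (Subtype.ext h))
  rw [absInf_eq_pow_degA ha] at hj
  have h1 := congrArg (Real.logb (Nat.card F)) hm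
  have h2 := congrArg (Real.logb (Nat.card F)) hj
  have hz : ∀ m : ℤ, Real.logb (Nat.card F) ((qInf O : ℝ) ^ m) =
      m * Real.logb (Nat.card F) (qInf O) := fun m ↦ by
    rw [Real.logb, Real.log_zpow, mul_div_assoc, Real.logb]
  rw [Real.logb_pow, hz] at h1
  rw [Real.logb_pow, hz, Real.logb_self_eq_one hq, mul_one] at h2
  have hj0 : 0 < j := by
    by_contra! h
    have h3 : (0 : ℝ) < degA F O a := by exact_mod_cast hd
    have h4 : (j : ℝ) ≤ 0 := by exact_mod_cast h
    have h5 := Real.logb_pos hq hQ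
    nlinarith
  refine ⟨n * j.toNat, Nat.mul_pos hn (by omega), m * degA F O a, ?_⟩
  have h3 : ((j.toNat : ℕ) : ℝ) = j := by
    exact_mod_cast congrArg (Int.cast : ℤ → ℝ) (Int.toNat_of_nonneg hj0.le)
  push_cast
  rw [h3, h2, logq]
  linear_combination (j : ℝ) * h1

/-- The logarithms of the nonzero elements of a lattice have a common denominator. -/
theorem exists_common_denominator (hΛ : IsLattice Λ r) :
    ∃ n : ℕ, 0 < n ∧ ∀ x ∈ Λ, x ≠ 0 → ∃ m : ℤ, logq x = m / n := by
  have := finite_constants_of F K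
  have := hΛ.isDiscreteSubspace
  have hq : (1 : ℝ) < Nat.card F := by exact_mod_cast one_lt_card_constants F K
  obtain ⟨a, ha, hd⟩ := exists_degA_pos F O
  obtain ⟨T, hTf, hdj, hT, hTc⟩ := hΛ.exists_complement_smulLat ha
  obtain ⟨R₀, hR₀, hTR₀⟩ := exists_norm_le T
  obtain ⟨R, hR, hTR⟩ : ∃ R : ℝ, 0 < R ∧ ∀ t ∈ T, ‖t‖ < R :=
    ⟨R₀ + 1, by linarith, fun t ht ↦ by linarith [hTR₀ t ht]⟩
  set s := nzElems (ballSub (lsub Λ) R)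
  choose! ν hν0 hν using exists_mul_logq_eq (F := F) (O := O)
  have hn : 0 < ∏ x ∈ s, ν x := Finset.prod_pos fun x hx ↦ hν0 x (mem_nzElems.1 hx).2
  refine ⟨∏ x ∈ s, ν x, hn, ?_⟩
  have hn' : (0 : ℝ) < (∏ x ∈ s, ν x : ℕ) := by exact_mod_cast hn
  have hbase : ∀ x ∈ Λ, x ≠ 0 → ‖x‖ ≤ R → ∃ m : ℤ, (∏ x ∈ s, ν x : ℕ) * logq x = m := by
    intro x hx hx0 hxR
    have hxs : x ∈ s := mem_nzElems.2 ⟨(mem_ballSub hR.le).2 ⟨hx, hxR⟩, hx0⟩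
    obtain ⟨m, hm⟩ := hν x hx0
    obtain ⟨l, hl⟩ := Finset.dvd_prod_of_mem ν hxs
    refine ⟨l * m, ?_⟩
    rw [hl]
    push_cast
    linear_combination (l : ℝ) * hm
  have h1 : (1 : ℝ) < (Nat.card F : ℝ) ^ degA F O a := one_lt_pow₀ hq hd.ne'
  -- Induction on the size of x. Finitely many vectors have norm ≤ R; a longer one is ay + t with t
  -- short, so log x = deg a + log y and no new denominator occurs.
  have h : ∀ k : ℕ, ∀ x ∈ Λ, x ≠ 0 → ‖x‖ ≤ R * ((Nat.card F : ℝ) ^ degA F O a) ^ k →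
      ∃ m : ℤ, (∏ x ∈ s, ν x : ℕ) * logq x = m := by
    intro k
    induction k with
    | zero =>
      intro x hx hx0 hxR
      exact hbase x hx hx0 (by rwa [pow_zero, mul_one] at hxR)
    | succ k ih =>
      intro x hx hx0 hxR
      rcases le_or_gt ‖x‖ R with hxR' | hxR'
      · exact hbase x hx hx0 hxR'
      have hxs : x ∈ lsub (smulLat a Λ) ⊔ T := hT.ge hx
      obtain ⟨_, ⟨y, hy, rfl⟩, t, ht, hyt⟩ := Submodule.mem_sup.1 hxs
      rw [LinearMap.lsmul_apply, coeffRing_smul_def] at hyt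
      have hn1 : ‖x‖ = ‖algebraMap K (CInf F O) a * y‖ := by
        rw [eq_sub_iff_add_eq.2 hyt, sub_eq_add_neg,
          IsUltrametricDist.norm_add_eq_max_of_norm_ne_norm, norm_neg,
          max_eq_left ((hTR t ht).trans hxR').le]
        rw [norm_neg]
        exact ((hTR t ht).trans hxR').ne'
      rw [norm_mul, norm_algebraMap_coeffRing ha] at hn1
      have hy0 : y ≠ 0 := by
        rintro rfl
        rw [norm_zero, mul_zero] at hn1
        exact hx0 (norm_eq_zero.1 hn1)
      obtain ⟨m, hm⟩ := ih y hy hy0 (by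
        rw [hn1, pow_succ, ← mul_assoc, mul_comm] at hxR
        exact le_of_mul_le_mul_right hxR (by linarith))
      refine ⟨m + (∏ x ∈ s, ν x : ℕ) * degA F O a, ?_⟩
      have hl : logq x = degA F O a + logq y := by
        rw [logq, hn1, Real.logb_mul (by linarith) (norm_ne_zero_iff.2 hy0), Real.logb_pow,
          Real.logb_self_eq_one hq, mul_one, logq]
      rw [hl]
      push_cast at hm ⊢
      linear_combination hm
  intro x hx hx0
  obtain ⟨k, hk⟩ := (((tendsto_pow_atTop_atTop_of_one_lt h1).const_mul_atTop
    hR).eventually_ge_atTop ‖x‖).exists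
  obtain ⟨m, hm⟩ := h k x hx hx0 hk
  exact ⟨m, by rw [eq_div_iff hn'.ne', mul_comm, hm]⟩

/-- Grouping the nonzero vectors of a ball by their logarithm. With g = 1 this counts them, with
g(m) = m it gives the logarithm of their product. -/
theorem sum_zCount_mul [Finite F] [IsDiscreteSubspace (lsub Λ)] {n : ℕ} (hn : 0 < n) {μ : CInf F O → ℤ}
    (hμ : ∀ x ∈ Λ, x ≠ 0 → logq x = μ x / n) {k : ℕ} (hk : ∀ m < -(k : ℤ), zCount Λ n m = 0) (N : ℕ)
    (g : ℤ → ℝ) : ∑ m ∈ Finset.Icc (-(k : ℤ)) (n * N), g m * zCount Λ n m =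
      ∑ x ∈ nzElems (ballSub (lsub Λ) ((Nat.card F : ℝ) ^ N)), g (μ x) := by
  classical
  have hq : (1 : ℝ) < Nat.card F := by exact_mod_cast one_lt_card_constants F K
  have hn' : (0 : ℝ) < n := by exact_mod_cast hn
  set s := nzElems (ballSub (lsub Λ) ((Nat.card F : ℝ) ^ N))
  have hs : ∀ x, x ∈ s ↔ x ∈ Λ ∧ x ≠ 0 ∧ μ x ≤ n * N := by
    intro x
    rw [mem_nzElems, mem_ballSub (by positivity), and_assoc]
    refine and_congr_right fun hx ↦ ?_
    rw [and_comm]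
    refine and_congr_right fun hx0 ↦ ?_
    rw [← Real.rpow_natCast, ← Real.logb_le_iff_le_rpow hq (norm_pos_iff.2 hx0)]
    change logq x ≤ N ↔ _
    rw [hμ x hx hx0, div_le_iff₀ hn', mul_comm]
    exact_mod_cast Iff.rfl
  have hc : ∀ m : ℤ, m ≤ n * N → zCount Λ n m = (s.filter fun x ↦ μ x = m).card := by
    intro m hm
    rw [zCount, Nat.subtype_card]
    intro x
    rw [Finset.mem_filter, hs]
    constructor
    · rintro ⟨⟨hx, hx0, -⟩, rfl⟩
      exact ⟨hx, hx0, hμ x hx hx0⟩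
    · rintro ⟨hx, hx0, h⟩
      rw [hμ x hx hx0, div_left_inj' hn'.ne'] at h
      have h2 : μ x = m := by exact_mod_cast h
      exact ⟨⟨hx, hx0, h2 ▸ hm⟩, h2⟩
  rw [← Finset.sum_fiberwise_of_maps_to (s := s) (t := Finset.Icc (-(k : ℤ)) (n * N)) (g := μ)]
  · refine Finset.sum_congr rfl fun m hm ↦ ?_
    rw [hc m (Finset.mem_Icc.1 hm).2, Finset.sum_congr rfl (g := fun _ ↦ g m), Finset.sum_const,
      nsmul_eq_mul, mul_comm]
    intro x hx
    rw [(Finset.mem_filter.1 hx).2]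
  · intro x hx
    have hx' := (hs x).1 hx
    refine Finset.mem_Icc.2 ⟨?_, hx'.2.2⟩
    by_contra! h
    have h1 := hk _ h
    rw [hc _ hx'.2.2, Finset.card_eq_zero] at h1
    exact Finset.notMem_empty x (h1 ▸ Finset.mem_filter.2 ⟨hx, rfl⟩)

/-- After the shift by `e`, the terms at the lower end involve `h` below -k and vanish. -/
theorem sum_Icc_mul_sub {h : ℤ → ℝ} {k : ℕ} (h0 : ∀ m < -(k : ℤ), h m = 0) (e : ℕ) (M : ℤ)
    (g : ℤ → ℝ) : ∑ m ∈ Finset.Icc (-(k : ℤ)) (M + e), g m * h (m - e) =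
      ∑ m ∈ Finset.Icc (-(k : ℤ)) M, g (m + e) * h m := by
  have h1 : ∑ m ∈ Finset.Icc (-(k : ℤ)) M, g (m + e) * h m =
      ∑ m ∈ Finset.Icc (-(k : ℤ) + e) (M + e), g m * h (m - e) := by
    rw [← Finset.image_add_right_Icc, Finset.sum_image (by simp)]
    simp
  rw [h1]
  symm
  refine Finset.sum_subset (fun m hm ↦ ?_) fun m hm hm' ↦ ?_
  · rw [Finset.mem_Icc] at hm ⊢
    omega
  · rw [Finset.mem_Icc] at hm hm'
    rw [h0 _ (by omega), mul_zero]

end ZFunction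

end DrinfeldLattice

/-! ### The formula for Z_Λ'(1) -/

namespace DrinfeldLattice

open Filter Topology

section ZDeriv

variable {F K : Type*} [Field F] [Field K] [Algebra F K] [IsGlobalFunctionField F K]
  {O : ValuationSubring K} [IsDiscreteValuationRing O]
  {Λ Λ' : Submodule (coeffRing F O) (CInf F O)} {r : ℕ} {a : coeffRing F O}

/-- For large radius the ball is `T` plus the ball of the same radius in aΛ, which is `a` times the
ball of radius R in Λ. -/
theorem IsLattice.eventually_ballCard (hΛ : IsLattice Λ r) [Finite F] [IsDiscreteSubspace (lsub Λ)]
    (ha : a ≠ 0) : ∀ᶠ R : ℝ in atTop,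
      Nat.card (ballSub (lsub Λ) ((Nat.card F : ℝ) ^ degA F O a * R)) =
        Nat.card F ^ (r * degA F O a) * Nat.card (ballSub (lsub Λ) R) := by
  have hq : (1 : ℝ) < Nat.card F := by exact_mod_cast one_lt_card_constants F K
  have := hΛ.isDiscreteSubspace_smulLat (a := a)
  obtain ⟨T, hTf, hd, hT, hTc⟩ := hΛ.exists_complement_smulLat ha
  have ht : Tendsto (fun R : ℝ ↦ (Nat.card F : ℝ) ^ degA F O a * R) atTop atTop :=
    tendsto_id.const_mul_atTop (by positivity)
  filter_upwards [ht.eventually (eventually_card_ballSub hd hT), eventually_ge_atTop 0] with R hR hR0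
  rw [hR, hTc]
  congr 1
  have h := mul_mem_ballSub_iff (Λ := lsub Λ) (Λ₁ := lsub (smulLat a Λ))
    (algebraMap_coeffRing_ne_zero ha) (mul_mem_smulLat_iff ha) hR0
  rw [norm_algebraMap_coeffRing ha] at h
  exact card_mul (algebraMap_coeffRing_ne_zero ha) h

/-- The value and derivative identities for Z_Λ, rewritten by balls. The subtracted 1 accounts for
the zero vector, which Z_Λ omits. -/
theorem IsLattice.sum_eq (hΛ : IsLattice Λ r) [Finite F] [IsDiscreteSubspace (lsub Λ)] (ha : a ≠ 0)
    {n : ℕ} {f : RatFunc ℚ} (hf : IsZFunction Λ n f) (hf1 : f.denom.eval 1 ≠ 0) :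
    ∀ᶠ N : ℕ in atTop,
      ((ballCard (lsub Λ) (N + degA F O a) : ℝ) - 1) -
          (Nat.card F : ℝ) ^ (r * degA F O a) * ((ballCard (lsub Λ) N : ℝ) - 1) =
        ratValOne f * (1 - (Nat.card F : ℝ) ^ (r * degA F O a)) ∧
      n * logProd (lsub Λ) (N + degA F O a) - (Nat.card F : ℝ) ^ (r * degA F O a) *
          (n * logProd (lsub Λ) N + degA F O a * n * ((ballCard (lsub Λ) N : ℝ) - 1)) =
        ratDerivOne f * (1 - (Nat.card F : ℝ) ^ (r * degA F O a)) -
          (Nat.card F : ℝ) ^ (r * degA F O a) * (degA F O a * n) * ratValOne f := by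
  have hn := hf.pos
  have hn' : (n : ℝ) ≠ 0 := by exact_mod_cast hn.ne'
  obtain ⟨M, hM⟩ := exists_zCount_eq_mul hΛ ha hn
  obtain ⟨k, hk⟩ := exists_zCount_eq_zero hΛ hn
  choose! μ hμ using hf.denominator
  set c := Nat.card F ^ (r * degA F O a) with hc
  have hc' : (Nat.card F : ℝ) ^ (r * degA F O a) = c := by rw [hc]; push_cast; rfl
  rw [hc']
  set d := degA F O a
  have hB : ∀ N : ℕ, ∑ m ∈ Finset.Icc (-(k : ℤ)) (n * N), (1 : ℝ) * zCount Λ n m =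
      (ballCard (lsub Λ) N : ℝ) - 1 := fun N ↦ by
    rw [sum_zCount_mul hn hμ hk N fun _ ↦ 1, Finset.sum_const, nsmul_one, ballCard,
      ← card_nzElems_add_one]
    push_cast
    ring
  have hS : ∀ N : ℕ, ∑ m ∈ Finset.Icc (-(k : ℤ)) (n * N), (m : ℝ) * zCount Λ n m =
      n * logProd (lsub Λ) N := fun N ↦ by
    rw [sum_zCount_mul hn hμ hk N fun m ↦ m, logProd_eq_sum, Finset.mul_sum]
    refine Finset.sum_congr rfl fun x hx ↦ ?_
    rw [mem_nzElems] at hx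
    rw [hμ x hx.1.1 hx.2]
    field_simp
  have hk' : ∀ m < -(k : ℤ), (zCount Λ n m : ℝ) = 0 := fun m hm ↦ by rw [hk m hm, Nat.cast_zero]
  filter_upwards [eventually_ge_atTop M.toNat] with N hN
  have hMN : M ≤ n * (N + d : ℕ) := by
    have h1 : M ≤ N := Int.toNat_le.1 hN
    have h2 : ((1 : ℕ) : ℤ) ≤ n := by exact_mod_cast hn
    push_cast at h2 ⊢
    nlinarith
  -- The window ends at log = N + d, so the unshifted terms fill the ball of radius q^(N+d) and the
  -- shifted ones that of radius q^N.
  obtain ⟨h1, h2⟩ := sum_eq_of_coeff_eq (h := fun m ↦ (zCount Λ n m : ℚ)) (k := k) (e := d * n)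
    (c := c) (M := n * (N + d : ℕ)) hf.coeff_eq hf1 (fun m hm ↦ by rw [hk m hm, Nat.cast_zero])
    fun m hm ↦ by rw [hM m (by omega)]; push_cast; rfl
  have h1' := congrArg (Rat.cast : ℚ → ℝ) h1
  have h2' := congrArg (Rat.cast : ℚ → ℝ) h2
  have hMe : (n * (N + d : ℕ) : ℤ) = n * N + (d * n : ℕ) := by push_cast; ring
  have hB' := sum_Icc_mul_sub hk' (d * n) (n * N) fun _ ↦ 1
  have hS' := sum_Icc_mul_sub hk' (d * n) (n * N) fun m ↦ m
  rw [← hMe] at hB' hS'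
  rw [hB] at hB'
  have hS2 : ∑ m ∈ Finset.Icc (-(k : ℤ)) (n * N),
      (((m + (d * n : ℕ) : ℤ) : ℝ)) * zCount Λ n m =
      n * logProd (lsub Λ) N + d * n * ((ballCard (lsub Λ) N : ℝ) - 1) := by
    rw [← hS, ← hB, Finset.mul_sum, ← Finset.sum_add_distrib]
    refine Finset.sum_congr rfl fun m _ ↦ ?_
    push_cast
    ring
  rw [hS2] at hS'
  rw [← hS', ← hB', ← hB, ← hS, Finset.mul_sum, Finset.mul_sum, ← Finset.sum_sub_distrib,
    ← Finset.sum_sub_distrib]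
  push_cast at h1' h2'
  constructor
  · rw [← h1']
    refine Finset.sum_congr rfl fun m _ ↦ ?_
    push_cast
    ring
  · rw [← h2']
    refine Finset.sum_congr rfl fun m _ ↦ ?_
    push_cast
    ring

/-- The key formula for `Z_Λ'(1)`. -/
theorem IsLattice.zDeriv_formula (hΛ : IsLattice Λ r) (hr : 1 ≤ r) [Finite F]
    [IsDiscreteSubspace (lsub Λ)] (ha : a ≠ 0) {z : ℚ} (hz : IsZDerivAtOne Λ z) :
    ∀ᶠ N : ℕ in atTop, ((Nat.card F : ℝ) ^ (r * degA F O a) - 1) * z =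
      (Nat.card F : ℝ) ^ (r * degA F O a) * logProd (lsub Λ) N -
        logProd (lsub Λ) (N + degA F O a) +
        degA F O a * (Nat.card F : ℝ) ^ (r * degA F O a) * ballCard (lsub Λ) N := by
  have hq : (1 : ℝ) < Nat.card F := by exact_mod_cast one_lt_card_constants F K
  obtain ⟨n, f, hf, hf1, rfl⟩ := hz
  rcases Nat.eq_zero_or_pos (degA F O a) with hd | hd
  · simp [hd]
  have hn : (n : ℝ) ≠ 0 := by exact_mod_cast hf.pos.ne'
  have hc : (Nat.card F : ℝ) ^ (r * degA F O a) - 1 ≠ 0 :=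
    sub_ne_zero.2 (one_lt_pow₀ hq (Nat.mul_pos hr hd).ne').ne'
  have hev := (tendsto_card_pow F K).eventually (hΛ.eventually_ballCard ha)
  filter_upwards [hΛ.sum_eq ha hf hf1, hev] with N hN hB
  obtain ⟨h1, h2⟩ := hN
  rw [← pow_add, add_comm] at hB
  change ballCard (lsub Λ) (N + degA F O a) = _ * ballCard (lsub Λ) N at hB
  rw [hB] at h1
  push_cast at h1
  -- Z_Λ(1) = -1: ball sizes scale exactly by q^(rd), so only the zero vector's contribution is
  -- left.
  have h3 : (ratValOne f : ℝ) = -1 := by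
    apply mul_right_cancel₀ hc
    linear_combination h1
  rw [h3] at h2
  change _ * (((ratDerivOne f / n : ℚ)) : ℝ) = _
  push_cast
  field_simp
  linear_combination h2

theorem IsLattice.existsUnique_zDeriv (hΛ : IsLattice Λ r) (hr : 1 ≤ r) :
    ∃! z, IsZDerivAtOne Λ z := by
  have := finite_constants_of F K
  have := hΛ.isDiscreteSubspace
  have hq : (1 : ℝ) < Nat.card F := by exact_mod_cast one_lt_card_constants F K
  obtain ⟨a, ha, hd⟩ := exists_degA_pos F O
  have hc : (1 : ℝ) < (Nat.card F : ℝ) ^ (r * degA F O a) := one_lt_pow₀ hq (Nat.mul_pos hr hd).ne'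
  refine existsUnique_of_exists_of_unique ?_ fun z z' hz hz' ↦ ?_
  · obtain ⟨n, hn, hden⟩ := exists_common_denominator hΛ
    obtain ⟨M, hM⟩ := exists_zCount_eq_mul hΛ ha hn
    obtain ⟨k, hk⟩ := exists_zCount_eq_zero hΛ hn
    obtain ⟨f, hf, hf1⟩ := exists_ratFunc_coeff_eq (h := fun m ↦ (zCount Λ n m : ℚ)) (k := k)
      (e := degA F O a * n) (c := Nat.card F ^ (r * degA F O a)) (M := M)
      (fun m hm ↦ by rw [hk m hm, Nat.cast_zero])
      (fun m hm ↦ by rw [hM m (by omega)]; push_cast; rfl) (by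
        intro h
        have h2 := congrArg (Rat.cast : ℚ → ℝ) h
        push_cast at h2
        exact hc.ne' h2)
    exact ⟨_, n, f, ⟨hn, hden, hf⟩, hf1, rfl⟩
  -- For `a` of positive degree the formula determines Z_Λ'(1), whatever denominator n is chosen.
  · obtain ⟨N, h1, h2⟩ := ((hΛ.zDeriv_formula hr ha hz).and (hΛ.zDeriv_formula hr ha hz')).exists
    have h3 := mul_left_cancel₀ (sub_ne_zero.2 hc.ne') (h1.trans h2.symm)
    exact_mod_cast h3

theorem IsLattice.isZDerivAtOne_zDeriv (hΛ : IsLattice Λ r) (hr : 1 ≤ r) :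
    IsZDerivAtOne Λ (zDeriv Λ) := by
  have h := hΛ.existsUnique_zDeriv hr
  rw [zDeriv, dif_pos h]
  exact h.exists.choose_spec

end ZDeriv

end DrinfeldLattice

/-! ### Discriminants of lattice pairs and of Drinfeld polynomials -/

namespace DrinfeldLattice

open Filter Topology

section Discriminants

variable {F K : Type*} [Field F] [Field K] [Algebra F K] [IsGlobalFunctionField F K]
  {O : ValuationSubring K} [IsDiscreteValuationRing O]
  {Λ Λ' : Submodule (coeffRing F O) (CInf F O)} {r : ℕ} {a : coeffRing F O}

variable (F O) in
theorem exists_norm_lt_one : ∃ y : CInf F O, y ≠ 0 ∧ ‖y‖ < 1 := by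
  obtain ⟨π, hπ⟩ := IsDiscreteValuationRing.exists_irreducible O
  refine ⟨algebraMap K (CInf F O) π, ?_, ?_⟩
  · rw [Ne, _root_.map_eq_zero]
    exact fun h ↦ hπ.ne_zero (Subtype.ext h)
  · rw [norm_algebraMap_CInf, absInf_uniformizer F O hπ]
    exact inv_lt_one_of_one_lt₀ (one_lt_qInf' F O)

theorem logb_norm_pow_div [Finite F] {x y : CInf F O} (hx : x ≠ 0) (hy : y ≠ 0) (m : ℕ) :
    Real.logb (Nat.card F) ‖x ^ m / y‖ =
      m * Real.logb (Nat.card F) ‖x‖ - Real.logb (Nat.card F) ‖y‖ := by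
  rw [norm_div, norm_pow, Real.logb_div (pow_ne_zero _ (norm_ne_zero_iff.2 hx))
    (norm_ne_zero_iff.2 hy), Real.logb_pow]

theorem norm_eq_rpow_of_logb {x : CInf F O} (hx : x ≠ 0) {k : ℝ}
    (h : Real.logb (Nat.card F) ‖x‖ = k) : ‖x‖ = (Nat.card F : ℝ) ^ k :=
  ne_zero_and_logq_eq_iff.1 ⟨hx, h⟩

theorem existsUnique_isNormalizedIsogeny [Finite F] [IsDiscreteSubspace (lsub Λ)]
    [IsDiscreteSubspace (lsub Λ')] {T : Submodule F (CInf F O)} [Finite T]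
    (hd : Disjoint (lsub Λ) T) (hT : lsub Λ ⊔ T = lsub Λ') (hTc : Nat.card T = latticeIndex Λ Λ') :
    IsNormalizedIsogeny Λ Λ' (isogPoly (lsub Λ) T) ∧ ∃! φ, IsNormalizedIsogeny Λ Λ' φ := by
  have h : IsNormalizedIsogeny Λ Λ' (isogPoly (lsub Λ) T) :=
    ⟨fun i hi ↦ isogPoly_mem_qLinear hd i (mem_support_iff.1 hi), coeff_one_isogPoly hd,
      (natDegree_isogPoly hd).trans hTc, fun z ↦ by
        rw [expFn_eq_latExp, expFn_eq_latExp, latExp_eq_eval_isogPoly hd hT]⟩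
  obtain ⟨y, hy, hy1⟩ := exists_norm_lt_one F O
  exact ⟨h, _, h, fun φ hφ ↦ eq_of_eval_latExp_eq (lsub Λ) hy hy1 fun z ↦
    (hφ.comp z).symm.trans (h.comp z)⟩

theorem pairDiscr_eq [Finite F] [IsDiscreteSubspace (lsub Λ)]
    [IsDiscreteSubspace (lsub Λ')] {T : Submodule F (CInf F O)} [Finite T]
    (hd : Disjoint (lsub Λ) T) (hT : lsub Λ ⊔ T = lsub Λ') (hTc : Nat.card T = latticeIndex Λ Λ') :
    pairDiscr Λ Λ' = (isogPoly (lsub Λ) T).leadingCoeff := by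
  obtain ⟨h, hu⟩ := existsUnique_isNormalizedIsogeny hd hT hTc
  rw [pairDiscr, dif_pos hu, hu.unique hu.exists.choose_spec h]

/-- With i the index, l_N = i L_Λ(N) - L_Λ'(N) tends to the logarithm l sought. The formulas for
Z_Λ'(1) and Z_Λ''(1), the derivatives for the two lattices, control only q^(rd) l_N - l_(N+d), but
this already tends to (q^(rd) - 1) l. -/
theorem IsLattice.norm_pairDiscr (hΛ : IsLattice Λ r) (hΛ' : IsLattice Λ' r) (hr : 1 ≤ r)
    (hle : Λ ≤ Λ') : ‖pairDiscr Λ Λ'‖ = (Nat.card F : ℝ) ^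
      ((latticeIndex Λ Λ' * zDeriv Λ - zDeriv Λ' : ℚ) : ℝ) := by
  have := finite_constants_of F K
  have := hΛ.isDiscreteSubspace
  have := hΛ'.isDiscreteSubspace
  have hq : (1 : ℝ) < Nat.card F := by exact_mod_cast one_lt_card_constants F K
  obtain ⟨T, hTf, hd, hT, hTc⟩ := exists_lattice_complement hle (hΛ.latticeIndex_ne_zero hΛ' hle)
  rw [pairDiscr_eq hd hT hTc]
  have h0 : (isogPoly (lsub Λ) T).leadingCoeff ≠ 0 := by
    rw [leadingCoeff_isogPoly]; exact isogConst_ne_zero hd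
  apply norm_eq_rpow_of_logb h0
  set l := Real.logb (Nat.card F) ‖(isogPoly (lsub Λ) T).leadingCoeff‖
  have hlim : Tendsto (fun N : ℕ ↦ (latticeIndex Λ Λ' : ℝ) * logProd (lsub Λ) N -
      logProd (lsub Λ') N) atTop (𝓝 l) := by
    have h1 := ((tendsto_nzProd_div hd hT).comp (tendsto_card_pow F K)).norm
    refine ((Real.continuousAt_logb (norm_ne_zero_iff.2 h0)).tendsto.comp h1).congr fun N ↦ ?_
    rw [Function.comp_apply, Function.comp_apply,
      logb_norm_pow_div (nzProd_ne_zero _) (nzProd_ne_zero _), hTc]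
    rfl
  obtain ⟨a, ha, hdeg⟩ := exists_degA_pos F O
  have hc : (1 : ℝ) < (Nat.card F : ℝ) ^ (r * degA F O a) :=
    one_lt_pow₀ hq (Nat.mul_pos hr hdeg).ne'
  have hlim2 := (hlim.const_mul ((Nat.card F : ℝ) ^ (r * degA F O a))).sub
    ((tendsto_add_atTop_iff_nat (degA F O a)).2 hlim)
  have hlim3 : Tendsto (fun _ : ℕ ↦ ((Nat.card F : ℝ) ^ (r * degA F O a) - 1) *
      (latticeIndex Λ Λ' * (zDeriv Λ : ℝ) - zDeriv Λ')) atTop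
      (𝓝 ((Nat.card F : ℝ) ^ (r * degA F O a) * l - l)) := by
    refine hlim2.congr' ?_
    -- The terms with ball sizes cancel because balls of Λ' have i times as many elements as those
    -- of Λ.
    filter_upwards [hΛ.zDeriv_formula hr ha (hΛ.isZDerivAtOne_zDeriv hr),
      hΛ'.zDeriv_formula hr ha (hΛ'.isZDerivAtOne_zDeriv hr),
      (tendsto_card_pow F K).eventually (eventually_card_ballSub hd hT)] with N h1 h2 h3
    change ballCard (lsub Λ') N = _ * ballCard (lsub Λ) N at h3
    rw [h3, hTc] at h2
    push_cast at h2
    linear_combination -(latticeIndex Λ Λ' : ℝ) * h1 + h2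
  have h4 := tendsto_nhds_unique hlim3 tendsto_const_nhds
  have h5 : ((Nat.card F : ℝ) ^ (r * degA F O a) - 1) * l =
      ((Nat.card F : ℝ) ^ (r * degA F O a) - 1) *
        (latticeIndex Λ Λ' * (zDeriv Λ : ℝ) - zDeriv Λ') := by linarith
  rw [mul_left_cancel₀ (sub_ne_zero.2 hc.ne') h5]
  push_cast
  rfl

/-- If P is the isogeny of aΛ ⊆ Λ, then e^Λ(az) = P(e^(aΛ)(az)) = P(a e^Λ(z)). -/
theorem existsUnique_isDrinfeldPoly [Finite F] [IsDiscreteSubspace (lsub Λ)]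
    [IsDiscreteSubspace (lsub (smulLat a Λ))] (ha : a ≠ 0) {T : Submodule F (CInf F O)} [Finite T]
    (hd : Disjoint (lsub (smulLat a Λ)) T) (hT : lsub (smulLat a Λ) ⊔ T = lsub Λ)
    (hTc : Nat.card T = Nat.card F ^ (r * degA F O a)) :
    IsDrinfeldPoly Λ r a ((isogPoly (lsub (smulLat a Λ)) T).comp
      (Polynomial.C (algebraMap K (CInf F O) a) * X)) ∧ ∃! φ, IsDrinfeldPoly Λ r a φ := by
  have h : IsDrinfeldPoly Λ r a ((isogPoly (lsub (smulLat a Λ)) T).comp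
      (Polynomial.C (algebraMap K (CInf F O) a) * X)) := by
    refine ⟨fun i hi ↦ ?_, ?_, fun z ↦ ?_⟩
    · rw [mem_support_iff, comp_C_mul_X_coeff] at hi
      have hi' := left_ne_zero_of_mul hi
      obtain ⟨j, rfl⟩ := isogPoly_mem_qLinear hd i hi'
      refine ⟨j, ?_, rfl⟩
      have h1 := le_natDegree_of_ne_zero hi'
      rw [natDegree_isogPoly hd, hTc] at h1
      exact (Nat.pow_le_pow_iff_right (one_lt_card_constants F K)).1 h1
    · rw [comp_C_mul_X_coeff, coeff_one_isogPoly hd, one_mul, pow_one]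
    · rw [expFn_eq_latExp, expFn_eq_latExp, latExp_eq_eval_isogPoly hd hT,
        latExp_mul (algebraMap_coeffRing_ne_zero ha) (mul_mem_smulLat_iff ha), eval_comp, eval_mul,
        eval_C, eval_X]
  obtain ⟨y, hy, hy1⟩ := exists_norm_lt_one F O
  exact ⟨h, _, h, fun φ hφ ↦ eq_of_eval_latExp_eq (lsub Λ) hy hy1 fun z ↦
    (hφ.comp z).symm.trans (h.comp z)⟩

theorem drinfeldDiscr_eq [Finite F] [IsDiscreteSubspace (lsub Λ)]
    [IsDiscreteSubspace (lsub (smulLat a Λ))] (ha : a ≠ 0) {T : Submodule F (CInf F O)} [Finite T]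
    (hd : Disjoint (lsub (smulLat a Λ)) T) (hT : lsub (smulLat a Λ) ⊔ T = lsub Λ)
    (hTc : Nat.card T = Nat.card F ^ (r * degA F O a)) :
    drinfeldDiscr Λ r a = (isogPoly (lsub (smulLat a Λ)) T).leadingCoeff *
      algebraMap K (CInf F O) a ^ Nat.card F ^ (r * degA F O a) := by
  obtain ⟨h, hu⟩ := existsUnique_isDrinfeldPoly ha hd hT hTc
  rw [drinfeldDiscr, dif_pos hu, hu.unique hu.exists.choose_spec h, comp_C_mul_X_coeff,
    leadingCoeff, natDegree_isogPoly hd, hTc]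

theorem IsLattice.drinfeldDiscr_ne_zero (hΛ : IsLattice Λ r) (ha : a ≠ 0) :
    drinfeldDiscr Λ r a ≠ 0 := by
  have := finite_constants_of F K
  have := hΛ.isDiscreteSubspace
  have := hΛ.isDiscreteSubspace_smulLat (a := a)
  obtain ⟨T, hTf, hd, hT, hTc⟩ := hΛ.exists_complement_smulLat ha
  rw [drinfeldDiscr_eq ha hd hT hTc, leadingCoeff_isogPoly]
  exact mul_ne_zero (isogConst_ne_zero hd) (pow_ne_zero _ (algebraMap_coeffRing_ne_zero ha))

/-- The limit for the pair aΛ ⊆ Λ at radius |a|R, where the ball of aΛ is `a` times Λ_R. The factor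
a^(q^(rd)) from substituting aX supplies the extra `a` in `nzProd_mul`. -/
theorem IsLattice.tendsto_drinfeldDiscr (hΛ : IsLattice Λ r) [Finite F]
    [IsDiscreteSubspace (lsub Λ)] (ha : a ≠ 0) :
    Tendsto (fun R : ℝ ↦ (algebraMap K (CInf F O) a ^ Nat.card (ballSub (lsub Λ) R) *
      nzProd (ballSub (lsub Λ) R)) ^ Nat.card F ^ (r * degA F O a) /
        nzProd (ballSub (lsub Λ) ((Nat.card F : ℝ) ^ degA F O a * R))) atTop
      (𝓝 (drinfeldDiscr Λ r a)) := by
  have hq : (1 : ℝ) < Nat.card F := by exact_mod_cast one_lt_card_constants F K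
  have := hΛ.isDiscreteSubspace_smulLat (a := a)
  obtain ⟨T, hTf, hd, hT, hTc⟩ := hΛ.exists_complement_smulLat ha
  rw [drinfeldDiscr_eq ha hd hT hTc]
  have ht : Tendsto (fun R : ℝ ↦ (Nat.card F : ℝ) ^ degA F O a * R) atTop atTop :=
    tendsto_id.const_mul_atTop (by positivity)
  refine (((tendsto_nzProd_div hd hT).comp ht).mul_const _).congr' ?_
  filter_upwards [eventually_ge_atTop 0] with R hR
  have h := mul_mem_ballSub_iff (Λ := lsub Λ) (Λ₁ := lsub (smulLat a Λ))
    (algebraMap_coeffRing_ne_zero ha) (mul_mem_smulLat_iff ha) hR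
  rw [norm_algebraMap_coeffRing ha] at h
  rw [← nzProd_mul (algebraMap_coeffRing_ne_zero ha) h, hTc, Function.comp_apply, mul_pow,
    div_mul_eq_mul_div, mul_comm]

/-- The logarithms of the approximants at R = q^N are the right side of `zDeriv_formula`, so they
are constant for large N. -/
theorem IsLattice.norm_drinfeldDiscr (hΛ : IsLattice Λ r) (hr : 1 ≤ r) (ha : a ≠ 0) :
    ‖drinfeldDiscr Λ r a‖ = (Nat.card F : ℝ) ^
        ((((Nat.card F : ℚ) ^ (r * degA F O a) - 1) * zDeriv Λ : ℚ) : ℝ) := by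
  have := finite_constants_of F K
  have := hΛ.isDiscreteSubspace
  have hq : (1 : ℝ) < Nat.card F := by exact_mod_cast one_lt_card_constants F K
  have h0 := hΛ.drinfeldDiscr_ne_zero ha
  have hα := algebraMap_coeffRing_ne_zero ha
  apply norm_eq_rpow_of_logb h0
  have h1 := ((hΛ.tendsto_drinfeldDiscr ha).comp (tendsto_card_pow F K)).norm
  have h2 := (Real.continuousAt_logb (b := Nat.card F) (norm_ne_zero_iff.2 h0)).tendsto.comp h1
  refine tendsto_nhds_unique h2 (tendsto_const_nhds.congr' ?_)
  filter_upwards [hΛ.zDeriv_formula hr ha (hΛ.isZDerivAtOne_zDeriv hr)] with N hN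
  rw [Function.comp_apply, Function.comp_apply, logb_norm_pow_div
    (mul_ne_zero (pow_ne_zero _ hα) (nzProd_ne_zero _)) (nzProd_ne_zero _), norm_mul, norm_pow,
    Real.logb_mul (pow_ne_zero _ (norm_ne_zero_iff.2 hα)) (norm_ne_zero_iff.2 (nzProd_ne_zero _)),
    Real.logb_pow, norm_algebraMap_coeffRing ha, Real.logb_pow, Real.logb_self_eq_one hq,
    ← pow_add, add_comm (degA F O a)]
  change _ = _ * (_ * _ + logProd (lsub Λ) N) - logProd (lsub Λ) (N + degA F O a)
  push_cast
  rw [hN, ballCard]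
  ring

end Discriminants

end DrinfeldLattice

/-! ### Teichmüller representatives and uniqueness of the sign -/

namespace DrinfeldLattice

open Filter Topology

section Sgn

variable {F K : Type*} [Field F] [Field K] [Algebra F K] [IsGlobalFunctionField F K]
  {O : ValuationSubring K} [IsDiscreteValuationRing O] {a : coeffRing F O} {π : O}

variable (F O) in
/-- `q_∞` is a power of `q`. -/
theorem exists_qInf_eq_pow : ∃ j : ℕ, qInf O = Nat.card F ^ j := by
  have := finite_constants_of F K
  have := finite_residueField F O
  let _ : Algebra F O := ((algebraMap F K).codRestrict O.toSubring (constants_mem F O)).toAlgebra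
  exact ⟨_, Module.natCard_eq_pow_finrank (K := F) (V := ResidueField O)⟩

theorem sub_pow_qInf_pow (x y : CInf F O) (k : ℕ) :
    (x - y) ^ qInf O ^ k = x ^ qInf O ^ k - y ^ qInf O ^ k := by
  have := finite_constants_of F K
  obtain ⟨j, hj⟩ := exists_qInf_eq_pow F O
  rw [hj, ← pow_mul]
  exact sub_pow_card_pow F x y _

theorem two_le_qInf (F : Type*) {K : Type*} [Field F] [Field K] [Algebra F K]
    [IsGlobalFunctionField F K] (O : ValuationSubring K) [IsDiscreteValuationRing O] : 2 ≤ qInf O := by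
  have := one_lt_qInf' F O
  exact_mod_cast this

/-- The Teichmüller representative of a unit. -/
theorem exists_teichmuller (u : Oˣ) : ∃ ζ : CInf F O, ζ ^ (qInf O - 1) = 1 ∧
    ‖algebraMap K (CInf F O) ((u : O) : K) - ζ‖ < 1 := by
  have := finite_residueField F O
  have hp := two_le_qInf F O
  set x := algebraMap K (CInf F O) ((u : O) : K) with hx
  have hx1 : ‖x‖ = 1 := by rw [hx, norm_algebraMap_CInf, absInf_coe_unit]
  set ρ := ‖x ^ qInf O - x‖ with hρ
  have hρ1 : ρ < 1 := by
    rw [hρ, hx, ← map_pow, ← map_sub, norm_algebraMap_CInf, absInf_lt_one_iff,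
      ValuationSubring.mem_nonunits_iff_exists_mem_maximalIdeal]
    refine ⟨((u : O) ^ qInf O - u : O).2, ?_⟩
    change ((u : O) ^ qInf O - u : O) ∈ maximalIdeal O
    have := Fintype.ofFinite (ResidueField O)
    rw [← residue_eq_zero_iff, map_sub, map_pow, qInf, Nat.card_eq_fintype_card,
      FiniteField.pow_card, sub_self]
  -- The difference is (x^Q - x)^(Q^k) with Q = q_∞ a power of q, and Q^k ≥ k + 1.
  have hstep : ∀ k : ℕ, ‖x ^ qInf O ^ (k + 1) - x ^ qInf O ^ k‖ ≤ ρ * ρ ^ k := by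
    intro k
    rw [pow_succ', pow_mul, ← sub_pow_qInf_pow, norm_pow, ← pow_succ']
    exact pow_le_pow_of_le_one (norm_nonneg _) hρ1.le (Nat.lt_pow_self hp)
  have hc : CauchySeq fun k : ℕ ↦ x ^ qInf O ^ k := by
    refine cauchySeq_of_le_geometric ρ ρ hρ1 fun k ↦ ?_
    rw [dist_comm, dist_eq_norm]
    exact hstep k
  obtain ⟨ζ, hζ⟩ := cauchySeq_tendsto_of_complete hc
  -- By the ultrametric inequality the iterates stay within ρ < 1 of `x`, and so does their limit.
  have hdist : ∀ k : ℕ, ‖x ^ qInf O ^ k - x‖ ≤ ρ := by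
    intro k
    induction k with
    | zero => simp [hρ]
    | succ k ih =>
      rw [← sub_add_sub_cancel _ (x ^ qInf O ^ k)]
      refine (IsUltrametricDist.norm_add_le_max _ _).trans (max_le ((hstep k).trans ?_) ih)
      exact mul_le_of_le_one_right (norm_nonneg _) (pow_le_one₀ (norm_nonneg _) hρ1.le)
  have hζx : ‖x - ζ‖ < 1 := by
    refine lt_of_le_of_lt ?_ hρ1
    rw [norm_sub_rev]
    exact le_of_tendsto (hζ.sub_const x).norm (Eventually.of_forall hdist)
  have hζp : ζ ^ qInf O = ζ := by
    refine tendsto_nhds_unique ((hζ.pow (qInf O)).congr fun k ↦ ?_)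
      ((tendsto_add_atTop_iff_nat 1).2 hζ)
    rw [← pow_mul, ← pow_succ]
  have hζ0 : ζ ≠ 0 := by
    rintro rfl
    rw [sub_zero, hx1] at hζx
    exact lt_irrefl _ hζx
  refine ⟨ζ, ?_, hζx⟩
  apply mul_right_cancel₀ hζ0
  rw [← pow_succ, Nat.sub_add_cancel (by omega), hζp, one_mul]

theorem norm_eq_one_of_pow_eq_one {E : Type*} [NormedField E] {x : E} {n : ℕ} (hn : n ≠ 0)
    (h : x ^ n = 1) : ‖x‖ = 1 := by
  have h1 := congrArg norm h
  rw [norm_pow, norm_one] at h1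
  exact (pow_eq_one_iff_of_nonneg (norm_nonneg _) hn).1 h1

theorem IsSgn.norm_eq_one {ζ : CInf F O} (h : IsSgn π a ζ) : ‖ζ‖ = 1 := by
  have hp := two_le_qInf F O
  exact norm_eq_one_of_pow_eq_one (by omega) h.1

/-- |a| fixes the exponent m, so two signs differ by δ with |δ| < 1. Frobenius additivity gives
δ^(q_∞) = δ, which forces δ = 0. -/
theorem IsSgn.unique (hπ : Irreducible π) {ζ ζ' : CInf F O} (h : IsSgn π a ζ)
    (h' : IsSgn π a ζ') : ζ = ζ' := by
  have hp := two_le_qInf F O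
  have hq := one_lt_qInf' F O
  have key : ∀ {ζ : CInf F O} {m : ℤ}, ‖ζ‖ = 1 →
      ‖algebraMap K (CInf F O) ((a : K) * (π : K) ^ m) - ζ‖ < 1 →
      absInf F O (a : K) = (qInf O : ℝ) ^ m := by
    intro ζ m hζ hm
    have h1 : ‖algebraMap K (CInf F O) ((a : K) * (π : K) ^ m)‖ = 1 := by
      by_contra hne
      have h2 := IsUltrametricDist.norm_add_eq_max_of_norm_ne_norm
        (x := algebraMap K (CInf F O) ((a : K) * (π : K) ^ m)) (y := -ζ)
        (by rw [norm_neg, hζ]; exact hne)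
      rw [← sub_eq_add_neg, norm_neg, hζ] at h2
      have := le_max_right ‖algebraMap K (CInf F O) ((a : K) * (π : K) ^ m)‖ 1
      linarith
    rw [norm_algebraMap_CInf, map_mul, map_zpow₀, absInf_uniformizer F O hπ, inv_zpow] at h1
    exact (eq_inv_of_mul_eq_one_left h1).trans (inv_inv _)
  obtain ⟨m, hm⟩ := h.2
  obtain ⟨m', hm'⟩ := h'.2
  have hmm : m = m' := zpow_right_injective₀ (by linarith) hq.ne'
    ((key h.norm_eq_one hm).symm.trans (key h'.norm_eq_one hm'))
  subst hmm
  have hlt : ‖ζ - ζ'‖ < 1 := by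
    have h1 : ζ - ζ' = (algebraMap K (CInf F O) ((a : K) * (π : K) ^ m) - ζ') +
        -(algebraMap K (CInf F O) ((a : K) * (π : K) ^ m) - ζ) := by ring
    rw [h1]
    refine (IsUltrametricDist.norm_add_le_max _ _).trans_lt (max_lt hm' ?_)
    rwa [norm_neg]
  have hfix : ∀ {ζ : CInf F O}, ζ ^ (qInf O - 1) = 1 → ζ ^ qInf O = ζ := by
    intro ζ hζ
    conv_lhs => rw [← Nat.sub_add_cancel (by omega : 1 ≤ qInf O), pow_succ, hζ, one_mul]
  have h1 := sub_pow_qInf_pow ζ ζ' 1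
  rw [pow_one, hfix h.1, hfix h'.1] at h1
  by_contra hne
  have h2 := congrArg norm h1
  rw [norm_pow] at h2
  have h3 := pow_lt_self_of_lt_one₀ (norm_pos_iff.2 (sub_ne_zero.2 hne)) hlt
    (by omega : 1 < qInf O)
  linarith

end Sgn

/-! ### Growth of balls under scaling by q_∞ -/

section CanonicalDiscriminant

variable {F K : Type*} [Field F] [Field K] [Algebra F K] [IsGlobalFunctionField F K]
  {O : ValuationSubring K} [IsDiscreteValuationRing O]
  {Λ : Submodule (coeffRing F O) (CInf F O)} {r : ℕ} {a : coeffRing F O} {π : O}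

theorem exists_card_pow_degA_eq (ha : a ≠ 0) : ∃ m : ℕ, Nat.card F ^ degA F O a = qInf O ^ m := by
  have hQ := one_lt_qInf' F O
  have hq : (1 : ℝ) < Nat.card F := by exact_mod_cast one_lt_card_constants F K
  obtain ⟨j, hj⟩ := exists_absInf_eq (F := F) (O := O) (x := (a : K)) (fun h ↦ ha (Subtype.ext h))
  rw [absInf_eq_pow_degA ha] at hj
  have hj0 : 0 ≤ j := by
    by_contra! h
    have h1 := zpow_lt_one_of_neg₀ hQ h
    have h2 := one_le_pow₀ hq.le (n := degA F O a)
    linarith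
  lift j to ℕ using hj0
  refine ⟨j, ?_⟩
  rw [zpow_natCast] at hj
  exact_mod_cast hj

variable (F) in
/-- A uniformizer is the quotient of two elements of `A`. -/
theorem exists_uniformizer_mul_eq (hπ : Irreducible π) : ∃ a b : coeffRing F O, ∃ m : ℕ,
    a ≠ 0 ∧ b ≠ 0 ∧ algebraMap K (CInf F O) π * algebraMap K (CInf F O) b =
      algebraMap K (CInf F O) a ∧
    Nat.card F ^ degA F O a = qInf O ^ m ∧ Nat.card F ^ degA F O b = qInf O ^ (m + 1) := by
  have hQ := one_lt_qInf' F O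
  obtain ⟨a, b, hb, h⟩ := exists_div_eq (F := F) (O := O) (π : K)
  have hb' : (b : K) ≠ 0 := fun h ↦ hb (Subtype.ext h)
  rw [eq_div_iff hb'] at h
  have ha : a ≠ 0 := by
    rintro rfl
    refine mul_ne_zero (fun h ↦ hπ.ne_zero (Subtype.ext h)) hb' h
  obtain ⟨m, hm⟩ := exists_card_pow_degA_eq ha
  refine ⟨a, b, m, ha, hb, by rw [← map_mul, h], hm, ?_⟩
  have h1 := congrArg (absInf F O) h
  rw [map_mul, absInf_uniformizer F O hπ, absInf_eq_pow_degA ha, absInf_eq_pow_degA hb,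
    inv_mul_eq_iff_eq_mul₀ (by linarith)] at h1
  have h2 : Nat.card F ^ degA F O b = qInf O * Nat.card F ^ degA F O a := by exact_mod_cast h1
  rw [h2, hm, pow_succ']

theorem card_pow_mul_degA {m : ℕ} (hm : Nat.card F ^ degA F O a = qInf O ^ m) :
    Nat.card F ^ (r * degA F O a) = (qInf O ^ r) ^ m := by
  rw [mul_comm, pow_mul, hm, pow_right_comm]

/-- The geometric sum shows that the division is exact, and that passing from m to m + 1 replaces
the exponent E by E q_∞^r + 1. -/
theorem discrExponent_eq_sum (hr : 1 ≤ r) {m : ℕ} (hm : Nat.card F ^ degA F O a = qInf O ^ m) :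
    discrExponent r a = ∑ i ∈ Finset.range m, (qInf O ^ r) ^ i := by
  rw [discrExponent, card_pow_mul_degA hm, Nat.geomSum_eq]
  exact (two_le_qInf F O).trans (Nat.le_self_pow (by omega) _)

theorem tendsto_qInf_mul (F : Type*) {K : Type*} [Field F] [Field K] [Algebra F K]
    [IsGlobalFunctionField F K] (O : ValuationSubring K) [IsDiscreteValuationRing O] (m : ℕ) :
    Tendsto (fun R : ℝ ↦ (qInf O : ℝ) ^ m * R) atTop atTop :=
  tendsto_id.const_mul_atTop (pow_pos (by linarith [one_lt_qInf' F O]) m)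

/-- A property of `q_∞ ^ m * R` for large `R` is a property of `R` for large `R`. -/
theorem eventually_of_eventually_qInf_mul {p : ℝ → Prop} (m : ℕ)
    (h : ∀ᶠ R : ℝ in atTop, p ((qInf O : ℝ) ^ m * R)) (F : Type*) [Field F] [Algebra F K]
    [IsGlobalFunctionField F K] : ∀ᶠ R : ℝ in atTop, p R := by
  have hQ : (0 : ℝ) < (qInf O : ℝ) ^ m := pow_pos (by linarith [one_lt_qInf' F O]) m
  have ht : Tendsto (fun R : ℝ ↦ ((qInf O : ℝ) ^ m)⁻¹ * R) atTop atTop :=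
    tendsto_id.const_mul_atTop (inv_pos.2 hQ)
  filter_upwards [ht.eventually h] with R hR
  rwa [mul_inv_cancel_left₀ hQ.ne'] at hR

variable [Finite F] [IsDiscreteSubspace (lsub Λ)]

theorem IsLattice.eventually_card_of_degA (hΛ : IsLattice Λ r) (ha : a ≠ 0) {m : ℕ}
    (hm : Nat.card F ^ degA F O a = qInf O ^ m) : ∀ᶠ R : ℝ in atTop,
      Nat.card (ballSub (lsub Λ) ((qInf O : ℝ) ^ m * R)) =
        (qInf O ^ r) ^ m * Nat.card (ballSub (lsub Λ) R) := by
  have hm' : (Nat.card F : ℝ) ^ degA F O a = (qInf O : ℝ) ^ m := by exact_mod_cast hm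
  filter_upwards [hΛ.eventually_ballCard ha] with R hR
  rwa [hm', card_pow_mul_degA hm] at hR

/-- `A` need not contain an element of absolute value q_∞, so the scalings by q_∞^m and q_∞^(m+1),
both realized in `A`, are compared. -/
theorem IsLattice.eventually_card_qInf_mul (hΛ : IsLattice Λ r) (hπ : Irreducible π) :
    ∀ᶠ R : ℝ in atTop, Nat.card (ballSub (lsub Λ) (qInf O * R)) =
        qInf O ^ r * Nat.card (ballSub (lsub Λ) R) := by
  obtain ⟨a, b, m, ha, hb, -, hma, hmb⟩ := exists_uniformizer_mul_eq F hπ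
  apply eventually_of_eventually_qInf_mul (O := O) m _ F
  filter_upwards [hΛ.eventually_card_of_degA ha hma, hΛ.eventually_card_of_degA hb hmb] with R h1 h2
  rw [← mul_assoc, ← pow_succ', h1, h2, pow_succ', mul_assoc]

theorem card_ballSub_mono : Monotone fun R : ℝ ↦ Nat.card (ballSub (lsub Λ) R) := by
  intro R R' h
  have : Finite (ballSub (lsub Λ) R' : Set (CInf F O)) :=
    inferInstanceAs (Finite (ballSub (lsub Λ) R'))
  refine Nat.card_mono (Set.toFinite (ballSub (lsub Λ) R' : Set (CInf F O))) fun x hx ↦ ⟨hx.1, hx.2.trans ?_⟩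
  exact max_le_max_right _ h

theorem IsLattice.tendsto_card_ballSub (hΛ : IsLattice Λ r) (hr : 1 ≤ r) (hπ : Irreducible π) :
    Tendsto (fun R : ℝ ↦ Nat.card (ballSub (lsub Λ) R)) atTop atTop := by
  have hQ := two_le_qInf F O
  have hQ' : (1 : ℝ) ≤ qInf O := (one_lt_qInf' F O).le
  obtain ⟨R₀, hR₀⟩ := eventually_atTop.1 (hΛ.eventually_card_qInf_mul hπ)
  refine tendsto_atTop_atTop_of_monotone card_ballSub_mono fun n ↦ ?_
  induction n with
  | zero => exact ⟨0, Nat.zero_le _⟩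
  | succ n ih =>
    obtain ⟨R, hR⟩ := ih
    refine ⟨qInf O * max (max R R₀) 0, ?_⟩
    rw [hR₀ _ (by simp)]
    have h1 : Nat.card (ballSub (lsub Λ) R) ≤ Nat.card (ballSub (lsub Λ) (max (max R R₀) 0)) :=
      card_ballSub_mono (by simp)
    have h2 : 0 < Nat.card (ballSub (lsub Λ) (max (max R R₀) 0)) := Nat.card_pos
    have h3 : 2 ≤ qInf O ^ r := hQ.trans (Nat.le_self_pow (by omega) _)
    nlinarith

end CanonicalDiscriminant

end DrinfeldLattice

/-! ### The canonical discriminant as a limit -/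

namespace DrinfeldLattice

open Filter Topology

section CanonicalDiscriminantLimit

variable {F K : Type*} [Field F] [Field K] [Algebra F K] [IsGlobalFunctionField F K]
  {O : ValuationSubring K} [IsDiscreteValuationRing O]
  {Λ : Submodule (coeffRing F O) (CInf F O)} {r : ℕ} {a : coeffRing F O} {π : O}

theorem algebraMap_uniformizer_ne_zero (hπ : Irreducible π) :
    algebraMap K (CInf F O) (π : K) ≠ 0 := by
  rw [Ne, _root_.map_eq_zero]
  exact fun h ↦ hπ.ne_zero (Subtype.ext h)

/-- A convergent net with finitely many values is eventually constant. -/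
theorem eventually_eq_of_tendsto_of_finite {X ι : Type*} [TopologicalSpace X] [T1Space X]
    {l : Filter ι} {f : ι → X} {x : X} {s : Set X} (hs : s.Finite) (hf : ∀ i, f i ∈ s)
    (h : Tendsto f l (𝓝 x)) : ∀ᶠ i in l, f i = x := by
  have h1 : (s \ {x})ᶜ ∈ 𝓝 x := (hs.sdiff.isClosed.isOpen_compl).mem_nhds (by simp)
  filter_upwards [h h1] with i hi
  by_contra hne
  exact hi ⟨hf i, hne⟩

variable [Finite F] [IsDiscreteSubspace (lsub Λ)]

/-- Ball sizes are powers of q, so v^B - 1 = (v - 1)^B, which tends to 0. -/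
theorem tendsto_pow_card_ballSub (hB : Tendsto (fun R : ℝ ↦ Nat.card (ballSub (lsub Λ) R)) atTop atTop)
    {v : CInf F O} (hv : ‖v - 1‖ < 1) :
    Tendsto (fun R : ℝ ↦ v ^ Nat.card (ballSub (lsub Λ) R)) atTop (𝓝 1) := by
  rw [tendsto_iff_norm_sub_tendsto_zero]
  refine ((tendsto_pow_atTop_nhds_zero_of_lt_one (norm_nonneg _) hv).comp hB).congr fun R ↦ ?_
  rw [Function.comp_apply, Module.natCard_eq_pow_finrank (K := F) (V := ballSub (lsub Λ) R),
    ← norm_pow, sub_pow_card_pow F, one_pow]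

/-- The product of the nonzero elements of norm at most `R`, up to sign. -/
noncomputable def latProd (Λ : Submodule (coeffRing F O) (CInf F O)) [IsDiscreteSubspace (lsub Λ)]
    (R : ℝ) : CInf F O :=
  nzProd (ballSub (lsub Λ) R)

theorem latProd_ne_zero (R : ℝ) : latProd Λ R ≠ 0 := nzProd_ne_zero _

/-- The sequence converging to the canonical discriminant (for `m = 1`). -/
noncomputable def discrSeq (π : O) (Λ : Submodule (coeffRing F O) (CInf F O))
    [IsDiscreteSubspace (lsub Λ)] (r m : ℕ) (R : ℝ) : CInf F O :=
  (algebraMap K (CInf F O) π ^ (m * Nat.card (ballSub (lsub Λ) ((qInf O : ℝ) ^ m * R))))⁻¹ *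
    (latProd Λ R ^ (qInf O ^ r) ^ m / latProd Λ ((qInf O : ℝ) ^ m * R))

/-- Substituting a = u π^(-m) in the limit for Δ_a separates the power of `u` from a factor that
depends on `a` only through m. -/
theorem IsLattice.tendsto_mul_discrSeq (hΛ : IsLattice Λ r) (hπ : Irreducible π) (ha : a ≠ 0) {m : ℕ}
    (hm : Nat.card F ^ degA F O a = qInf O ^ m) {u : CInf F O}
    (hu : u = algebraMap K (CInf F O) a * algebraMap K (CInf F O) π ^ m) :
    Tendsto (fun R : ℝ ↦ u ^ Nat.card (ballSub (lsub Λ) ((qInf O : ℝ) ^ m * R)) *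
      discrSeq π Λ r m R) atTop (𝓝 (drinfeldDiscr Λ r a)) := by
  have hm' : (Nat.card F : ℝ) ^ degA F O a = (qInf O : ℝ) ^ m := by exact_mod_cast hm
  have hϖ := algebraMap_uniformizer_ne_zero (F := F) hπ
  refine (hΛ.tendsto_drinfeldDiscr ha).congr' ?_
  filter_upwards [hΛ.eventually_card_of_degA ha hm] with R hR
  have hu' : ∀ B : ℕ, u ^ B = algebraMap K (CInf F O) a ^ B *
      algebraMap K (CInf F O) π ^ (m * B) := fun B ↦ by rw [hu, mul_pow, ← pow_mul]
  change (_ * latProd Λ R) ^ _ / latProd Λ (_ * R) = _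
  rw [hm', card_pow_mul_degA hm, discrSeq, hu', ← mul_assoc,
    mul_inv_cancel_right₀ (pow_ne_zero _ hϖ), hR, mul_pow, ← pow_mul (algebraMap K (CInf F O) a),
    mul_div_assoc, mul_comm (Nat.card _)]

/-- The sequence defining the canonical discriminant converges. -/
theorem IsLattice.exists_tendsto_discrSeq (hΛ : IsLattice Λ r) (hπ : Irreducible π) :
    ∃ D : CInf F O, D ≠ 0 ∧ Tendsto (discrSeq π Λ r 1) atTop (𝓝 D) := by
  obtain ⟨a, b, m, ha, hb, hab, hma, hmb⟩ := exists_uniformizer_mul_eq F hπ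
  have hma' : (Nat.card F : ℝ) ^ degA F O a = (qInf O : ℝ) ^ m := by exact_mod_cast hma
  have hmb' : (Nat.card F : ℝ) ^ degA F O b = (qInf O : ℝ) ^ (m + 1) := by exact_mod_cast hmb
  have hϖ := algebraMap_uniformizer_ne_zero (F := F) hπ
  have hα := algebraMap_coeffRing_ne_zero ha
  have hβ := algebraMap_coeffRing_ne_zero hb
  -- The exponents for `b` and `a` are E q_∞^r + 1 and E, which dictates this quotient. Because π b
  -- = a holds exactly, the powers of `a` and `b` in the limits leave only a power of π.
  refine ⟨drinfeldDiscr Λ r b / drinfeldDiscr Λ r a ^ qInf O ^ r,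
    div_ne_zero (hΛ.drinfeldDiscr_ne_zero hb) (pow_ne_zero _ (hΛ.drinfeldDiscr_ne_zero ha)), ?_⟩
  have h1 : Tendsto (fun R : ℝ ↦ discrSeq π Λ r 1 ((qInf O : ℝ) ^ m * R)) atTop
      (𝓝 (drinfeldDiscr Λ r b / drinfeldDiscr Λ r a ^ qInf O ^ r)) := by
    refine ((hΛ.tendsto_drinfeldDiscr hb).div ((hΛ.tendsto_drinfeldDiscr ha).pow (qInf O ^ r))
      (pow_ne_zero _ (hΛ.drinfeldDiscr_ne_zero ha))).congr' ?_
    filter_upwards [hΛ.eventually_card_of_degA hb hmb] with R hR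
    have hR' : (qInf O : ℝ) ^ 1 * ((qInf O : ℝ) ^ m * R) = (qInf O : ℝ) ^ (m + 1) * R := by ring
    have hc := latProd_ne_zero (Λ := Λ) R
    have hc1 := latProd_ne_zero (Λ := Λ) ((qInf O : ℝ) ^ m * R)
    have hc2 := latProd_ne_zero (Λ := Λ) ((qInf O : ℝ) ^ (m + 1) * R)
    change (_ * latProd Λ R) ^ _ / latProd Λ (_ * R) /
      ((_ * latProd Λ R) ^ _ / latProd Λ (_ * R)) ^ _ = _
    rw [discrSeq, hma', hmb', hR', hR, card_pow_mul_degA hma, card_pow_mul_degA hmb,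
      ← hab, pow_one, one_mul]
    generalize Nat.card (ballSub (lsub Λ) R) = B at *
    generalize latProd Λ R = c at *
    generalize latProd Λ ((qInf O : ℝ) ^ m * R) = c1 at *
    generalize latProd Λ ((qInf O : ℝ) ^ (m + 1) * R) = c2 at *
    generalize algebraMap K (CInf F O) π = x at *
    generalize algebraMap K (CInf F O) b = y at *
    generalize qInf O ^ r = Q at *
    rw [div_pow, ← pow_mul (_ * c), ← pow_succ, mul_pow x, mul_pow, mul_pow, mul_pow, ← pow_mul x,
      mul_comm B]
    field_simp
  have h2 : Tendsto (fun R : ℝ ↦ ((qInf O : ℝ) ^ m)⁻¹ * R) atTop atTop :=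
    tendsto_id.const_mul_atTop (inv_pos.2 (pow_pos (by linarith [one_lt_qInf' F O]) m))
  refine (h1.comp h2).congr fun R ↦ ?_
  rw [Function.comp_apply, mul_inv_cancel_left₀]
  exact pow_ne_zero _ (by linarith [one_lt_qInf' F O])

/-- Writing D_m for `discrSeq` with parameter m and Q = q_∞, for large R one has D_(m+1)(R) =
D_m(R)^(Q^r) D_1(Q^m R), which matches the recursion of the geometric sums. -/
theorem IsLattice.tendsto_discrSeq (hΛ : IsLattice Λ r) (hπ : Irreducible π) {D : CInf F O}
    (hD : Tendsto (discrSeq π Λ r 1) atTop (𝓝 D)) (m : ℕ) :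
    Tendsto (discrSeq π Λ r m) atTop (𝓝 (D ^ ∑ i ∈ Finset.range m, (qInf O ^ r) ^ i)) := by
  have hϖ := algebraMap_uniformizer_ne_zero (F := F) hπ
  induction m with
  | zero =>
    refine tendsto_const_nhds.congr fun R ↦ ?_
    have hc := latProd_ne_zero (Λ := Λ) R
    simp [discrSeq, hc]
  | succ m ih =>
    rw [Finset.sum_range_succ']
    simp only [pow_succ _ (_ : ℕ)]
    rw [← Finset.sum_mul, pow_zero, pow_succ, pow_mul]
    refine ((ih.pow (qInf O ^ r)).mul (hD.comp (tendsto_qInf_mul F O m))).congr' ?_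
    filter_upwards [(tendsto_qInf_mul F O m).eventually (hΛ.eventually_card_qInf_mul hπ)] with R hR
    have hR' : (qInf O : ℝ) ^ 1 * ((qInf O : ℝ) ^ m * R) = (qInf O : ℝ) ^ (m + 1) * R := by ring
    have hR2 : (qInf O : ℝ) * ((qInf O : ℝ) ^ m * R) = (qInf O : ℝ) ^ (m + 1) * R := by ring
    have hc1 := latProd_ne_zero (Λ := Λ) ((qInf O : ℝ) ^ m * R)
    have hc2 := latProd_ne_zero (Λ := Λ) ((qInf O : ℝ) ^ (m + 1) * R)
    rw [Function.comp_apply, discrSeq, discrSeq, discrSeq, hR', ← hR2, hR, hR2, pow_one, one_mul]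
    generalize Nat.card (ballSub (lsub Λ) ((qInf O : ℝ) ^ m * R)) = B at *
    generalize latProd Λ R = c at *
    generalize latProd Λ ((qInf O : ℝ) ^ m * R) = c1 at *
    generalize latProd Λ ((qInf O : ℝ) ^ (m + 1) * R) = c2 at *
    generalize algebraMap K (CInf F O) π = x at *
    rw [mul_pow, div_pow, inv_pow, ← pow_mul, ← pow_mul c, ← pow_succ, add_mul, one_mul, pow_add,
      mul_assoc m B, mul_comm B]
    field_simp
    ring

/-- Write a π^m = ζ v with ζ the Teichmüller representative and v a 1-unit. The powers of v with
ball sizes as exponents tend to 1, so the powers of ζ converge to Δ_a / D^E. -/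
theorem IsLattice.drinfeldDiscr_eq_of_tendsto (hΛ : IsLattice Λ r) (hr : 1 ≤ r) (hπ : Irreducible π)
    {D : CInf F O} (hD0 : D ≠ 0) (hD : Tendsto (discrSeq π Λ r 1) atTop (𝓝 D)) :
    IsCanonicalDiscr π Λ r D := by
  intro a ha
  have hp := two_le_qInf F O
  have hϖ := algebraMap_uniformizer_ne_zero (F := F) hπ
  obtain ⟨m, hm⟩ := exists_card_pow_degA_eq ha
  have hπ0 : (π : K) ≠ 0 := fun h ↦ hπ.ne_zero (Subtype.ext h)
  have ha0 : (a : K) ≠ 0 := fun h ↦ ha (Subtype.ext h)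
  obtain ⟨u, j, hu⟩ := exists_eq_mul_zpow (O := O) hπ (mul_ne_zero ha0 (pow_ne_zero m hπ0))
  have hj : j = 0 := by
    have h1 := congrArg (absInf F O) hu
    have hm' : (Nat.card F : ℝ) ^ degA F O a = (qInf O : ℝ) ^ m := by exact_mod_cast hm
    have hQ := one_lt_qInf' F O
    rw [absInf_mul_zpow u hπ, map_mul, map_pow, absInf_uniformizer F O hπ,
      absInf_eq_pow_degA ha, hm', inv_pow, mul_inv_cancel₀ (pow_ne_zero _ (by linarith))] at h1
    have h2 := zpow_right_injective₀ (by linarith) hQ.ne' ((zpow_zero _).trans h1)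
    omega
  rw [hj, zpow_zero, mul_one] at hu
  obtain ⟨ζ, hζ1, hζ⟩ := exists_teichmuller (F := F) u
  rw [← hu] at hζ
  have hsgn : IsSgn π a ζ := ⟨hζ1, m, by rwa [zpow_natCast]⟩
  refine ⟨ζ, hsgn, ?_⟩
  have hζn := hsgn.norm_eq_one
  have hζ0 : ζ ≠ 0 := by rintro rfl; simp at hζn
  have hΔ := hΛ.tendsto_mul_discrSeq hπ ha hm (u := algebraMap K (CInf F O) ((a : K) * (π : K) ^ m))
    (by rw [map_mul, map_pow])
  have hH := hΛ.tendsto_discrSeq hπ hD m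
  rw [← discrExponent_eq_sum hr hm] at hH
  set x := algebraMap K (CInf F O) ((a : K) * (π : K) ^ m)
  have hx0 : x ≠ 0 := by
    rintro h
    rw [h, zero_sub, norm_neg, hζn] at hζ
    exact lt_irrefl _ hζ
  have hB := hΛ.tendsto_card_ballSub hr hπ
  have hv : ‖x / ζ - 1‖ < 1 := by
    rw [div_sub_one hζ0, norm_div, hζn, div_one]
    exact hζ
  have hv' := (tendsto_pow_card_ballSub hB hv).comp (tendsto_qInf_mul F O m)
  have hD' : D ^ discrExponent r a ≠ 0 := pow_ne_zero _ hD0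
  have h1 : Tendsto (fun R : ℝ ↦ ζ ^ Nat.card (ballSub (lsub Λ) ((qInf O : ℝ) ^ m * R))) atTop
      (𝓝 (drinfeldDiscr Λ r a / D ^ discrExponent r a / 1)) := by
    refine ((hΔ.div hH hD').div hv' one_ne_zero).congr' ?_
    filter_upwards [hH.eventually_ne hD'] with R hR
    rw [Pi.div_apply, Pi.div_apply, mul_div_cancel_right₀ _ hR, Function.comp_apply, div_pow,
      div_div_cancel₀ (pow_ne_zero _ hx0)]
  -- Powers of a root of unity take finitely many values, so convergence means being eventually
  -- constant; this also gives the stationarity of sgn(a)^#Λ_R.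
  have h2 := eventually_eq_of_tendsto_of_finite (s := Set.range fun i : Fin (qInf O - 1) ↦ ζ ^ (i : ℕ))
    (Set.finite_range _) (fun R ↦ ⟨⟨_ % _, Nat.mod_lt _ (by omega)⟩,
      (pow_eq_pow_mod _ hζ1).symm⟩) h1
  have h3 := eventually_of_eventually_qInf_mul (O := O)
    (p := fun R ↦ ζ ^ Nat.card (ballSub (lsub Λ) R) = _) m h2 F
  filter_upwards [h3, eventually_ge_atTop 0] with R hR hR0
  have h4 : Nat.card {x : CInf F O // x ∈ Λ ∧ ‖x‖ ≤ R} = Nat.card (ballSub (lsub Λ) R) :=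
    Nat.card_congr (Equiv.subtypeEquivRight fun x ↦ (mem_ballSub (Λ := lsub Λ) hR0).symm)
  rw [h4, hR, div_one, div_mul_cancel₀ _ hD']

end CanonicalDiscriminantLimit

/-! ### Uniqueness and absolute value of the canonical discriminant -/

section Main

variable {F K : Type*} [Field F] [Field K] [Algebra F K] [IsGlobalFunctionField F K]
  {O : ValuationSubring K} [IsDiscreteValuationRing O]
  {Λ : Submodule (coeffRing F O) (CInf F O)} {r : ℕ} {a : coeffRing F O} {π : O}

theorem IsLattice.existsUnique_isCanonicalDiscr (hΛ : IsLattice Λ r) (hr : 1 ≤ r)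
    (hπ : Irreducible π) : ∃! D, IsCanonicalDiscr π Λ r D := by
  have := finite_constants_of F K
  have := hΛ.isDiscreteSubspace
  obtain ⟨D₀, hD₀, hlim⟩ := hΛ.exists_tendsto_discrSeq hπ
  refine existsUnique_of_exists_of_unique
    ⟨D₀, hΛ.drinfeldDiscr_eq_of_tendsto hr hπ hD₀ hlim⟩ fun D D' hD hD' ↦ ?_
  have key : ∀ a : coeffRing F O, a ≠ 0 → D ^ discrExponent r a ≠ 0 ∧
      D ^ discrExponent r a = D' ^ discrExponent r a := by
    intro a ha
    obtain ⟨ζ, hζ, h⟩ := hD a ha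
    obtain ⟨ζ', hζ', h'⟩ := hD' a ha
    obtain rfl := hζ.unique hπ hζ'
    obtain ⟨R, h1, h2⟩ := (h.and h').exists
    have h3 := hΛ.drinfeldDiscr_ne_zero ha
    rw [h1] at h2 h3
    exact ⟨right_ne_zero_of_mul h3, mul_left_cancel₀ (left_ne_zero_of_mul h3) h2⟩
  obtain ⟨a, b, m, ha, hb, -, hma, hmb⟩ := exists_uniformizer_mul_eq F hπ
  obtain ⟨h1, h2⟩ := key a ha
  obtain ⟨-, h3⟩ := key b hb
  -- The two exponents are coprime, so agreement of these two powers, which are nonzero, forces D =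
  -- D'.
  have h4 : discrExponent r b = discrExponent r a * qInf O ^ r + 1 := by
    rw [discrExponent_eq_sum hr hma, discrExponent_eq_sum hr hmb, Finset.sum_range_succ',
      Finset.sum_mul, pow_zero]
    simp only [pow_succ]
  rw [h4, pow_succ, pow_succ, pow_mul, pow_mul, ← h2] at h3
  exact mul_left_cancel₀ (pow_ne_zero _ h1) h3

/-- One `a` of positive degree suffices: roots of unity have norm 1, the exponent E satisfies E
(q_∞^r - 1) = q^(rd) - 1, and E ≠ 0 can be cancelled in the logarithm of (ii). -/
theorem IsLattice.norm_eq_of_drinfeldDiscr_eq (hΛ : IsLattice Λ r) (hr : 1 ≤ r) {D : CInf F O}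
    (hD : ∀ a : coeffRing F O, a ≠ 0 → ∃ ζ : CInf F O,
        (∃ m : ℕ, 0 < m ∧ ζ ^ m = 1) ∧
        drinfeldDiscr Λ r a = ζ * D ^ discrExponent r a) :
    ‖D‖ = (Nat.card F : ℝ) ^ ((((qInf O : ℚ) ^ r - 1) * zDeriv Λ : ℚ) : ℝ) := by
  have hq : (1 : ℝ) < Nat.card F := by exact_mod_cast one_lt_card_constants F K
  have hQ := one_lt_qInf' F O
  obtain ⟨a, ha, hd⟩ := exists_degA_pos F O
  obtain ⟨m, hm⟩ := exists_card_pow_degA_eq ha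
  obtain ⟨ζ, ⟨j, hj, hζ⟩, h⟩ := hD a ha
  have hm0 : 0 < m := by
    rcases Nat.eq_zero_or_pos m with rfl | h
    · rw [pow_zero] at hm
      exact absurd hm (Nat.one_lt_pow hd.ne' (one_lt_card_constants F K)).ne'
    · exact h
  have hmr : (Nat.card F : ℝ) ^ (r * degA F O a) = ((qInf O : ℝ) ^ r) ^ m := by
    exact_mod_cast card_pow_mul_degA (r := r) hm
  have hQr : (1 : ℝ) < (qInf O : ℝ) ^ r := one_lt_pow₀ hQ (by omega)
  have he : (discrExponent r a : ℝ) * ((qInf O : ℝ) ^ r - 1) = ((qInf O : ℝ) ^ r) ^ m - 1 := by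
    rw [discrExponent_eq_sum hr hm]
    push_cast
    exact geom_sum_mul _ _
  have he0 : (discrExponent r a : ℝ) ≠ 0 := by
    intro h0
    rw [h0, zero_mul] at he
    have := one_lt_pow₀ hQr hm0.ne'
    linarith
  have hD0 : D ≠ 0 := by
    rintro rfl
    have h1 := hΛ.drinfeldDiscr_ne_zero ha
    rw [h, zero_pow (by exact_mod_cast he0), mul_zero] at h1
    exact h1 rfl
  have h1 := hΛ.norm_drinfeldDiscr hr ha
  have h2 := congrArg (Real.logb (Nat.card F)) h1
  rw [h, norm_mul, norm_eq_one_of_pow_eq_one hj.ne' hζ, one_mul, norm_pow, Real.logb_pow,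
    Real.logb_rpow (by linarith) hq.ne'] at h2
  apply norm_eq_rpow_of_logb hD0
  apply mul_left_cancel₀ he0
  push_cast at h2 ⊢
  rw [h2, hmr, ← he, mul_assoc]

theorem IsLattice.norm_canonicalDiscr (hΛ : IsLattice Λ r) (hr : 1 ≤ r) (hπ : Irreducible π) :
    ‖canonicalDiscr π Λ r‖ = (Nat.card F : ℝ) ^
      ((((qInf O : ℚ) ^ r - 1) * zDeriv Λ : ℚ) : ℝ) := by
  have hu := hΛ.existsUnique_isCanonicalDiscr hr hπ
  rw [canonicalDiscr, dif_pos hu]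
  refine hΛ.norm_eq_of_drinfeldDiscr_eq hr fun a ha ↦ ?_
  obtain ⟨ζ, hζ, h⟩ := hu.exists.choose_spec a ha
  obtain ⟨R, hR⟩ := h.exists
  have hp := two_le_qInf F O
  refine ⟨_, ⟨qInf O - 1, by omega, ?_⟩, hR⟩
  rw [pow_right_comm, hζ.1, one_pow]

end Main

end DrinfeldLattice

theorem mainTheorem10 {F K : Type*} [Field F] [Field K] [Algebra F K] [IsGlobalFunctionField F K]
    (O : ValuationSubring K) [IsDiscreteValuationRing O] (π : O) (hπ : Irreducible π)
    (r : ℕ) (hr : 1 ≤ r)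
    (Λ Λ' : Submodule (coeffRing F O) (CInf F O))
    (hΛ : IsLattice Λ r) (hΛ' : IsLattice Λ' r) (hle : Λ ≤ Λ') :
    (∃! z, IsZDerivAtOne Λ z) ∧ (∃! z, IsZDerivAtOne Λ' z) ∧
    -- (i)
    ‖pairDiscr Λ Λ'‖ = (Nat.card F : ℝ) ^
      ((latticeIndex Λ Λ' * zDeriv Λ -
        zDeriv Λ' : ℚ) : ℝ) ∧
    -- (ii)
    (∀ a : coeffRing F O, a ≠ 0 →
      ‖drinfeldDiscr Λ r a‖ = (Nat.card F : ℝ) ^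
        ((((Nat.card F : ℚ) ^ (r * degA F O a) - 1) *
          zDeriv Λ : ℚ) : ℝ)) ∧
    -- (iii)
    ‖canonicalDiscr π Λ r‖ = (Nat.card F : ℝ) ^
      ((((qInf O : ℚ) ^ r - 1) * zDeriv Λ : ℚ) : ℝ) ∧
    -- the same for every discriminant that is normalized only up to roots of unity
    (∀ D : CInf F O,
      (∀ a : coeffRing F O, a ≠ 0 → ∃ ζ : CInf F O,
        (∃ m : ℕ, 0 < m ∧ ζ ^ m = 1) ∧
        drinfeldDiscr Λ r a = ζ * D ^ discrExponent r a) →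
      ‖D‖ = (Nat.card F : ℝ) ^
        ((((qInf O : ℚ) ^ r - 1) * zDeriv Λ : ℚ) : ℝ)) := by
  refine ⟨hΛ.existsUnique_zDeriv hr, hΛ'.existsUnique_zDeriv hr, hΛ.norm_pairDiscr hΛ' hr hle,
    fun a ha ↦ hΛ.norm_drinfeldDiscr hr ha, hΛ.norm_canonicalDiscr hr hπ,
    fun D hD ↦ hΛ.norm_eq_of_drinfeldDiscr_eq hr hD⟩
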